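/- Conventions. Let $A$ and $B$ be C$^*$-algebras. For a (right) Hilbert $B$-module $X$ (with inner product $\langle\cdot,\cdot\rangle$ linear in the second variable), $\mathcal L_B(X,Y)$ denotes the adjointable operators $X\to Y$, $\mathcal L_B(X)=\mathcal L_B(X,X)$, and $\mathcal K_B(X)\subset\mathcal L_B(X)$ denotes the compact operators, i.e. the closed linear span of the operators $\zeta\mapsto\xi\langle\eta,\zeta\rangle$, $\xi,\eta\in X$. The module $X$ is countably generated if there is a sequence $(\xi_n)$ in $X$ such that the linear span of $\{\xi_n b : n\in\mathbb N,\ b\in B\}$ is dense in $X$. A C$^*$-correspondence $(X,\pi_X)$ from $A$ to $B$ is a Hilbert $B$-module $X$ with a $*$-homomorphism $\pi_X:A\to\mathcal L_B(X)$; it is unital if $A$ and $\pi_X$ are unital. We write $Y^\infty$ for the Hilbert $B$-module of sequences $(y_n)_{n\in\mathbb N}$ in $Y$ such that $\sum_n\langle y_n,y_n\rangle$ converges in norm, and $\pi_Y^\infty(a)(y_n)_n=(\pi_Y(a)y_n)_n$. Let $(H,\pi_H)$ be the universal representation of $B$, i.e. the direct sum of the GNS representations of all states of $B$, and let $\pi_H(B)'\subset\mathcal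 B(H)$ be the commutant. For a correspondence $(X,\pi_X)$ let $X\otimes_B H$ be the interior tensor product (the separation and completion of the algebraic tensor product with respect to $\langle\xi\otimes h,\xi'\otimes h'\rangle=\langle h,\pi_H(\langle\xi,\xi'\rangle)h'\rangle$), and let $\theta_X:A\otimes_{\max}\pi_H(B)'\to\mathcal B(X\otimes_B H)$ be the $*$-representation determined by $\theta_X(a\otimes x)=\pi_X(a)\otimes x$. We write $(X,\pi_X)\prec_{\mathrm{univ}}(Y,\pi_Y)$ if $\ker\theta_Y\subset\ker\theta_X$. Two correspondences $(E,\pi)$, $(F,\rho)$ from $A$ to $B$ are approximately unitarily equivalent if there is a sequence of unitaries $U_n\in\mathcal L_B(E,F)$ such that for every $a\in A$ one has $\pi(a)-U_n^*\rho(a)U_n\in\mathcal K_B(E)$ for all $n$ and $\lim_{n}\|\pi(a)-U_n^*\rho(a)U_n\|=0$. Theorem. Let $A$ be a unital C$^*$-algebra and $B$ a $\sigma$-unital C$^*$-algebra, and let $(X,\pi_X)$ and $(Y,\pi_Y)$ be unital C$^*$-correspondences from $A$ to $B$ with $X$ countably generated. 1. $(X,\pi_X)\prec_{\mathrm{univ}}(Y,\pi_Y)$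 if and only if there is a net of unitaries $U_i\in\mathcal L_B(X\oplus Y^\infty,Y^\infty)$ such that $$\lim_i\|(\pi_X(a)\oplus\pi_Y^\infty(a))-U_i^*\pi_Y^\infty(a)U_i\|=0\qquad\text{for all }a\in A.$$ 2. If $A$ is separable, then $(X,\pi_X)\prec_{\mathrm{univ}}(Y,\pi_Y)$ if and only if $(X\oplus Y^\infty,\pi_X\oplus\pi_Y^\infty)$ and $(Y^\infty,\pi_Y^\infty)$ are approximately unitarily equivalent. -/

import Mathlib

set_option linter.unusedSectionVars false

open scoped TensorProduct InnerProductSpace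
open Filter Topology

noncomputable section

namespace HilbertMod

/-! ## Adjointable operators

Everything in this part is for `CStarModule D E`. A (right) Hilbert C⋆-module over `B` is a complete
`CStarModule Bᵐᵒᵖ X`: the right action is `ξ · b = MulOpposite.op b • ξ`, the `B`-valued inner product
is `(inner Bᵐᵒᵖ ξ η).unop`, and the law `inner ξ (op b • η) = op b * inner ξ η` reads
`⟨ξ, η b⟩ = ⟨ξ, η⟩ b`. -/

/-- `S` is an adjoint of `T`, i.e. `⟨T x, y⟩ = ⟨x, S y⟩`. -/
def IsAdjoint (D : Type*) {E F : Type*} [NonUnitalCStarAlgebra D] [PartialOrder D]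
    [NormedAddCommGroup E] [NormedSpace ℂ E] [SMul D E] [CStarModule D E]
    [NormedAddCommGroup F] [NormedSpace ℂ F] [SMul D F] [CStarModule D F]
    (T : E →L[ℂ] F) (S : F →L[ℂ] E) : Prop :=
  ∀ x y, inner D (T x) y = inner D x (S y)

section Adjointable

variable {D E F : Type*} [NonUnitalCStarAlgebra D] [PartialOrder D] [StarOrderedRing D]
  [NormedAddCommGroup E] [NormedSpace ℂ E] [SMul D E] [CStarModule D E]
  [NormedAddCommGroup F] [NormedSpace ℂ F] [SMul D F] [CStarModule D F]

variable (D) in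
theorem ext_inner {x y : E} (h : ∀ z : E, inner D z x = inner D z y) : x = y := by
  rw [← sub_eq_zero, ← CStarModule.inner_self (A := D)]
  simp [h]

theorem IsAdjoint.symm {T : E →L[ℂ] F} {S : F →L[ℂ] E} (h : IsAdjoint D T S) :
    IsAdjoint D S T := fun x y => by
  rw [← CStarModule.star_inner, ← h, CStarModule.star_inner]

theorem IsAdjoint.unique {T : E →L[ℂ] F} {S S' : F →L[ℂ] E} (h : IsAdjoint D T S)
    (h' : IsAdjoint D T S') : S = S' :=
  ContinuousLinearMap.ext fun y => ext_inner D fun z => by rw [← h, ← h']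

variable (D E) in
/-- The adjointable operators on `E`, as a subalgebra of the bounded operators. -/
def adjSubalgebra : Subalgebra ℂ (E →L[ℂ] E) where
  carrier := {T | ∃ S, IsAdjoint D T S}
  mul_mem' := by
    rintro T T' ⟨S, h⟩ ⟨S', h'⟩
    exact ⟨S' * S, fun x y => by
      simp only [mul_apply_eq_comp]; rw [h, h']⟩
  add_mem' := by
    rintro T T' ⟨S, h⟩ ⟨S', h'⟩
    refine ⟨S + S', fun x y => ?_⟩
    simp [h x y, h' x y]
  algebraMap_mem' c := ⟨algebraMap ℂ _ (star c), fun x y => by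
    simp [Algebra.algebraMap_eq_smul_one]⟩

variable (D E) in
/-- The algebra `𝓛(E)` of adjointable operators on `E`, with the operator norm. -/
def AdjEnd : Type _ := adjSubalgebra D E

instance : NormedRing (AdjEnd D E) := inferInstanceAs (NormedRing (adjSubalgebra D E))
instance : NormedAlgebra ℂ (AdjEnd D E) := inferInstanceAs (NormedAlgebra ℂ (adjSubalgebra D E))

/-- The inclusion of `𝓛(E)` into the bounded operators. -/
def AdjEnd.val : AdjEnd D E →ₐ[ℂ] (E →L[ℂ] E) := (adjSubalgebra D E).val

/-- The adjointable operator given by an adjoint pair. -/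
def AdjEnd.mk (T S : E →L[ℂ] E) (h : IsAdjoint D T S) : AdjEnd D E := ⟨T, S, h⟩

instance : CoeFun (AdjEnd D E) fun _ => E → E := ⟨fun T => AdjEnd.val T⟩

@[simp] theorem AdjEnd.val_mk (T S : E →L[ℂ] E) (h : IsAdjoint D T S) :
    (AdjEnd.mk T S h).val = T := rfl

theorem AdjEnd.val_injective : Function.Injective (AdjEnd.val (D := D) (E := E)) :=
  Subtype.val_injective

theorem AdjEnd.norm_val (T : AdjEnd D E) : ‖T.val‖ = ‖T‖ := rfl

theorem AdjEnd.isometry_val : Isometry (AdjEnd.val (D := D) (E := E)) := isometry_subtype_coe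

instance : Star (AdjEnd D E) where
  star T := AdjEnd.mk T.2.choose T.val T.2.choose_spec.symm

theorem AdjEnd.inner_apply_left (T : AdjEnd D E) (x y : E) :
    inner D (T.val x) y = inner D x ((star T).val y) := T.2.choose_spec x y

theorem AdjEnd.inner_apply_right (T : AdjEnd D E) (x y : E) :
    inner D ((star T).val x) y = inner D x (T.val y) := T.2.choose_spec.symm x y

theorem AdjEnd.star_eq {T S : AdjEnd D E} (h : IsAdjoint D T.val S.val) : star T = S :=
  AdjEnd.val_injective (IsAdjoint.unique T.2.choose_spec h)

instance : StarRing (AdjEnd D E) where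
  star_involutive T := AdjEnd.star_eq T.inner_apply_right
  star_mul T S := AdjEnd.star_eq fun x y => by
    simp [AdjEnd.inner_apply_left]
  star_add T S := AdjEnd.star_eq fun x y => by
    simp [AdjEnd.inner_apply_left]

instance : StarModule ℂ (AdjEnd D E) where
  star_smul c T := AdjEnd.star_eq fun x y => by
    simp [AdjEnd.inner_apply_left]

theorem AdjEnd.norm_sq_le (T : AdjEnd D E) : ‖T‖ * ‖T‖ ≤ ‖star T * T‖ := by
  have h : ∀ x, ‖T.val x‖ ≤ √‖star T * T‖ * ‖x‖ := fun x => by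
    refine abs_le_of_sq_le_sq' ?_ (by positivity) |>.2
    rw [mul_pow, Real.sq_sqrt (norm_nonneg _), CStarModule.norm_sq_eq D, T.inner_apply_left]
    calc _ ≤ ‖x‖ * ‖(star T * T).val x‖ := by
          rw [map_mul]; exact CStarModule.norm_inner_le E
      _ ≤ ‖x‖ * (‖star T * T‖ * ‖x‖) := by
        gcongr
        exact (star T * T).val.le_opNorm x
      _ = _ := by ring
  have h2 : ‖T‖ ≤ √‖star T * T‖ := T.val.opNorm_le_bound (by positivity) h
  calc ‖T‖ * ‖T‖ ≤ √‖star T * T‖ * √‖star T * T‖ := by gcongr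
    _ = _ := Real.mul_self_sqrt (norm_nonneg _)

instance : CStarRing (AdjEnd D E) where
  norm_mul_self_le := AdjEnd.norm_sq_le

instance [CompleteSpace E] : CompleteSpace (AdjEnd D E) := by
  refine Metric.complete_of_cauchySeq_tendsto fun v hv => ?_
  have hv' : CauchySeq fun n => (star (v n)).val := by
    have h1 : CauchySeq fun n => star (v n) :=
      hv.map (starₗᵢ ℂ (E := AdjEnd D E)).isometry.uniformContinuous
    exact h1.map AdjEnd.isometry_val.uniformContinuous
  have hv'' : CauchySeq fun n => (v n).val := hv.map AdjEnd.isometry_val.uniformContinuous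
  obtain ⟨T, hT⟩ := cauchySeq_tendsto_of_complete hv''
  obtain ⟨S, hS⟩ := cauchySeq_tendsto_of_complete hv'
  have h : IsAdjoint D T S := fun x y => by
    have e1 : Tendsto (fun n => inner D ((v n).val x) y) atTop (𝓝 (inner D (T x) y)) :=
      (CStarModule.continuous_inner (A := D) (E := E)).tendsto (T x, y) |>.comp
        (((ContinuousLinearMap.apply ℂ E x).continuous.tendsto T |>.comp hT).prodMk_nhds
          tendsto_const_nhds)
    have e2 : Tendsto (fun n => inner D x ((star (v n)).val y)) atTop (𝓝 (inner D x (S y))) :=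
      (CStarModule.continuous_inner (A := D) (E := E)).tendsto (x, S y) |>.comp
        (tendsto_const_nhds.prodMk_nhds
          ((ContinuousLinearMap.apply ℂ E y).continuous.tendsto S |>.comp hS))
    exact tendsto_nhds_unique e1 (e2.congr fun n => ((v n).inner_apply_left x y).symm)
  exact ⟨AdjEnd.mk T S h, AdjEnd.isometry_val.isEmbedding.tendsto_nhds_iff.2 hT⟩

/-- `𝓛(E)` is a unital C⋆-algebra. -/
instance [CompleteSpace E] : CStarAlgebra (AdjEnd D E) where

/-! ### Compact operators -/

theorem add_smul' (d d' : D) (x : E) : (d + d') • x = d • x + d' • x :=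
  ext_inner D fun z => by simp [add_mul]

theorem smul_smul_comm (c : ℂ) (d : D) (x : E) : (c • d) • x = c • (d • x) :=
  ext_inner D fun z => by simp [smul_mul_assoc]

theorem norm_smul_le' (d : D) (x : E) : ‖d • x‖ ≤ ‖d‖ * ‖x‖ := by
  refine abs_le_of_sq_le_sq' ?_ (by positivity) |>.2
  rw [CStarModule.norm_sq_eq D]
  simp only [CStarModule.inner_op_smul_right, CStarModule.inner_op_smul_left]
  calc _ ≤ ‖d‖ * (‖inner D x x‖ * ‖star d‖) :=
        (norm_mul_le _ _).trans (by gcongr; exact norm_mul_le _ _)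
    _ = _ := by rw [← CStarModule.norm_sq_eq D, norm_star]; ring

variable (D) in
/-- The rank one operator `θ_{ξ,η} ζ = ξ ⟨η, ζ⟩`, as a bounded operator. -/
def rankOneCLM (ξ η : E) : E →L[ℂ] E :=
  LinearMap.mkContinuous
    { toFun := fun ζ => (inner D η ζ : D) • ξ
      map_add' := fun x y => by simp [add_smul']
      map_smul' := fun c x => by simp [smul_smul_comm] }
    (‖η‖ * ‖ξ‖) fun ζ => by
      calc _ ≤ ‖inner D η ζ‖ * ‖ξ‖ := norm_smul_le' _ _
        _ ≤ (‖η‖ * ‖ζ‖) * ‖ξ‖ := by gcongr; exact CStarModule.norm_inner_le E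
        _ = _ := by ring

variable (D) in
/-- The rank one operator `θ_{ξ,η} ζ = ξ ⟨η, ζ⟩`, as an adjointable operator. -/
def rankOne (ξ η : E) : AdjEnd D E :=
  .mk (rankOneCLM D ξ η) (rankOneCLM D η ξ) fun x y => by
    simp [rankOneCLM]

variable (D E) in
/-- The compact operators `𝓚(E)`: the closed linear span of the rank one operators
in `𝓛(E)`. -/
def Compacts : Submodule ℂ (AdjEnd D E) :=
  (Submodule.span ℂ {T | ∃ ξ η : E, T = rankOne D ξ η}).topologicalClosure

variable (D E) in
/-- `E` is countably generated: `E` is the closed linear span of `{ξₙ d | n ∈ ℕ, d ∈ D}` for some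
sequence `ξ`. -/
def CountablyGenerated : Prop :=
  ∃ ξ : ℕ → E, (Submodule.span ℂ {x : E | ∃ (n : ℕ) (d : D), x = d • ξ n}).topologicalClosure = ⊤

variable (D E F) in
/-- Unitaries `U` in `𝓛(E, F)`: adjointable operators with `U⋆U = 1` and `UU⋆ = 1`. -/
structure UnitaryMap where
  toCLM : E →L[ℂ] F
  adj : F →L[ℂ] E
  isAdjoint : IsAdjoint D toCLM adj
  adj_comp : adj ∘L toCLM = ContinuousLinearMap.id ℂ E
  comp_adj : toCLM ∘L adj = ContinuousLinearMap.id ℂ F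

/-- `U⋆ T U ∈ 𝓛(E)` for a unitary `U ∈ 𝓛(E, F)` and `T ∈ 𝓛(F)`. -/
def UnitaryMap.conj (U : UnitaryMap D E F) (T : AdjEnd D F) : AdjEnd D E :=
  .mk (U.adj ∘L T.val ∘L U.toCLM) (U.adj ∘L (star T).val ∘L U.toCLM) fun x y => by
    simp only [ContinuousLinearMap.comp_apply]
    rw [U.isAdjoint.symm, T.inner_apply_left, U.isAdjoint]

theorem exists_star_mul_self_eq {C : Type*} [CStarAlgebra C] (t : C) :
    ∃ s : C, star s * s = ((‖t‖ ^ 2 : ℝ) : ℂ) • (1 : C) - star t * t := by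
  let _ := CStarAlgebra.spectralOrder C
  have := CStarAlgebra.spectralOrderedRing C
  have h : 0 ≤ ((‖t‖ ^ 2 : ℝ) : ℂ) • (1 : C) - star t * t := by
    rw [sub_nonneg, Complex.coe_smul, ← Algebra.algebraMap_eq_smul_one]
    exact CStarAlgebra.star_mul_le_algebraMap_norm_sq
  obtain ⟨s, hs⟩ := CStarAlgebra.nonneg_iff_eq_star_mul_self.1 h
  exact ⟨s, hs.symm⟩

theorem AdjEnd.inner_apply_le [CompleteSpace E] (T : AdjEnd D E) (x : E) :
    inner D (T.val x) (T.val x) ≤ ((‖T‖ ^ 2 : ℝ) : ℂ) • (inner D x x : D) := by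
  obtain ⟨S, hS⟩ := exists_star_mul_self_eq T
  have h3 : (star S).val (S.val x) = (((‖T‖ ^ 2 : ℝ) : ℂ) • x) - (star T).val (T.val x) := by
    have h2 : (star S * S).val x = (((‖T‖ ^ 2 : ℝ) : ℂ) • (1 : AdjEnd D E) - star T * T).val x := by
      rw [hS]
    simpa using h2
  rw [← sub_nonneg]
  have h : ((‖T‖ ^ 2 : ℝ) : ℂ) • (inner D x x : D) - inner D (T.val x) (T.val x)
      = inner D (S.val x) (S.val x) := by
    rw [S.inner_apply_left, T.inner_apply_left, h3, CStarModule.inner_sub_right,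
      CStarModule.inner_smul_right_complex]
  rw [h]
  exact CStarModule.inner_self_nonneg

end Adjointable

/-! ## Direct sums -/

section Prod

open scoped WithCStarModule

variable {A D E F : Type*} [CStarAlgebra A] [NonUnitalCStarAlgebra D] [PartialOrder D]
  [StarOrderedRing D]
  [NormedAddCommGroup E] [NormedSpace ℂ E] [SMul D E] [CStarModule D E]
  [NormedAddCommGroup F] [NormedSpace ℂ F] [SMul D F] [CStarModule D F]

variable (D) in
/-- The bounded operator `T ⊕ S` on the Hilbert module `E ⊕ F`. -/
def prodCLM (T : E →L[ℂ] E) (S : F →L[ℂ] F) : C⋆ᵐᵒᵈ(D, E × F) →L[ℂ] C⋆ᵐᵒᵈ(D, E × F) :=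
  (WithCStarModule.equivL ℂ (A := D) (E := E × F)).symm.toContinuousLinearMap ∘L T.prodMap S ∘L
    (WithCStarModule.equivL ℂ (A := D) (E := E × F)).toContinuousLinearMap

@[simp] theorem prodCLM_fst (T : E →L[ℂ] E) (S : F →L[ℂ] F) (x : C⋆ᵐᵒᵈ(D, E × F)) :
    (prodCLM D T S x).1 = T x.1 := rfl

@[simp] theorem prodCLM_snd (T : E →L[ℂ] E) (S : F →L[ℂ] F) (x : C⋆ᵐᵒᵈ(D, E × F)) :
    (prodCLM D T S x).2 = S x.2 := rfl

/-- The adjointable operator `T ⊕ S` on `E ⊕ F`. -/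
def AdjEnd.prod (T : AdjEnd D E) (S : AdjEnd D F) : AdjEnd D C⋆ᵐᵒᵈ(D, E × F) :=
  .mk (prodCLM D T.val S.val) (prodCLM D (star T).val (star S).val) fun x y => by
    simp [WithCStarModule.prod_inner, AdjEnd.inner_apply_left]

@[simp] theorem AdjEnd.val_prod (T : AdjEnd D E) (S : AdjEnd D F) :
    (T.prod S).val = prodCLM D T.val S.val := rfl

theorem AdjEnd.star_prod (T : AdjEnd D E) (S : AdjEnd D F) :
    star (T.prod S) = (star T).prod (star S) :=
  AdjEnd.star_eq fun x y => by simp [WithCStarModule.prod_inner, AdjEnd.inner_apply_left]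

/-- The direct sum `π ⊕ ρ : A → 𝓛(E ⊕ F)` of two left actions. -/
def prodRep (π : A →⋆ₐ[ℂ] AdjEnd D E) (ρ : A →⋆ₐ[ℂ] AdjEnd D F) :
    A →⋆ₐ[ℂ] AdjEnd D C⋆ᵐᵒᵈ(D, E × F) :=
  StarAlgHom.mk
    (AlgHom.ofLinearMap
      { toFun := fun a => (π a).prod (ρ a)
        map_add' := fun a b => by
          rw [map_add, map_add]
          exact AdjEnd.val_injective <| ContinuousLinearMap.ext fun x => Prod.ext rfl rfl
        map_smul' := fun c a => by
          rw [map_smul, map_smul]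
          exact AdjEnd.val_injective <| ContinuousLinearMap.ext fun x => Prod.ext rfl rfl }
      (by
        change (π 1).prod (ρ 1) = 1
        rw [map_one, map_one]
        exact AdjEnd.val_injective <| ContinuousLinearMap.ext fun x => Prod.ext rfl rfl)
      fun a b => by
        change (π (a * b)).prod (ρ (a * b)) = (π a).prod (ρ a) * (π b).prod (ρ b)
        rw [map_mul, map_mul]
        exact AdjEnd.val_injective <| ContinuousLinearMap.ext fun x => Prod.ext rfl rfl)
    fun a => by
      simp [AdjEnd.star_prod, map_star]

end Prod

section Infinite

variable {A D E : Type*} [CStarAlgebra A] [NonUnitalCStarAlgebra D] [PartialOrder D]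
  [StarOrderedRing D]
  [NormedAddCommGroup E] [NormedSpace ℂ E] [SMul D E] [CStarModule D E]

theorem summable_of_nonneg_of_le {f g : ℕ → D} (hf : ∀ n, 0 ≤ f n) (hfg : ∀ n, f n ≤ g n)
    (hg : Summable g) : Summable f := by
  rw [summable_iff_vanishing_norm] at hg ⊢
  intro ε hε
  obtain ⟨s, hs⟩ := hg ε hε
  refine ⟨s, fun t ht => lt_of_le_of_lt ?_ (hs t ht)⟩
  exact CStarAlgebra.norm_le_norm_of_nonneg_of_le (Finset.sum_nonneg fun i _ => hf i)
    (Finset.sum_le_sum fun i _ => hfg i)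

variable (D) in
theorem inner_add_self_le (x y : E) :
    (inner D (x + y) (x + y) : D) ≤ (2 : ℂ) • (inner D x x + inner D y y) := by
  rw [← sub_nonneg]
  have h : (2 : ℂ) • (inner D x x + inner D y y) - (inner D (x + y) (x + y) : D)
      = inner D (x - y) (x - y) := by
    simp [two_smul]
    abel
  rw [h]
  exact CStarModule.inner_self_nonneg

variable (D E) in
/-- The sequences `x` in `E` for which `∑ ⟨xₙ, xₙ⟩` converges in norm. -/
def l2Submodule : Submodule ℂ (ℕ → E) where
  carrier := {x | Summable fun n => (inner D (x n) (x n) : D)}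
  zero_mem' := by simp
  add_mem' {x y} hx hy := summable_of_nonneg_of_le (fun _ => CStarModule.inner_self_nonneg)
    (fun n => inner_add_self_le D (x n) (y n)) ((hx.add hy).const_smul 2)
  smul_mem' c x hx := by
    have h : Summable fun n => c • star c • (inner D (x n) (x n) : D) :=
      (Summable.const_smul (star c) hx).const_smul c
    simpa using h

variable (D E) in
/-- The Hilbert module `E^∞`, the direct sum of countably many copies of `E`: sequences `x` in `E`
such that `∑ ⟨xₙ, xₙ⟩` converges in norm, with inner product `⟨x, y⟩ = ∑ ⟨xₙ, yₙ⟩`. -/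
def InfSum : Type _ := l2Submodule D E

namespace InfSum

instance : AddCommGroup (InfSum D E) := inferInstanceAs (AddCommGroup (l2Submodule D E))
instance : Module ℂ (InfSum D E) := inferInstanceAs (Module ℂ (l2Submodule D E))

/-- The underlying sequence. -/
def seq : InfSum D E →ₗ[ℂ] (ℕ → E) := (l2Submodule D E).subtype

theorem seq_injective : Function.Injective (seq (D := D) (E := E)) := Subtype.val_injective

@[ext] theorem ext {x y : InfSum D E} (h : ∀ n, x.seq n = y.seq n) : x = y :=
  seq_injective (funext h)

/-- The element of `E^∞` given by a sequence. -/
def mk (x : ℕ → E) (hx : Summable fun n => (inner D (x n) (x n) : D)) : InfSum D E := ⟨x, hx⟩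

@[simp] theorem seq_mk (x : ℕ → E) (hx : Summable fun n => (inner D (x n) (x n) : D)) :
    (mk x hx).seq = x := rfl

theorem summable_self (x : InfSum D E) : Summable fun n => (inner D (x.seq n) (x.seq n) : D) := x.2

theorem summable_inner (x y : InfSum D E) :
    Summable fun n => (inner D (x.seq n) (y.seq n) : D) := by
  have h := ((((x + y).summable_self.sub (x - y).summable_self).sub
    ((x + Complex.I • y).summable_self.const_smul Complex.I)).add
    ((x - Complex.I • y).summable_self.const_smul Complex.I)).const_smul (4⁻¹ : ℂ)
  refine h.congr fun n => ?_
  simp only [map_add, map_sub, map_smul, Pi.add_apply, Pi.sub_apply, Pi.smul_apply,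
    CStarModule.inner_add_right, CStarModule.inner_add_left, CStarModule.inner_sub_right,
    CStarModule.inner_sub_left, CStarModule.inner_smul_right_complex,
    CStarModule.inner_smul_left_complex, smul_add, smul_sub, smul_smul]
  simp only [Complex.star_def, Complex.conj_I, mul_neg, Complex.I_mul_I, neg_neg, mul_one]
  module

instance : SMul D (InfSum D E) where
  smul d x := mk (fun n => d • x.seq n) <| by
    have h := (x.summable_self.mul_right (star d)).mul_left d
    refine h.congr fun n => ?_
    simp

@[simp] theorem seq_smul (d : D) (x : InfSum D E) (n : ℕ) : (d • x).seq n = d • x.seq n := rfl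

instance : Inner D (InfSum D E) where
  inner x y := ∑' n, inner D (x.seq n) (y.seq n)

theorem inner_def (x y : InfSum D E) :
    (inner D x y : D) = ∑' n, inner D (x.seq n) (y.seq n) := rfl

instance : Norm (InfSum D E) := CStarModule.norm D

instance : CStarModule D (InfSum D E) where
  inner_add_right {x y z} := by
    simp only [inner_def, map_add, Pi.add_apply, CStarModule.inner_add_right]
    exact (summable_inner x y).tsum_add (summable_inner x z)
  inner_self_nonneg := tsum_nonneg fun _ => CStarModule.inner_self_nonneg
  inner_self {x} := by
    refine ⟨fun h => ext fun n => ?_, fun h => by simp [h, inner_def]⟩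
    rw [map_zero, Pi.zero_apply, ← CStarModule.inner_self (A := D)]
    refine le_antisymm ?_ CStarModule.inner_self_nonneg
    rw [← h]
    exact x.summable_self.le_tsum n fun _ _ => CStarModule.inner_self_nonneg
  inner_op_smul_right {d x y} := by
    simp only [inner_def, seq_smul, CStarModule.inner_op_smul_right]
    exact (summable_inner x y).tsum_mul_left d
  inner_smul_right_complex {c x y} := by
    simp only [inner_def, map_smul, Pi.smul_apply, CStarModule.inner_smul_right_complex]
    exact (summable_inner x y).tsum_const_smul c
  star_inner x y := by
    simp only [inner_def]
    rw [tsum_star]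
    simp
  norm_eq_sqrt_norm_inner_self x := rfl

instance : NormedAddCommGroup (InfSum D E) := CStarModule.normedAddCommGroup D

instance : NormedSpace ℂ (InfSum D E) := .ofCore (CStarModule.normedSpaceCore D)

theorem norm_sum_inner_le (x : InfSum D E) (t : Finset ℕ) :
    ‖∑ n ∈ t, (inner D (x.seq n) (x.seq n) : D)‖ ≤ ‖x‖ ^ 2 := by
  rw [CStarModule.norm_sq_eq D]
  exact CStarAlgebra.norm_le_norm_of_nonneg_of_le
    (Finset.sum_nonneg fun _ _ => CStarModule.inner_self_nonneg)
    (x.summable_self.sum_le_tsum t fun _ _ => CStarModule.inner_self_nonneg)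

theorem norm_seq_le (x : InfSum D E) (n : ℕ) : ‖x.seq n‖ ≤ ‖x‖ := by
  refine abs_le_of_sq_le_sq' ?_ (norm_nonneg _) |>.2
  simpa [← CStarModule.norm_sq_eq D] using norm_sum_inner_le x {n}

instance [CompleteSpace E] : CompleteSpace (InfSum D E) := by
  refine Metric.complete_of_cauchySeq_tendsto fun v hv => ?_
  have hc : ∀ n, ∃ y, Tendsto (fun m => (v m).seq n) atTop (𝓝 y) := fun n => by
    refine cauchySeq_tendsto_of_complete ?_
    rw [Metric.cauchySeq_iff'] at hv ⊢
    intro ε hε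
    obtain ⟨N, hN⟩ := hv ε hε
    refine ⟨N, fun m hm => lt_of_le_of_lt ?_ (hN m hm)⟩
    rw [dist_eq_norm, dist_eq_norm]
    simpa using norm_seq_le (v m - v N) n
  choose y hy using hc
  have key : ∀ ε > 0, ∃ N, ∀ k ≥ N, ∀ t : Finset ℕ,
      ‖∑ n ∈ t, (inner D (y n - (v k).seq n) (y n - (v k).seq n) : D)‖ ≤ ε ^ 2 := by
    intro ε hε
    obtain ⟨N, hN⟩ := Metric.cauchySeq_iff.1 hv ε hε
    refine ⟨N, fun k hk t => ?_⟩
    have hl : Tendsto (fun m => ‖∑ n ∈ t, (inner D ((v m).seq n - (v k).seq n)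
        ((v m).seq n - (v k).seq n) : D)‖) atTop
        (𝓝 ‖∑ n ∈ t, (inner D (y n - (v k).seq n) (y n - (v k).seq n) : D)‖) := by
      refine (tendsto_finsetSum t fun n _ => ?_).norm
      have h1 := (hy n).sub_const ((v k).seq n)
      exact ((CStarModule.continuous_inner (A := D) (E := E)).tendsto
        (y n - (v k).seq n, y n - (v k).seq n)).comp (h1.prodMk_nhds h1)
    refine le_of_tendsto hl (eventually_atTop.2 ⟨N, fun m hm => ?_⟩)
    have h2 := norm_sum_inner_le (v m - v k) t
    have h3 : ‖v m - v k‖ < ε := by rw [← dist_eq_norm]; exact hN m hm k hk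
    have h4 : ‖v m - v k‖ ^ 2 ≤ ε ^ 2 := by gcongr
    simp only [map_sub, Pi.sub_apply] at h2
    exact h2.trans h4
  have hsum : Summable fun n => (inner D (y n) (y n) : D) := by
    rw [summable_iff_vanishing_norm]
    intro ε hε
    obtain ⟨N, hN⟩ := key (√(ε / 5)) (by positivity)
    obtain ⟨s, hs⟩ := summable_iff_vanishing_norm.1 (v N).summable_self (ε / 5) (by positivity)
    refine ⟨s, fun t ht => ?_⟩
    have h1 := hN N le_rfl t
    rw [Real.sq_sqrt (by positivity)] at h1
    have h2 := hs t ht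
    have h3 : ‖∑ n ∈ t, (inner D (y n) (y n) : D)‖ ≤
        ‖(2 : ℂ) • (∑ n ∈ t, (inner D (y n - (v N).seq n) (y n - (v N).seq n) : D) +
          ∑ n ∈ t, (inner D ((v N).seq n) ((v N).seq n) : D))‖ := by
      refine CStarAlgebra.norm_le_norm_of_nonneg_of_le
        (Finset.sum_nonneg fun _ _ => CStarModule.inner_self_nonneg) ?_
      rw [← Finset.sum_add_distrib, Finset.smul_sum]
      refine Finset.sum_le_sum fun n _ => ?_
      simpa using inner_add_self_le D (y n - (v N).seq n) ((v N).seq n)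
    rw [norm_smul] at h3
    have h4 := norm_add_le (∑ n ∈ t, (inner D (y n - (v N).seq n) (y n - (v N).seq n) : D))
      (∑ n ∈ t, (inner D ((v N).seq n) ((v N).seq n) : D))
    simp only [Complex.norm_ofNat] at h3
    linarith
  refine ⟨mk y hsum, Metric.tendsto_atTop.2 fun ε hε => ?_⟩
  obtain ⟨N, hN⟩ := key (ε / 2) (by positivity)
  refine ⟨N, fun k hk => ?_⟩
  rw [dist_comm, dist_eq_norm]
  have h : ‖mk y hsum - v k‖ ≤ ε / 2 := by
    refine abs_le_of_sq_le_sq' ?_ (by positivity) |>.2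
    rw [CStarModule.norm_sq_eq D]
    have hl := (mk y hsum - v k).summable_self.hasSum.norm
    refine le_of_tendsto hl (Eventually.of_forall fun t => ?_)
    simpa using hN k hk t
  linarith

variable [CompleteSpace E]

theorem summable_apply (T : AdjEnd D E) (x : InfSum D E) :
    Summable fun n => (inner D (T.val (x.seq n)) (T.val (x.seq n)) : D) :=
  summable_of_nonneg_of_le (fun _ => CStarModule.inner_self_nonneg)
    (fun n => T.inner_apply_le (x.seq n)) (x.summable_self.const_smul _)

/-- The diagonal operator `T^∞ x = (T xₙ)ₙ` on `E^∞`, as a linear map. -/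
def diagLinear (T : AdjEnd D E) : InfSum D E →ₗ[ℂ] InfSum D E where
  toFun x := mk (fun n => T.val (x.seq n)) (summable_apply T x)
  map_add' x y := ext fun n => by simp
  map_smul' c x := ext fun n => by simp

theorem norm_diagLinear_le (T : AdjEnd D E) (x : InfSum D E) :
    ‖diagLinear T x‖ ≤ ‖T‖ * ‖x‖ := by
  refine abs_le_of_sq_le_sq' ?_ (by positivity) |>.2
  rw [mul_pow, CStarModule.norm_sq_eq D (x := x), CStarModule.norm_sq_eq D (x := diagLinear T x)]
  have h := CStarAlgebra.norm_le_norm_of_nonneg_of_le (A := D)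
    (tsum_nonneg fun n => CStarModule.inner_self_nonneg (x := T.val (x.seq n)))
    ((summable_apply T x).tsum_le_tsum
      (fun n => T.inner_apply_le (x.seq n)) (x.summable_self.const_smul _))
  rw [x.summable_self.tsum_const_smul, norm_smul] at h
  simpa [inner_def, diagLinear] using h

/-- The diagonal operator `T^∞`, as a bounded operator on `E^∞`. -/
def diagCLM (T : AdjEnd D E) : InfSum D E →L[ℂ] InfSum D E :=
  (diagLinear T).mkContinuous ‖T‖ (norm_diagLinear_le T)

@[simp] theorem diagCLM_seq (T : AdjEnd D E) (x : InfSum D E) (n : ℕ) :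
    (diagCLM T x).seq n = T.val (x.seq n) := rfl

/-- The diagonal operator `T^∞`, as an adjointable operator on `E^∞`. -/
def diag (T : AdjEnd D E) : AdjEnd D (InfSum D E) :=
  .mk (diagCLM T) (diagCLM (star T)) fun x y => by
    simp [inner_def, AdjEnd.inner_apply_left]

@[simp] theorem val_diag (T : AdjEnd D E) : (diag T).val = diagCLM T := rfl

theorem star_diag (T : AdjEnd D E) : star (diag T) = diag (star T) :=
  AdjEnd.star_eq fun x y => by simp [inner_def, AdjEnd.inner_apply_left]

/-- The left action `π^∞ : A → 𝓛(E^∞)`. -/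
def rep (π : A →⋆ₐ[ℂ] AdjEnd D E) : A →⋆ₐ[ℂ] AdjEnd D (InfSum D E) :=
  StarAlgHom.mk
    (AlgHom.ofLinearMap
      { toFun := fun a => diag (π a)
        map_add' := fun a b => AdjEnd.val_injective <| ContinuousLinearMap.ext fun x =>
          ext fun n => by simp
        map_smul' := fun c a => AdjEnd.val_injective <| ContinuousLinearMap.ext fun x =>
          ext fun n => by simp }
      (AdjEnd.val_injective <| ContinuousLinearMap.ext fun x => ext fun n => by simp)
      fun a b => AdjEnd.val_injective <| ContinuousLinearMap.ext fun x => ext fun n => by simp)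
    fun a => by
      simp [star_diag, map_star]

end InfSum

end Infinite

/-! ## The interior tensor product with a representation -/

section Tensor

variable {B X H : Type*} [NonUnitalCStarAlgebra B] [PartialOrder B] [StarOrderedRing B]

theorem exists_negPart {N : Type*} [NonUnitalCStarAlgebra N] (m : N) (hm : IsSelfAdjoint m) :
    ∃ c w : N, star c = c ∧ star c * m * c = -(star w * w) ∧ c * c * c = star w * w ∧
      (c = 0 → ∃ y, m = star y * y) := by
  let _ := CStarAlgebra.spectralOrder N
  have := CStarAlgebra.spectralOrderedRing N
  have hneg : 0 ≤ m⁻ := CFC.negPart_nonneg m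
  have hsa : star m⁻ = m⁻ := (IsSelfAdjoint.of_nonneg hneg).star_eq
  have hN : 0 ≤ star m⁻ * m⁻ * m⁻ := star_left_conjugate_nonneg hneg m⁻
  obtain ⟨w, hw⟩ := CStarAlgebra.nonneg_iff_eq_star_mul_self.1 hN
  refine ⟨m⁻, w, hsa, ?_, by rw [← hw, hsa], fun h => ?_⟩
  · have hmm : m * m⁻ = -(m⁻ * m⁻) := by
      have h1 : (m⁺ - m⁻) * m⁻ = -(m⁻ * m⁻) := by
        rw [sub_mul, CFC.posPart_mul_negPart, zero_sub]
      rwa [CFC.posPart_sub_negPart m hm] at h1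
    rw [← hw, mul_assoc, hmm, mul_neg, mul_assoc]
  · exact CStarAlgebra.nonneg_iff_eq_star_mul_self.1 ((CFC.negPart_eq_zero_iff m hm).1 h)

/-- A self-adjoint matrix `M` over `B` with `∑ bᵢ⋆ Mᵢⱼ bⱼ ≥ 0` for all `b` is of the form `y⋆y`. -/
theorem exists_eq_star_mul_self_of_form_nonneg {n : Type*} [Fintype n]
    (M : CStarMatrix n n B) (hM : IsSelfAdjoint M)
    (h : ∀ b : n → B, 0 ≤ ∑ i, ∑ j, star (b i) * M i j * b j) :
    ∃ y : CStarMatrix n n B, M = star y * y := by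
  obtain ⟨c, w, hsa, hconj, hw, hfin⟩ := exists_negPart M hM
  have hw0 : w = 0 := by
    ext l k
    have h1 : 0 ≤ (star c * M * c) k k := by
      have h0 := h fun i => c i k
      rw [Finset.sum_comm] at h0
      simpa [CStarMatrix.mul_apply, Finset.sum_mul, CStarMatrix.star_apply] using h0
    have h2 : (star w * w) k k = ∑ l, star (w l k) * w l k := by
      simp [CStarMatrix.mul_apply, CStarMatrix.star_apply]
    rw [hconj, CStarMatrix.neg_apply, h2, neg_nonneg] at h1
    have h3 := Finset.sum_nonneg fun l (_ : l ∈ Finset.univ) => star_mul_self_nonneg (w l k)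
    have h4 := (Finset.sum_eq_zero_iff_of_nonneg fun l _ => star_mul_self_nonneg (w l k)).1
      (le_antisymm h1 h3) l (Finset.mem_univ l)
    simpa using h4
  rw [hw0, mul_zero] at hw
  have hz : c * c = 0 := by
    rw [← CStarRing.star_mul_self_eq_zero_iff, star_mul, hsa, ← mul_assoc, hw, zero_mul]
  exact hfin (by rw [← CStarRing.star_mul_self_eq_zero_iff, hsa, hz])

variable [NormedAddCommGroup X] [NormedSpace ℂ X] [SMul Bᵐᵒᵖ X] [CStarModule Bᵐᵒᵖ X]
  [NormedAddCommGroup H] [InnerProductSpace ℂ H] [CompleteSpace H]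

variable (B) in
/-- The `B`-valued inner product of a right Hilbert `B`-module, linear in the second variable. -/
def rinner (x y : X) : B := (inner Bᵐᵒᵖ x y : Bᵐᵒᵖ).unop

@[simp] theorem rinner_add_right (x y z : X) :
    rinner B x (y + z) = rinner B x y + rinner B x z := by simp [rinner]

@[simp] theorem rinner_add_left (x y z : X) :
    rinner B (x + y) z = rinner B x z + rinner B y z := by simp [rinner]

@[simp] theorem rinner_smul_right (c : ℂ) (x y : X) :
    rinner B x (c • y) = c • rinner B x y := by simp [rinner]

@[simp] theorem rinner_smul_left (c : ℂ) (x y : X) :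
    rinner B (c • x) y = star c • rinner B x y := by simp [rinner]

theorem star_rinner (x y : X) : star (rinner B x y) = rinner B y x := by
  simp [rinner, ← MulOpposite.unop_star]

theorem rinner_nonneg (x : X) : 0 ≤ rinner B x x :=
  MulOpposite.unop_nonneg.2 CStarModule.inner_self_nonneg

theorem rinner_sum_sum {n : Type*} [Fintype n] (x : n → X) (b : n → B) :
    rinner B (∑ i, MulOpposite.op (b i) • x i) (∑ i, MulOpposite.op (b i) • x i)
      = ∑ i, ∑ j, star (b i) * rinner B (x i) (x j) * b j := by
  rw [Finset.sum_comm]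
  simp [rinner, Finset.mul_sum, mul_assoc]

/-- The form `⟨ξ ⊗ η, ξ' ⊗ η'⟩ = ⟨η, π(⟨ξ, ξ'⟩) η'⟩` on the algebraic tensor product. -/
def tensorForm (π : B →⋆ₙₐ[ℂ] (H →L[ℂ] H)) : X ⊗[ℂ] H →ₗ⋆[ℂ] X ⊗[ℂ] H →ₗ[ℂ] ℂ :=
  TensorProduct.lift <| LinearMap.mk₂'ₛₗ (starRingEnd ℂ) (starRingEnd ℂ)
    (fun ξ η => TensorProduct.lift <| LinearMap.mk₂ ℂ
      (fun ξ' η' => (⟪η, π (rinner B ξ ξ') η'⟫_ℂ : ℂ))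
      (fun x y h => by simp) (fun c x h => by simp) (fun x h k => by simp)
      (fun c x h => by simp))
    (fun x y h => TensorProduct.ext' fun x' h' => by simp)
    (fun c x h => TensorProduct.ext' fun x' h' => by simp)
    (fun x h k => TensorProduct.ext' fun x' h' => by simp)
    (fun c x h => TensorProduct.ext' fun x' h' => by simp [mul_comm])

@[simp] theorem tensorForm_tmul (π : B →⋆ₙₐ[ℂ] (H →L[ℂ] H)) (ξ ξ' : X) (η η' : H) :
    tensorForm π (ξ ⊗ₜ η) (ξ' ⊗ₜ η') = ⟪η, π (rinner B ξ ξ') η'⟫_ℂ := rfl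

theorem tensorForm_conj (π : B →⋆ₙₐ[ℂ] (H →L[ℂ] H)) (z w : X ⊗[ℂ] H) :
    starRingEnd ℂ (tensorForm π w z) = tensorForm π z w := by
  induction z with
  | zero => simp
  | add z z' hz hz' => simp [hz, hz']
  | tmul ξ η =>
    induction w with
    | zero => simp
    | add w w' hw hw' => simp [hw, hw']
    | tmul ξ' η' =>
      rw [tensorForm_tmul, tensorForm_tmul, inner_conj_symm, ← star_rinner, map_star,
        ContinuousLinearMap.star_eq_adjoint, ContinuousLinearMap.adjoint_inner_left]

theorem tensorForm_self_nonneg (π : B →⋆ₙₐ[ℂ] (H →L[ℂ] H)) (z : X ⊗[ℂ] H) :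
    0 ≤ (tensorForm π z z).re := by
  obtain ⟨k, ξ, η, rfl⟩ := TensorProduct.exists_sum_tmul_eq z
  obtain ⟨y, hy⟩ := exists_eq_star_mul_self_of_form_nonneg
    (CStarMatrix.ofMatrix (Matrix.of fun i j => rinner B (ξ i) (ξ j)))
    (by ext i j; simp [CStarMatrix.star_apply, star_rinner])
    (fun b => by
      have h := rinner_nonneg (B := B) (∑ i, MulOpposite.op (b i) • ξ i)
      rw [rinner_sum_sum] at h
      exact h)
  have hy' : ∀ i j, rinner B (ξ i) (ξ j) = ∑ l, star (y l i) * y l j := fun i j => by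
    have := congrFun (congrFun hy i) j
    rw [CStarMatrix.mul_apply] at this
    exact this
  have h : tensorForm π (∑ j, ξ j ⊗ₜ[ℂ] η j) (∑ j, ξ j ⊗ₜ[ℂ] η j)
      = ∑ l, ⟪∑ i, π (y l i) (η i), ∑ j, π (y l j) (η j)⟫_ℂ := by
    simp only [map_sum, LinearMap.sum_apply, tensorForm_tmul, hy', map_mul, map_star,
      sum_apply, inner_sum, sum_inner, mul_apply_eq_comp,
      ContinuousLinearMap.star_eq_adjoint, ContinuousLinearMap.adjoint_inner_right]
    exact (Finset.sum_congr rfl fun _ _ => Finset.sum_comm).trans Finset.sum_comm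
  rw [h, Complex.re_sum]
  exact Finset.sum_nonneg fun l _ => inner_self_nonneg (𝕜 := ℂ)


/-- The algebraic tensor product `X ⊙ H` with the semi-inner product given by `π`. -/
def PreTensor (X : Type*) {B H : Type*} [NonUnitalCStarAlgebra B]
    [NormedAddCommGroup X] [NormedSpace ℂ X]
    [NormedAddCommGroup H] [InnerProductSpace ℂ H] [CompleteSpace H]
    (_π : B →⋆ₙₐ[ℂ] (H →L[ℂ] H)) : Type _ := X ⊗[ℂ] H

variable (π : B →⋆ₙₐ[ℂ] (H →L[ℂ] H))

namespace PreTensor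

instance : AddCommGroup (PreTensor X π) := inferInstanceAs (AddCommGroup (X ⊗[ℂ] H))
instance : Module ℂ (PreTensor X π) := inferInstanceAs (Module ℂ (X ⊗[ℂ] H))

variable (X) in
/-- The identity map from the algebraic tensor product. -/
def of : X ⊗[ℂ] H ≃ₗ[ℂ] PreTensor X π := LinearEquiv.refl ℂ _

/-- The semi-inner product on `X ⊙ H`. -/
abbrev core : PreInnerProductSpace.Core ℂ (PreTensor X π) where
  inner z w := tensorForm π ((of X π).symm z) ((of X π).symm w)
  conj_inner_symm z w := tensorForm_conj π _ _
  re_inner_nonneg z := tensorForm_self_nonneg π _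
  add_left z w v := by simp
  smul_left z w c := by simp

instance : SeminormedAddCommGroup (PreTensor X π) :=
  InnerProductSpace.Core.toSeminormedAddCommGroup (c := core π)

instance : InnerProductSpace ℂ (PreTensor X π) := InnerProductSpace.ofCore (core π)

theorem inner_def (z w : X ⊗[ℂ] H) :
    ⟪of X π z, of X π w⟫_ℂ = tensorForm π z w := rfl

end PreTensor

variable (X) in
/-- The interior tensor product `X ⊗_B H`: the Hilbert space obtained from `X ⊙ H` by separation
and completion. -/
abbrev IntTensor : Type _ := UniformSpace.Completion (PreTensor X π)

/-- The commutant `π(B)'` in the bounded operators on `H`. -/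
abbrev Commutant : StarSubalgebra ℂ (H →L[ℂ] H) := StarSubalgebra.centralizer ℂ (Set.range π)

instance : IsClosed (Commutant π : Set (H →L[ℂ] H)) := by
  rw [StarSubalgebra.coe_centralizer]
  exact Set.isClosed_centralizer _

variable [CompleteSpace X]

/-- `T ⊙ x` on `X ⊙ H`. -/
def tensorLinear (T : AdjEnd Bᵐᵒᵖ X) (x : Commutant π) : PreTensor X π →ₗ[ℂ] PreTensor X π :=
  (PreTensor.of X π).toLinearMap ∘ₗ
    TensorProduct.map (T.val : X →ₗ[ℂ] X) (x.1 : H →ₗ[ℂ] H) ∘ₗ (PreTensor.of X π).symm.toLinearMap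

theorem tensorLinear_tmul (T : AdjEnd Bᵐᵒᵖ X) (x : Commutant π) (ξ : X) (η : H) :
    tensorLinear π T x (PreTensor.of X π (ξ ⊗ₜ η)) = PreTensor.of X π (T.val ξ ⊗ₜ x.1 η) := rfl

theorem commutant_apply (x : Commutant π) (b : B) (η : H) : π b (x.1 η) = x.1 (π b η) := by
  have h := (StarSubalgebra.mem_centralizer_iff ℂ).1 x.2 (π b) ⟨b, rfl⟩
  exact congrArg (fun f : H →L[ℂ] H => f η) h.1

theorem tensorLinear_adjoint (T : AdjEnd Bᵐᵒᵖ X) (x : Commutant π) (z w : PreTensor X π) :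
    ⟪tensorLinear π T x z, w⟫_ℂ = ⟪z, tensorLinear π (star T) (star x) w⟫_ℂ := by
  obtain ⟨z, rfl⟩ := (PreTensor.of X π).surjective z
  obtain ⟨w, rfl⟩ := (PreTensor.of X π).surjective w
  induction z with
  | zero => simp
  | add z z' hz hz' => simp only [map_add, inner_add_left, hz, hz']
  | tmul ξ η =>
    induction w with
    | zero => simp
    | add w w' hw hw' => simp only [map_add, inner_add_right, hw, hw']
    | tmul ξ' η' =>
      rw [tensorLinear_tmul, tensorLinear_tmul, PreTensor.inner_def, PreTensor.inner_def,
        tensorForm_tmul, tensorForm_tmul, commutant_apply]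
      have h : rinner B (T.val ξ) ξ' = rinner B ξ ((star T).val ξ') := by
        rw [rinner, AdjEnd.inner_apply_left]; rfl
      rw [h]
      exact (ContinuousLinearMap.adjoint_inner_right x.1 η _).symm

theorem tensorLinear_mul (T T' : AdjEnd Bᵐᵒᵖ X) (x x' : Commutant π) (z : PreTensor X π) :
    tensorLinear π (T * T') (x * x') z = tensorLinear π T x (tensorLinear π T' x' z) := by
  obtain ⟨z, rfl⟩ := (PreTensor.of X π).surjective z
  induction z with
  | zero => simp
  | add z z' hz hz' => simp only [map_add, hz, hz']
  | tmul ξ η => simp [tensorLinear_tmul]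

theorem tensorLinear_one (z : PreTensor X π) :
    tensorLinear π (1 : AdjEnd Bᵐᵒᵖ X) 1 z = z := by
  obtain ⟨z, rfl⟩ := (PreTensor.of X π).surjective z
  induction z with
  | zero => simp
  | add z z' hz hz' => simp only [map_add, hz, hz']
  | tmul ξ η => simp [tensorLinear_tmul]

theorem tensorLinear_add_left (T T' : AdjEnd Bᵐᵒᵖ X) (x : Commutant π) (z : PreTensor X π) :
    tensorLinear π (T + T') x z = tensorLinear π T x z + tensorLinear π T' x z := by
  obtain ⟨z, rfl⟩ := (PreTensor.of X π).surjective z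
  induction z with
  | zero => simp
  | add z z' hz hz' => simp only [map_add, hz, hz']; abel
  | tmul ξ η => simp [tensorLinear_tmul, TensorProduct.add_tmul]

theorem tensorLinear_add_right (T : AdjEnd Bᵐᵒᵖ X) (x x' : Commutant π) (z : PreTensor X π) :
    tensorLinear π T (x + x') z = tensorLinear π T x z + tensorLinear π T x' z := by
  obtain ⟨z, rfl⟩ := (PreTensor.of X π).surjective z
  induction z with
  | zero => simp
  | add z z' hz hz' => simp only [map_add, hz, hz']; abel
  | tmul ξ η => simp [tensorLinear_tmul, TensorProduct.tmul_add]

theorem tensorLinear_smul_left (c : ℂ) (T : AdjEnd Bᵐᵒᵖ X) (x : Commutant π)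
    (z : PreTensor X π) : tensorLinear π (c • T) x z = c • tensorLinear π T x z := by
  obtain ⟨z, rfl⟩ := (PreTensor.of X π).surjective z
  induction z with
  | zero => simp
  | add z z' hz hz' => simp only [map_add, hz, hz', smul_add]
  | tmul ξ η => simp [tensorLinear_tmul, ← TensorProduct.smul_tmul']

theorem tensorLinear_smul_right (c : ℂ) (T : AdjEnd Bᵐᵒᵖ X) (x : Commutant π)
    (z : PreTensor X π) : tensorLinear π T (c • x) z = c • tensorLinear π T x z := by
  obtain ⟨z, rfl⟩ := (PreTensor.of X π).surjective z
  induction z with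
  | zero => simp
  | add z z' hz hz' => simp only [map_add, hz, hz', smul_add]
  | tmul ξ η => simp [tensorLinear_tmul]

/-- If a unital `⋆`-preserving multiplicative linear action `L` of a C⋆-algebra on a semi-inner
product space is given, it is contractive. -/
theorem norm_action_le {C K : Type*} [CStarAlgebra C] [SeminormedAddCommGroup K]
    [InnerProductSpace ℂ K] (L : C →ₗ[ℂ] K →ₗ[ℂ] K) (h1 : ∀ z, L 1 z = z)
    (hmul : ∀ s t z, L (s * t) z = L s (L t z))
    (hstar : ∀ t z w, ⟪L t z, w⟫_ℂ = ⟪z, L (star t) w⟫_ℂ) (t : C) (z : K) :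
    ‖L t z‖ ≤ ‖t‖ * ‖z‖ := by
  have key : ∀ s : C, ⟪z, L (star s * s) z⟫_ℂ = ((‖L s z‖ ^ 2 : ℝ) : ℂ) := fun s => by
    rw [hmul, ← hstar, inner_self_eq_norm_sq_to_K]
    norm_cast
  obtain ⟨s, hs⟩ := exists_star_mul_self_eq t
  have h := key s
  rw [hs, map_sub, map_smul, LinearMap.sub_apply, LinearMap.smul_apply, h1, inner_sub_right,
    key t, inner_smul_right, inner_self_eq_norm_sq_to_K] at h
  have h' : ‖t‖ ^ 2 * ‖z‖ ^ 2 - ‖L t z‖ ^ 2 = ‖L s z‖ ^ 2 := by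
    apply Complex.ofReal_injective
    rw [← h]
    simp
  refine abs_le_of_sq_le_sq' ?_ (by positivity) |>.2
  rw [mul_pow]
  nlinarith [sq_nonneg ‖L s z‖]

theorem norm_tensorLinear_le (T : AdjEnd Bᵐᵒᵖ X) (x : Commutant π) (z : PreTensor X π) :
    ‖tensorLinear π T x z‖ ≤ ‖T‖ * ‖x‖ * ‖z‖ := by
  have hl : ∀ w : PreTensor X π, ‖tensorLinear π T 1 w‖ ≤ ‖T‖ * ‖w‖ := fun w =>
    norm_action_le
      (LinearMap.mk₂ ℂ (fun (T : AdjEnd Bᵐᵒᵖ X) z => tensorLinear π T 1 z)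
        (fun T T' z => tensorLinear_add_left π T T' 1 z)
        (fun c T z => tensorLinear_smul_left π c T 1 z)
        (fun T z w => map_add _ z w) (fun c T z => map_smul _ c z))
      (tensorLinear_one π)
      (fun S T z => by
        have := tensorLinear_mul π S T 1 1 z
        rwa [mul_one] at this)
      (fun T z w => by
        have := tensorLinear_adjoint π T 1 z w
        rwa [star_one] at this) T w
  have hr : ∀ w : PreTensor X π, ‖tensorLinear π (1 : AdjEnd Bᵐᵒᵖ X) x w‖ ≤ ‖x‖ * ‖w‖ := fun w =>
    norm_action_le
      (LinearMap.mk₂ ℂ (fun (x : Commutant π) z => tensorLinear π (1 : AdjEnd Bᵐᵒᵖ X) x z)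
        (fun T T' z => tensorLinear_add_right π 1 T T' z)
        (fun c T z => tensorLinear_smul_right π c 1 T z)
        (fun T z w => map_add _ z w) (fun c T z => map_smul _ c z))
      (tensorLinear_one π)
      (fun S T z => by
        have := tensorLinear_mul π (1 : AdjEnd Bᵐᵒᵖ X) 1 S T z
        rwa [mul_one] at this)
      (fun T z w => by
        have := tensorLinear_adjoint π (1 : AdjEnd Bᵐᵒᵖ X) T z w
        rwa [star_one] at this) x w
  have h := tensorLinear_mul π T 1 1 x z
  rw [mul_one, one_mul] at h
  rw [h, mul_assoc]
  exact (hl _).trans (by gcongr; exact hr _)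

/-- The operator `T ⊗ x` on `X ⊗_B H`, for `T ∈ 𝓛(X)` and `x ∈ π(B)'`. -/
def tensorOp (T : AdjEnd Bᵐᵒᵖ X) (x : Commutant π) : IntTensor X π →L[ℂ] IntTensor X π :=
  ((tensorLinear π T x).mkContinuous (‖T‖ * ‖x‖) (norm_tensorLinear_le π T x)).completion

@[simp] theorem tensorOp_coe (T : AdjEnd Bᵐᵒᵖ X) (x : Commutant π) (z : PreTensor X π) :
    tensorOp π T x (z : IntTensor X π) = (tensorLinear π T x z : PreTensor X π) := by
  simp [tensorOp]

theorem intTensor_ext {S S' : IntTensor X π →L[ℂ] IntTensor X π}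
    (h : ∀ z : PreTensor X π, S (z : IntTensor X π) = S' z) : S = S' := by
  ext z
  induction z using UniformSpace.Completion.induction_on with
  | hp => exact isClosed_eq S.continuous S'.continuous
  | ih z => exact h z

theorem tensorOp_mul (T T' : AdjEnd Bᵐᵒᵖ X) (x x' : Commutant π) :
    tensorOp π (T * T') (x * x') = tensorOp π T x * tensorOp π T' x' :=
  intTensor_ext π fun z => by simp [tensorLinear_mul]

theorem tensorOp_star (T : AdjEnd Bᵐᵒᵖ X) (x : Commutant π) :
    tensorOp π (star T) (star x) = star (tensorOp π T x) := by
  rw [ContinuousLinearMap.star_eq_adjoint, ContinuousLinearMap.eq_adjoint_iff]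
  intro z w
  induction z, w using UniformSpace.Completion.induction_on₂ with
  | hp => apply isClosed_eq <;> fun_prop
  | ih z w =>
    rw [tensorOp_coe, tensorOp_coe, UniformSpace.Completion.inner_coe,
      UniformSpace.Completion.inner_coe, tensorLinear_adjoint, star_star, star_star]

variable (X) in
/-- `(T, x) ↦ T ⊗ x` as a bilinear map. -/
def tensorOpBilin : AdjEnd Bᵐᵒᵖ X →ₗ[ℂ] Commutant π →ₗ[ℂ]
    (IntTensor X π →L[ℂ] IntTensor X π) :=
  LinearMap.mk₂ ℂ (tensorOp π)
    (fun T T' x => intTensor_ext π fun z => by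
      simp [tensorLinear_add_left, UniformSpace.Completion.coe_add])
    (fun c T x => intTensor_ext π fun z => by
      simp [tensorLinear_smul_left, UniformSpace.Completion.coe_smul])
    (fun T x x' => intTensor_ext π fun z => by
      simp [tensorLinear_add_right, UniformSpace.Completion.coe_add])
    (fun c T x => intTensor_ext π fun z => by
      simp [tensorLinear_smul_right, UniformSpace.Completion.coe_smul])

end Tensor

/-! ## The maximal tensor product -/

section MaxTensor

variable {A C : Type*} [CStarAlgebra A] [CStarAlgebra C]

/-- C⋆-seminorms on the algebraic tensor product of two C⋆-algebras. -/
structure IsCStarSeminorm (p : Seminorm ℂ (A ⊗[ℂ] C)) : Prop where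
  mul_le : ∀ z w, p (z * w) ≤ p z * p w
  star_mul_self : ∀ z, p (star z * z) = p z ^ 2

theorem IsCStarSeminorm.unitary_le {p : Seminorm ℂ (A ⊗[ℂ] C)} (hp : IsCStarSeminorm p)
    (u : unitary A) (v : unitary C) : p ((u : A) ⊗ₜ (v : C)) ≤ 1 := by
  have h1 : p 1 = p 1 ^ 2 := by simpa using hp.star_mul_self 1
  have h2 := hp.star_mul_self ((u : A) ⊗ₜ (v : C))
  rw [TensorProduct.star_tmul, Algebra.TensorProduct.tmul_mul_tmul, Unitary.coe_star_mul_self,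
    Unitary.coe_star_mul_self, ← Algebra.TensorProduct.one_def] at h2
  have h3 : p 1 ≤ 1 := by nlinarith [apply_nonneg p 1]
  nlinarith [apply_nonneg p ((u : A) ⊗ₜ[ℂ] (v : C))]

theorem IsCStarSeminorm.tmul_le {p : Seminorm ℂ (A ⊗[ℂ] C)} (hp : IsCStarSeminorm p)
    (a : A) (c : C) : p (a ⊗ₜ c) ≤ 4 * ‖a‖ * ‖c‖ := by
  obtain ⟨u, r, hu, hr⟩ := CStarAlgebra.exists_sum_four_unitary a
  obtain ⟨v, s, hv, hs⟩ := CStarAlgebra.exists_sum_four_unitary c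
  have h : a ⊗ₜ[ℂ] c = ∑ i, ∑ j, (r i * s j) • ((u i : A) ⊗ₜ[ℂ] (v j : C)) := by
    conv_lhs => rw [hu, hv]
    simp only [TensorProduct.sum_tmul, TensorProduct.tmul_sum, TensorProduct.smul_tmul_smul]
    exact Finset.sum_comm
  have hle : ∀ i j, p ((r i * s j) • ((u i : A) ⊗ₜ[ℂ] (v j : C))) ≤ (‖a‖ / 2) * (‖c‖ / 2) := by
    intro i j
    rw [map_smul_eq_mul, norm_mul]
    calc _ ≤ (‖a‖ / 2) * (‖c‖ / 2) * 1 := by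
          gcongr
          · exact hr i
          · exact hs j
          · exact hp.unitary_le _ _
      _ = _ := mul_one _
  rw [h]
  calc _ ≤ ∑ i, ∑ j, p ((r i * s j) • ((u i : A) ⊗ₜ[ℂ] (v j : C))) :=
        (Finset.le_sum_of_subadditive p (map_zero p).le (map_add_le_add p) _ _).trans
          (Finset.sum_le_sum fun i _ =>
            Finset.le_sum_of_subadditive p (map_zero p).le (map_add_le_add p) _ _)
    _ ≤ ∑ i : Fin 4, ∑ j : Fin 4, (‖a‖ / 2) * (‖c‖ / 2) :=
        Finset.sum_le_sum fun i _ => Finset.sum_le_sum fun j _ => hle i j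
    _ = _ := by simp; ring

theorem bddAbove_isCStarSeminorm :
    BddAbove {p : Seminorm ℂ (A ⊗[ℂ] C) | IsCStarSeminorm p} := by
  have key : ∀ z : A ⊗[ℂ] C, ∃ M : ℝ, ∀ p : Seminorm ℂ (A ⊗[ℂ] C), IsCStarSeminorm p →
      p z ≤ M := by
    intro z
    induction z with
    | zero => exact ⟨0, fun p _ => by simp⟩
    | tmul a c => exact ⟨_, fun p hp => hp.tmul_le a c⟩
    | add z w hz hw =>
      obtain ⟨M, hM⟩ := hz
      obtain ⟨N, hN⟩ := hw
      exact ⟨M + N, fun p hp => (map_add_le_add p z w).trans (add_le_add (hM p hp) (hN p hp))⟩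
  choose M hM using key
  rw [Seminorm.bddAbove_iff]
  refine ⟨M, ?_⟩
  rintro _ ⟨p, hp, rfl⟩ z
  exact hM z p hp

variable (A C) in
/-- The maximal C⋆-seminorm on `A ⊙ C`, the supremum of all C⋆-seminorms. -/
def maxSeminorm : Seminorm ℂ (A ⊗[ℂ] C) := sSup {p | IsCStarSeminorm p}

theorem IsCStarSeminorm.le_max {p : Seminorm ℂ (A ⊗[ℂ] C)} (hp : IsCStarSeminorm p) :
    p ≤ maxSeminorm A C := le_csSup bddAbove_isCStarSeminorm hp

variable (A C) in
/-- `A ⊙ C` with the maximal C⋆-seminorm. -/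
def PreMax : Type _ := A ⊗[ℂ] C

instance : AddCommGroup (PreMax A C) := inferInstanceAs (AddCommGroup (A ⊗[ℂ] C))
instance : Module ℂ (PreMax A C) := inferInstanceAs (Module ℂ (A ⊗[ℂ] C))

variable (A C) in
/-- The identity map from the algebraic tensor product. -/
def PreMax.of : A ⊗[ℂ] C ≃ₗ[ℂ] PreMax A C := LinearEquiv.refl ℂ _

instance : SeminormedAddCommGroup (PreMax A C) :=
  ((maxSeminorm A C).comp (PreMax.of A C).symm.toLinearMap).toAddGroupSeminorm.toSeminormedAddCommGroup

theorem PreMax.norm_of (z : A ⊗[ℂ] C) : ‖PreMax.of A C z‖ = maxSeminorm A C z := rfl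

instance : NormedSpace ℂ (PreMax A C) where
  norm_smul_le c z :=
    (map_smul_eq_mul ((maxSeminorm A C).comp (PreMax.of A C).symm.toLinearMap) c z).le

variable (A C) in
/-- The maximal tensor product `A ⊗_max C`: the completion of `A ⊙ C` in the maximal C⋆-norm. -/
abbrev MaxTensor : Type _ := UniformSpace.Completion (PreMax A C)

end MaxTensor

/-! ## Weak containment -/

section WeakContainment

variable {A B X Y H : Type*} [CStarAlgebra A]
  [NonUnitalCStarAlgebra B] [PartialOrder B] [StarOrderedRing B]
  [NormedAddCommGroup X] [NormedSpace ℂ X] [SMul Bᵐᵒᵖ X] [CStarModule Bᵐᵒᵖ X] [CompleteSpace X]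
  [NormedAddCommGroup Y] [NormedSpace ℂ Y] [SMul Bᵐᵒᵖ Y] [CStarModule Bᵐᵒᵖ Y] [CompleteSpace Y]
  [NormedAddCommGroup H] [InnerProductSpace ℂ H] [CompleteSpace H]

/-- `θ(a ⊗ x) = π_X(a) ⊗ x` on the algebraic tensor product `A ⊙ π(B)'`. -/
def thetaAlg (πX : A →⋆ₐ[ℂ] AdjEnd Bᵐᵒᵖ X) (π : B →⋆ₙₐ[ℂ] (H →L[ℂ] H)) :
    A ⊗[ℂ] Commutant π →ₗ[ℂ] (IntTensor X π →L[ℂ] IntTensor X π) :=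
  TensorProduct.lift ((tensorOpBilin X π).comp πX.toAlgHom.toLinearMap)

@[simp] theorem thetaAlg_tmul (πX : A →⋆ₐ[ℂ] AdjEnd Bᵐᵒᵖ X) (π : B →⋆ₙₐ[ℂ] (H →L[ℂ] H))
    (a : A) (x : Commutant π) : thetaAlg πX π (a ⊗ₜ x) = tensorOp π (πX a) x := rfl

theorem thetaAlg_mul (πX : A →⋆ₐ[ℂ] AdjEnd Bᵐᵒᵖ X) (π : B →⋆ₙₐ[ℂ] (H →L[ℂ] H))
    (z w : A ⊗[ℂ] Commutant π) : thetaAlg πX π (z * w) = thetaAlg πX π z * thetaAlg πX π w := by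
  induction z with
  | zero => simp
  | add z z' hz hz' => simp only [add_mul, map_add, hz, hz']
  | tmul a x =>
    induction w with
    | zero => simp
    | add w w' hw hw' => simp only [mul_add, map_add, hw, hw']
    | tmul b y => simp [tensorOp_mul]

theorem thetaAlg_star (πX : A →⋆ₐ[ℂ] AdjEnd Bᵐᵒᵖ X) (π : B →⋆ₙₐ[ℂ] (H →L[ℂ] H))
    (z : A ⊗[ℂ] Commutant π) : thetaAlg πX π (star z) = star (thetaAlg πX π z) := by
  induction z with
  | zero => simp
  | add z z' hz hz' => simp only [star_add, map_add, hz, hz']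
  | tmul a x => simp [TensorProduct.star_tmul, tensorOp_star, map_star]

theorem norm_star_mul_self_eq_sq {K : Type*} [NormedAddCommGroup K] [InnerProductSpace ℂ K]
    [CompleteSpace K] (T : K →L[ℂ] K) : ‖star T * T‖ = ‖T‖ ^ 2 :=
  CStarRing.norm_star_mul_self.trans (sq _).symm

theorem norm_thetaAlg_le (πX : A →⋆ₐ[ℂ] AdjEnd Bᵐᵒᵖ X) (π : B →⋆ₙₐ[ℂ] (H →L[ℂ] H))
    (z : A ⊗[ℂ] Commutant π) : ‖thetaAlg πX π z‖ ≤ maxSeminorm A (Commutant π) z := by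
  have h : IsCStarSeminorm ((normSeminorm ℂ (IntTensor X π →L[ℂ] IntTensor X π)).comp
      (thetaAlg πX π)) :=
    { mul_le := fun z w => by
        simp only [Seminorm.comp_apply, coe_normSeminorm, thetaAlg_mul]
        exact norm_mul_le _ _
      star_mul_self := fun z => by
        simp only [Seminorm.comp_apply, coe_normSeminorm, thetaAlg_mul, thetaAlg_star]
        exact norm_star_mul_self_eq_sq (thetaAlg πX π z) }
  exact h.le_max z

/-- The representation `θ_X^H : A ⊗_max π(B)' → 𝓑(X ⊗_B H)`, the continuous extension of
`a ⊗ x ↦ π_X(a) ⊗ x`. -/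
def theta (πX : A →⋆ₐ[ℂ] AdjEnd Bᵐᵒᵖ X) (π : B →⋆ₙₐ[ℂ] (H →L[ℂ] H)) :
    MaxTensor A (Commutant π) →L[ℂ] (IntTensor X π →L[ℂ] IntTensor X π) :=
  (LinearMap.mkContinuous (thetaAlg πX π ∘ₗ (PreMax.of A (Commutant π)).symm.toLinearMap) 1
    fun z => by
      rw [one_mul]
      exact norm_thetaAlg_le πX π _).extend UniformSpace.Completion.toComplL

theorem theta_coe (πX : A →⋆ₐ[ℂ] AdjEnd Bᵐᵒᵖ X) (π : B →⋆ₙₐ[ℂ] (H →L[ℂ] H))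
    (z : A ⊗[ℂ] Commutant π) :
    theta πX π (PreMax.of A (Commutant π) z : PreMax A (Commutant π)) = thetaAlg πX π z :=
  ContinuousLinearMap.extend_eq _ UniformSpace.Completion.denseRange_coe
    (UniformSpace.Completion.isUniformInducing_coe _) (PreMax.of A (Commutant π) z)

/-- `(X, π_X)` is weakly contained in `(Y, π_Y)` with respect to the representation `π` of `B`:
`ker θ_Y^H ⊆ ker θ_X^H`. -/
def WeaklyContainedWrt (π : B →⋆ₙₐ[ℂ] (H →L[ℂ] H))
    (πX : A →⋆ₐ[ℂ] AdjEnd Bᵐᵒᵖ X) (πY : A →⋆ₐ[ℂ] AdjEnd Bᵐᵒᵖ Y) : Prop :=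
  ∀ z : MaxTensor A (Commutant π), theta πY π z = 0 → theta πX π z = 0

end WeakContainment

/-! ## The universal representation -/

section Universal

variable (B : Type*) [NonUnitalCStarAlgebra B] [PartialOrder B] [StarOrderedRing B]

open scoped ComplexOrder in
/-- The states of `B`: the positive linear functionals of norm one. -/
def State : Type _ :=
  {φ : B →ₚ[ℂ] ℂ // IsLUB ((fun b => ‖φ b‖) '' Metric.closedBall (0 : B) 1) 1}

/-- The Hilbert space of the universal representation: the direct sum of the GNS spaces of all
states of `B`. -/
abbrev UnivSpace : Type _ := lp (fun φ : State B => φ.1.GNS) 2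

variable {B}

theorem norm_gns_le (b : B) (φ : State B) (v : φ.1.GNS) :
    ‖φ.1.gnsNonUnitalStarAlgHom b v‖ ≤ ‖b‖ * ‖v‖ :=
  ((φ.1.gnsNonUnitalStarAlgHom b).le_opNorm v).trans (by
    gcongr
    exact NonUnitalStarAlgHom.norm_apply_le φ.1.gnsNonUnitalStarAlgHom b)

/-- `(v_φ)_φ ↦ (π_φ(b) v_φ)_φ` as a linear map. -/
def univLinear (b : B) : UnivSpace B →ₗ[ℂ] UnivSpace B where
  toFun v := ⟨fun φ => φ.1.gnsNonUnitalStarAlgHom b (v φ),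
    ((lp.memℓp v).norm.const_smul ‖b‖).mono fun φ => norm_gns_le b φ (v φ)⟩
  map_add' v w := Subtype.ext <| funext fun φ => map_add _ _ _
  map_smul' c v := by ext φ; simp

theorem univLinear_apply (b : B) (v : UnivSpace B) (φ : State B) :
    univLinear b v φ = φ.1.gnsNonUnitalStarAlgHom b (v φ) := rfl

theorem norm_univLinear_le (b : B) (v : UnivSpace B) : ‖univLinear b v‖ ≤ ‖b‖ * ‖v‖ := by
  refine lp.norm_le_of_forall_sum_le (by norm_num) (by positivity) fun s => ?_
  have h := lp.sum_rpow_le_norm_rpow (p := 2) (by norm_num) v s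
  simp only [ENNReal.toReal_ofNat, Real.rpow_ofNat] at h ⊢
  calc _ ≤ ∑ φ ∈ s, (‖b‖ * ‖v φ‖) ^ 2 := by
        gcongr with φ
        exact norm_gns_le b φ (v φ)
    _ = ‖b‖ ^ 2 * ∑ φ ∈ s, ‖v φ‖ ^ 2 := by simp [mul_pow, Finset.mul_sum]
    _ ≤ ‖b‖ ^ 2 * ‖v‖ ^ 2 := by gcongr
    _ = _ := by ring

/-- The operator `π_u(b)`. -/
def univOp (b : B) : UnivSpace B →L[ℂ] UnivSpace B :=
  (univLinear b).mkContinuous ‖b‖ (norm_univLinear_le b)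

@[simp] theorem univOp_apply (b : B) (v : UnivSpace B) (φ : State B) :
    univOp b v φ = φ.1.gnsNonUnitalStarAlgHom b (v φ) := rfl

variable (B) in
/-- The universal representation `π_u = ⨁_φ π_φ` of `B`, the direct sum of the GNS representations
of all states. -/
def univRep : B →⋆ₙₐ[ℂ] (UnivSpace B →L[ℂ] UnivSpace B) where
  toFun := univOp
  map_smul' c b := by ext v φ; simp
  map_zero' := by ext v φ; simp
  map_add' b c := by ext v φ; simp
  map_mul' b c := by ext v φ; simp
  map_star' b := by
    rw [ContinuousLinearMap.star_eq_adjoint, ContinuousLinearMap.eq_adjoint_iff]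
    intro v w
    rw [lp.inner_eq_tsum, lp.inner_eq_tsum]
    refine tsum_congr fun φ => ?_
    rw [univOp_apply, univOp_apply, map_star, ContinuousLinearMap.star_eq_adjoint,
      ContinuousLinearMap.adjoint_inner_left]

end Universal

section Main

variable {A B X Y : Type*} [CStarAlgebra A]
  [NonUnitalCStarAlgebra B] [PartialOrder B] [StarOrderedRing B]
  [NormedAddCommGroup X] [NormedSpace ℂ X] [SMul Bᵐᵒᵖ X] [CStarModule Bᵐᵒᵖ X] [CompleteSpace X]
  [NormedAddCommGroup Y] [NormedSpace ℂ Y] [SMul Bᵐᵒᵖ Y] [CStarModule Bᵐᵒᵖ Y] [CompleteSpace Y]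

/-- `X ≺_univ Y`: weak containment with respect to the universal representation of `B`. -/
def WeaklyContainedUniv (πX : A →⋆ₐ[ℂ] AdjEnd Bᵐᵒᵖ X) (πY : A →⋆ₐ[ℂ] AdjEnd Bᵐᵒᵖ Y) : Prop :=
  WeaklyContainedWrt (univRep B) πX πY

end Main

section Approx

variable {A D E F : Type*} [CStarAlgebra A] [NonUnitalCStarAlgebra D] [PartialOrder D]
  [StarOrderedRing D]
  [NormedAddCommGroup E] [NormedSpace ℂ E] [SMul D E] [CStarModule D E]
  [NormedAddCommGroup F] [NormedSpace ℂ F] [SMul D F] [CStarModule D F]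

/-- Approximate unitary equivalence of `(E, π)` and `(F, ρ)`: there is a sequence of unitaries
`Uₙ ∈ 𝓛(E, F)` with `π(a) - Uₙ⋆ ρ(a) Uₙ ∈ 𝓚(E)` for all `n` and `‖π(a) - Uₙ⋆ ρ(a) Uₙ‖ → 0`, for
all `a`. -/
def ApproxUnitarilyEquiv (π : A →⋆ₐ[ℂ] AdjEnd D E) (ρ : A →⋆ₐ[ℂ] AdjEnd D F) : Prop :=
  ∃ U : ℕ → UnitaryMap D E F, ∀ a : A,
    (∀ n, π a - (U n).conj (ρ a) ∈ Compacts D E) ∧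
    Tendsto (fun n => ‖π a - (U n).conj (ρ a)‖) atTop (𝓝 0)

end Approx

/-- `B` is `σ`-unital: it has a sequential approximate unit of positive contractions. -/
def SigmaUnital (B : Type*) [NonUnitalCStarAlgebra B] [PartialOrder B] [StarOrderedRing B] : Prop :=
  ∃ e : ℕ → B, (Filter.map e atTop).IsIncreasingApproximateUnit

end HilbertMod

end

universe u

open HilbertMod
open scoped WithCStarModule

open scoped TensorProduct InnerProductSpace
open Filter Topology

noncomputable section

namespace HilbertMod

/-! ## The maximal tensor product as a C⋆-algebra -/

section MaxCStar

variable {A C : Type*} [CStarAlgebra A] [CStarAlgebra C]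

/-! The bridge between kernels and modules is approximation of coefficients. The matrices
$(\langle\eta_l,\pi_Y(a)\eta_k\rangle)_{a,l,k}$, with $a$ in a finite set, generate a convex cone of
families in $B$; weak containment puts the corresponding matrices of $X$ into its closure. By
Hahn–Banach it suffices that a functional with nonnegative real part on the coefficients of $Y$ has
the same property on those of $X$. Bounded functionals on $B$ are dominated by positive ones,
finitely many of them by a single state $\varphi$, so each has the form $f(b^*c)=\langle
[b],x[c]\rangle$ with $x\in\pi_H(B)'$ living on the GNS space of $\varphi$. The functional thereby
becomes a matrix over $A\otimes_{\max}\pi_H(B)'$. Nonnegativity on $Y$ says that the image of its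
real part under $\theta_Y$ is positive; then the negative part lies in the kernel of $\theta_Y$,
hence of $\theta_X$, and positivity holds for $X$ as well (`WeaklyContainedUniv.coefficient_nonneg`,
`WeaklyContainedUniv.coefficients_mem_closure`).

From coefficients to operators: a compression $C^*\pi(a)C$ with $C$ compact is, up to a small error,
a function of finitely many coefficients, so it is approximated by finitely many compressions of
$\rho(a)$. Quasicentral compact elements cut the identity into such blocks. At each stage
$c^2+s^2=1$ with $c$ compact and $c,s$ almost commuting with the given operators; the part $c$ is
dilated and the part $s$ is passed on to the next stage. For a countably generated module the
remainders tend strongly to zero, so the blocks add up to $W$ with $W^*\rho^\infty(a)W-\pi(a)$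
compact and small (`CoefficientApprox.exists_almost_dilation`). Since $W^*W$ is close to $1$, the
polar part $V=W(W^*W)^{-1/2}$ is an isometry, and it almost intertwines $\pi$ and $\rho^\infty$
(`CoefficientApprox.exists_isometric_dilation`).

This is applied to $\pi_X^\infty$ and not to $\pi_X$: an almost intertwining isometry $X^\infty\to
Y^\infty$ splits off a copy of $X^\infty$, and a shift inside that copy makes room for one more $X$.
This gives the unitary $X\oplus Y^\infty\to Y^\infty$ (`exists_unitary_of_isometry`).

Conversely, restricting the unitaries to $X$ exhibits coefficients of $\pi_X$ as limits of
coefficients of $\pi_Y^\infty$, which are sums of coefficients of $\pi_Y$. This yields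
$\|\theta_X(z)\|\le\|\theta_Y(z)\|$, first on the algebraic tensor product and then everywhere
(`norm_thetaAlg_le_of_tendsto`), and kernels are compared. -/

theorem IsCStarSeminorm.zero : IsCStarSeminorm (0 : Seminorm ℂ (A ⊗[ℂ] C)) where
  mul_le z w := by simp
  star_mul_self z := by simp

theorem maxSeminorm_le {z : A ⊗[ℂ] C} {r : ℝ}
    (h : ∀ p : Seminorm ℂ (A ⊗[ℂ] C), IsCStarSeminorm p → p z ≤ r) : maxSeminorm A C z ≤ r := by
  rw [maxSeminorm, Seminorm.sSup_apply bddAbove_isCStarSeminorm]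
  have : Nonempty {p : Seminorm ℂ (A ⊗[ℂ] C) | IsCStarSeminorm p} := ⟨⟨0, .zero⟩⟩
  exact ciSup_le fun p => h p.1 p.2

/-- Both laws pass to a supremum of C⋆-seminorms; for the harder half of the C⋆-identity one uses
$p(z)=\sqrt{p(z^*z)}$ for each member $p$. -/
theorem isCStarSeminorm_maxSeminorm : IsCStarSeminorm (maxSeminorm A C) where
  mul_le z w := maxSeminorm_le fun p hp => (hp.mul_le z w).trans
    (mul_le_mul (hp.le_max z) (hp.le_max w) (apply_nonneg _ _) (apply_nonneg _ _))
  star_mul_self z := by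
    refine le_antisymm (maxSeminorm_le fun p hp => ?_) ?_
    · rw [hp.star_mul_self]
      exact pow_le_pow_left₀ (apply_nonneg _ _) (hp.le_max z) 2
    · have h : maxSeminorm A C z ≤ √(maxSeminorm A C (star z * z)) :=
        maxSeminorm_le fun p hp => Real.le_sqrt_of_sq_le
          ((hp.star_mul_self z).symm.trans_le (hp.le_max _))
      calc _ ≤ √(maxSeminorm A C (star z * z)) ^ 2 := pow_le_pow_left₀ (apply_nonneg _ _) h 2
        _ = _ := Real.sq_sqrt (apply_nonneg _ _)

/-- Invariance under the involution is not part of the definition; it follows from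
$p(z^*)^2=p(zz^*)\le p(z)\,p(z^*)$. -/
theorem IsCStarSeminorm.star_le {p : Seminorm ℂ (A ⊗[ℂ] C)} (hp : IsCStarSeminorm p)
    (z : A ⊗[ℂ] C) : p (star z) ≤ p z := by
  have h1 := hp.star_mul_self (star z)
  have h2 := hp.mul_le (star (star z)) (star z)
  rw [h1, star_star, sq] at h2
  rcases (apply_nonneg p (star z)).eq_or_lt with h | h
  · rw [← h]; exact apply_nonneg _ _
  · exact le_of_mul_le_mul_right h2 h

namespace PreMax

instance : Ring (PreMax A C) := inferInstanceAs (Ring (A ⊗[ℂ] C))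
instance : Algebra ℂ (PreMax A C) := inferInstanceAs (Algebra ℂ (A ⊗[ℂ] C))
instance : StarRing (PreMax A C) := inferInstanceAs (StarRing (A ⊗[ℂ] C))
instance : StarModule ℂ (PreMax A C) := inferInstanceAs (StarModule ℂ (A ⊗[ℂ] C))

instance : SeminormedRing (PreMax A C) where
  __ := (inferInstance : Ring (PreMax A C))
  __ := (inferInstance : SeminormedAddCommGroup (PreMax A C))
  norm_mul_le _ _ := isCStarSeminorm_maxSeminorm.mul_le _ _

instance : NormedStarGroup (PreMax A C) where
  norm_star_le _ := isCStarSeminorm_maxSeminorm.star_le _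

theorem norm_star_mul_self (z : PreMax A C) : ‖star z * z‖ = ‖z‖ * ‖z‖ :=
  (isCStarSeminorm_maxSeminorm.star_mul_self ((of A C).symm z)).trans (sq _)

end PreMax

namespace MaxTensor

open UniformSpace

instance : Star (MaxTensor A C) := ⟨Completion.map star⟩

theorem uniformContinuous_star_preMax : UniformContinuous (star : PreMax A C → PreMax A C) :=
  (starₗᵢ ℂ (E := PreMax A C)).isometry.uniformContinuous

theorem coe_star (z : PreMax A C) : ((star z : PreMax A C) : MaxTensor A C) = star (z : MaxTensor A C) :=
  (Completion.map_coe uniformContinuous_star_preMax z).symm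

theorem continuous_star_maxTensor : Continuous (star : MaxTensor A C → MaxTensor A C) :=
  Completion.continuous_map

instance : StarRing (MaxTensor A C) where
  star_involutive z := by
    induction z using Completion.induction_on with
    | hp => exact isClosed_eq (continuous_star_maxTensor.comp continuous_star_maxTensor) continuous_id
    | ih z => rw [← coe_star, ← coe_star, star_star]
  star_mul z w := by
    induction z, w using Completion.induction_on₂ with
    | hp =>
      exact isClosed_eq (continuous_star_maxTensor.comp continuous_mul)
        ((continuous_star_maxTensor.comp continuous_snd).mul
          (continuous_star_maxTensor.comp continuous_fst))
    | ih z w =>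
      rw [← Completion.coe_mul, ← coe_star, ← coe_star, ← coe_star, star_mul, Completion.coe_mul]
  star_add z w := by
    induction z, w using Completion.induction_on₂ with
    | hp =>
      exact isClosed_eq (continuous_star_maxTensor.comp continuous_add)
        ((continuous_star_maxTensor.comp continuous_fst).add
          (continuous_star_maxTensor.comp continuous_snd))
    | ih z w =>
      rw [← Completion.coe_add, ← coe_star, ← coe_star, ← coe_star, star_add, Completion.coe_add]

instance : StarModule ℂ (MaxTensor A C) where
  star_smul c z := by
    induction z using Completion.induction_on with
    | hp =>
      exact isClosed_eq (continuous_star_maxTensor.comp (continuous_const_smul c))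
        ((continuous_const_smul (star c)).comp continuous_star_maxTensor)
    | ih z => rw [← Completion.coe_smul, ← coe_star, ← coe_star, star_smul, Completion.coe_smul]

instance : IsScalarTower ℂ (MaxTensor A C) (MaxTensor A C) where
  smul_assoc c z w := by
    induction z, w using Completion.induction_on₂ with
    | hp =>
      exact isClosed_eq ((continuous_fst.const_smul c).mul continuous_snd)
        ((continuous_fst.mul continuous_snd).const_smul c)
    | ih z w =>
      simp only [smul_eq_mul]
      rw [← Completion.coe_smul, ← Completion.coe_mul, ← Completion.coe_mul, ← Completion.coe_smul,
        smul_mul_assoc]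

instance : SMulCommClass ℂ (MaxTensor A C) (MaxTensor A C) where
  smul_comm c z w := by
    induction z, w using Completion.induction_on₂ with
    | hp =>
      exact isClosed_eq ((continuous_fst.mul continuous_snd).const_smul c)
        (continuous_fst.mul (continuous_snd.const_smul c))
    | ih z w =>
      simp only [smul_eq_mul]
      rw [← Completion.coe_smul, ← Completion.coe_mul, ← Completion.coe_mul, ← Completion.coe_smul,
        mul_smul_comm]

instance : CStarRing (MaxTensor A C) where
  norm_mul_self_le z := by
    induction z using Completion.induction_on with
    | hp => exact isClosed_le (by fun_prop) ((continuous_star_maxTensor.mul continuous_id).norm)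
    | ih z =>
      rw [← coe_star, ← Completion.coe_mul, Completion.norm_coe, Completion.norm_coe,
        PreMax.norm_star_mul_self]

/-- With this structure, positive and negative parts are available in $A\otimes_{\max}C$ and in
matrices over it, which the transfer of positivity between kernels needs. -/
instance : NonUnitalCStarAlgebra (MaxTensor A C) where

end MaxTensor

end MaxCStar

/-! ### The representation $\theta$ as a ⋆-homomorphism -/

section ThetaHom

variable {A B X H : Type*} [CStarAlgebra A]
  [NonUnitalCStarAlgebra B] [PartialOrder B] [StarOrderedRing B]
  [NormedAddCommGroup X] [NormedSpace ℂ X] [SMul Bᵐᵒᵖ X] [CStarModule Bᵐᵒᵖ X] [CompleteSpace X]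
  [NormedAddCommGroup H] [InnerProductSpace ℂ H] [CompleteSpace H]

/-- `θ` as a `⋆`-homomorphism on the C⋆-algebra `A ⊗_max C`, where `C` is the commutant of `π`. -/
def thetaHom (πX : A →⋆ₐ[ℂ] AdjEnd Bᵐᵒᵖ X) (π : B →⋆ₙₐ[ℂ] (H →L[ℂ] H)) :
    MaxTensor A (Commutant π) →⋆ₙₐ[ℂ] (IntTensor X π →L[ℂ] IntTensor X π) where
  toFun := theta πX π
  map_smul' c z := map_smul _ c z
  map_zero' := map_zero _
  map_add' z w := map_add _ z w
  map_mul' z w := by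
    induction z, w using UniformSpace.Completion.induction_on₂ with
    | hp => apply isClosed_eq <;> fun_prop
    | ih z w =>
      rw [← UniformSpace.Completion.coe_mul]
      exact (theta_coe πX π ((PreMax.of _ _).symm z * (PreMax.of _ _).symm w)).trans
        ((thetaAlg_mul πX π _ _).trans (congrArg₂ _ (theta_coe πX π _).symm
          (theta_coe πX π _).symm))
  map_star' z := by
    induction z using UniformSpace.Completion.induction_on with
    | hp =>
      exact isClosed_eq ((theta πX π).continuous.comp MaxTensor.continuous_star_maxTensor)
        (continuous_star.comp (theta πX π).continuous)
    | ih z =>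
      rw [← MaxTensor.coe_star]
      exact (theta_coe πX π (star ((PreMax.of _ _).symm z))).trans
        ((thetaAlg_star πX π _).trans (congrArg _ (theta_coe πX π _).symm))

theorem thetaHom_apply (πX : A →⋆ₐ[ℂ] AdjEnd Bᵐᵒᵖ X) (π : B →⋆ₙₐ[ℂ] (H →L[ℂ] H))
    (z : MaxTensor A (Commutant π)) : thetaHom πX π z = theta πX π z := rfl

end ThetaHom

/-! ### Positivity and inclusion of kernels -/

section PositivityTransfer

/-- If `ker f ⊆ ker g` for `⋆`-homomorphisms `f`, `g` and `f z ≥ 0`, then `g z ≥ 0`. -/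
theorem exists_eq_star_mul_self_of_ker_le {N M M' : Type*} [NonUnitalCStarAlgebra N]
    [NonUnitalCStarAlgebra M] [NonUnitalCStarAlgebra M'] (f : N →⋆ₙₐ[ℂ] M) (g : N →⋆ₙₐ[ℂ] M')
    (hfg : ∀ z, f z = 0 → g z = 0) (z : N) (hz : IsSelfAdjoint z) (y : M)
    (hy : f z = star y * y) : ∃ y' : M', g z = star y' * y' := by
  let _ := CStarAlgebra.spectralOrder N
  have := CStarAlgebra.spectralOrderedRing N
  let _ := CStarAlgebra.spectralOrder M
  have := CStarAlgebra.spectralOrderedRing M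
  have hneg : 0 ≤ z⁻ := CFC.negPart_nonneg z
  have hsa : star z⁻ = z⁻ := (IsSelfAdjoint.of_nonneg hneg).star_eq
  obtain ⟨w, hw⟩ := CStarAlgebra.nonneg_iff_eq_star_mul_self.1
    (star_left_conjugate_nonneg hneg z⁻)
  have hmm : z⁻ * z * z⁻ = -(star w * w) := by
    have h1 : (z⁺ - z⁻) * z⁻ = -(z⁻ * z⁻) := by
      rw [sub_mul, CFC.posPart_mul_negPart, zero_sub]
    rw [CFC.posPart_sub_negPart z hz] at h1
    rw [← hw, hsa, mul_assoc, h1, mul_neg, mul_assoc]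
  -- The element $f(z^-zz^-)$ is positive because $f(z)=y^*y$, and equals $-f(w)^*f(w)$; so both
  -- vanish. As $w^*w=(z^-)^3$, this forces $f(z^-)=0$.
  have hw0 : f w = 0 := by
    have h2 : star (y * f z⁻) * (y * f z⁻) = - (star (f w) * f w) := by
      rw [star_mul, mul_assoc, ← mul_assoc (star y), ← hy, ← map_star, hsa, ← mul_assoc, ← map_mul,
        ← map_mul, hmm, map_neg, map_mul, map_star]
    have h3 : star (f w) * f w = 0 := le_antisymm
      (by rw [← neg_nonneg, ← h2]; exact star_mul_self_nonneg _) (star_mul_self_nonneg _)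
    exact (CStarRing.star_mul_self_eq_zero_iff _).1 h3
  have hf0 : f z⁻ = 0 := by
    have h4 : f z⁻ * f z⁻ * f z⁻ = 0 := by
      rw [← map_mul, ← map_mul]
      rw [hsa] at hw
      rw [hw, map_mul, hw0, mul_zero]
    have hs : star (f z⁻) = f z⁻ := by rw [← map_star, hsa]
    have h5 : f z⁻ * f z⁻ = 0 := by
      rw [← CStarRing.star_mul_self_eq_zero_iff, star_mul, hs, ← mul_assoc, h4, zero_mul]
    rw [← CStarRing.star_mul_self_eq_zero_iff, hs, h5]
  obtain ⟨v, hv⟩ := CStarAlgebra.nonneg_iff_eq_star_mul_self.1 (CFC.posPart_nonneg z)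
  refine ⟨g v, ?_⟩
  rw [← map_star, ← map_mul, ← hv]
  conv_lhs => rw [← CFC.posPart_sub_negPart z hz, map_sub, hfg _ hf0, sub_zero]

end PositivityTransfer

/-! ## Bounded functionals are dominated by positive functionals -/

section Jordan

variable {B : Type*} [NonUnitalCStarAlgebra B] [PartialOrder B] [StarOrderedRing B]

open scoped ComplexStarModule ComplexOrder

/-- The distance of `x` to the negative cone, measured by positive upper bounds. -/
def upperNorm (x : selfAdjoint B) : ℝ := sInf {r : ℝ | ∃ c : B, 0 ≤ c ∧ (x : B) ≤ c ∧ r = ‖c‖}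

theorem bddBelow_upperNorm (x : selfAdjoint B) :
    BddBelow {r : ℝ | ∃ c : B, 0 ≤ c ∧ (x : B) ≤ c ∧ r = ‖c‖} :=
  ⟨0, by rintro _ ⟨c, _, _, rfl⟩; exact norm_nonneg c⟩

theorem upperNorm_le {x : selfAdjoint B} {c : B} (hc : 0 ≤ c) (hx : (x : B) ≤ c) :
    upperNorm x ≤ ‖c‖ := csInf_le (bddBelow_upperNorm x) ⟨c, hc, hx, rfl⟩

theorem exists_lt_upperNorm_add (x : selfAdjoint B) {ε : ℝ} (hε : 0 < ε) :
    ∃ c : B, 0 ≤ c ∧ (x : B) ≤ c ∧ ‖c‖ < upperNorm x + ε := by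
  have hne : {r : ℝ | ∃ c : B, 0 ≤ c ∧ (x : B) ≤ c ∧ r = ‖c‖}.Nonempty :=
    ⟨_, (x : B)⁺, CFC.posPart_nonneg _, CFC.le_posPart x.2, rfl⟩
  obtain ⟨_, ⟨c, hc, hx, rfl⟩, h⟩ := exists_lt_of_csInf_lt hne (lt_add_of_pos_right _ hε)
  exact ⟨c, hc, hx, h⟩

theorem upperNorm_add_le (x y : selfAdjoint B) : upperNorm (x + y) ≤ upperNorm x + upperNorm y := by
  refine le_of_forall_pos_le_add fun ε hε => ?_
  obtain ⟨c, hc, hx, hc'⟩ := exists_lt_upperNorm_add x (half_pos hε)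
  obtain ⟨d, hd, hy, hd'⟩ := exists_lt_upperNorm_add y (half_pos hε)
  have h := upperNorm_le (x := x + y) (add_nonneg hc hd) (by simpa using add_le_add hx hy)
  linarith [norm_add_le c d]

theorem upperNorm_smul_le {t : ℝ} (ht : 0 < t) (x : selfAdjoint B) :
    upperNorm (t • x) ≤ t * upperNorm x := by
  refine le_of_forall_pos_le_add fun ε hε => ?_
  obtain ⟨c, hc, hx, hc'⟩ := exists_lt_upperNorm_add x (div_pos hε ht)
  have h := upperNorm_le (x := t • x) (smul_nonneg ht.le hc)
    (by simpa using smul_le_smul_of_nonneg_left hx ht.le)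
  rw [norm_smul, Real.norm_of_nonneg ht.le] at h
  calc _ ≤ t * ‖c‖ := h
    _ ≤ t * (upperNorm x + ε / t) := by gcongr
    _ = _ := by field_simp

theorem upperNorm_smul {t : ℝ} (ht : 0 < t) (x : selfAdjoint B) :
    upperNorm (t • x) = t * upperNorm x := by
  refine le_antisymm (upperNorm_smul_le ht x) ?_
  have h := upperNorm_smul_le (inv_pos.2 ht) (t • x)
  rw [smul_smul, inv_mul_cancel₀ ht.ne', one_smul] at h
  rwa [inv_mul_eq_div, le_div_iff₀ ht, mul_comm] at h

theorem upperNorm_nonpos {x : selfAdjoint B} (hx : (x : B) ≤ 0) : upperNorm x ≤ 0 :=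
  (upperNorm_le le_rfl hx).trans (by simp)

/-- From $-d\le x\le c$ one gets $0\le x+(c+d)\le 2(c+d)$, hence $\|x\|\le 3\|c+d\|$. Thus a
functional bounded in norm is bounded on the pairs $(x,-x)$ by a sublinear functional that is
nonpositive on negative pairs. -/
theorem norm_le_upperNorm (x : selfAdjoint B) :
    ‖(x : B)‖ ≤ 3 * (upperNorm x + upperNorm (-x)) := by
  refine le_of_forall_pos_le_add fun ε hε => ?_
  obtain ⟨c, hc, hx, hc'⟩ := exists_lt_upperNorm_add x (show 0 < ε / 6 by positivity)
  obtain ⟨d, hd, hy, hd'⟩ := exists_lt_upperNorm_add (-x) (show 0 < ε / 6 by positivity)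
  have hy' : -d ≤ (x : B) := neg_le.1 (by simpa using hy)
  have h1 : 0 ≤ (x : B) + (c + d) := by
    have := add_le_add hy' (le_add_of_nonneg_left hc : d ≤ c + d)
    simpa using this
  have h2 : (x : B) + (c + d) ≤ (c + d) + (c + d) := by
    gcongr
    exact hx.trans (le_add_of_nonneg_right hd)
  have h3 := CStarAlgebra.norm_le_norm_of_nonneg_of_le h1 h2
  have h4 := norm_sub_le ((x : B) + (c + d)) (c + d)
  rw [add_sub_cancel_right] at h4
  linarith [norm_add_le (c + d) (c + d), norm_add_le c d]

/-- The complex linear extension of a positive real functional on the self-adjoint part. -/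
def positiveExtension (h : selfAdjoint B →ₗ[ℝ] ℝ) (hpos : ∀ x : selfAdjoint B, 0 ≤ (x : B) → 0 ≤ h x) :
    B →ₚ[ℂ] ℂ :=
  let f : B →ₗ[ℂ] ℂ :=
    { toFun := fun b => (h (ℜ b) : ℂ) + Complex.I * h (ℑ b)
      map_add' := fun b c => by simp; ring
      map_smul' := fun z b => by
        apply Complex.ext <;> simp [realPart_smul, imaginaryPart_smul] }
  { f with
    monotone' := fun b c hbc => by
      have hs : IsSelfAdjoint (c - b) := .of_nonneg (sub_nonneg.2 hbc)
      have h1 : f (c - b) = (h (ℜ (c - b)) : ℂ) := by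
        change (h (ℜ (c - b)) : ℂ) + Complex.I * h (ℑ (c - b)) = _
        rw [hs.imaginaryPart]
        simp
      have h2 : 0 ≤ h (ℜ (c - b)) := hpos _ (by rw [hs.coe_realPart]; exact sub_nonneg.2 hbc)
      have h3 : 0 ≤ f (c - b) := by
        rw [h1]
        exact_mod_cast h2
      rw [map_sub, sub_nonneg] at h3
      exact h3 }

theorem positiveExtension_apply (h : selfAdjoint B →ₗ[ℝ] ℝ)
    (hpos : ∀ x : selfAdjoint B, 0 ≤ (x : B) → 0 ≤ h x) (b : B) :
    positiveExtension h hpos b = (h (ℜ b) : ℂ) + Complex.I * h (ℑ b) := rfl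

/-- A bounded real functional on the self-adjoint part is a difference of positive ones. -/
theorem exists_positive_sub_positive (g : selfAdjoint B →ₗ[ℝ] ℝ) (C : ℝ) (hC : 0 ≤ C)
    (hg : ∀ x, g x ≤ C * ‖(x : B)‖) :
    ∃ p q : B →ₚ[ℂ] ℂ, ∀ b, p b - q b = (g (ℜ b) : ℂ) + Complex.I * g (ℑ b) := by
  -- Hahn–Banach on pairs: $(x,-x)\mapsto g(x)$ on the antidiagonal extends to $G$ dominated by the
  -- sum of the `upperNorm`s. The domination makes both restrictions of $G$ to the axes positive,
  -- and $G(x,0)-G(0,x)=G(x,-x)=g(x)$.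
  let D : Submodule ℝ (selfAdjoint B × selfAdjoint B) := LinearMap.ker (LinearMap.fst ℝ _ _ + LinearMap.snd ℝ _ _)
  obtain ⟨G, hG, hGle⟩ := exists_extension_of_le_sublinear
    (⟨D, (g ∘ₗ LinearMap.fst ℝ _ _).domRestrict D⟩ : (selfAdjoint B × selfAdjoint B) →ₗ.[ℝ] ℝ)
    (fun x => (3 * C) * (upperNorm x.1 + upperNorm x.2))
    (fun t ht x => by
      simp only [Prod.smul_fst, Prod.smul_snd, upperNorm_smul ht]; ring)
    (fun x y => by
      have h1 := upperNorm_add_le x.1 y.1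
      have h2 := upperNorm_add_le x.2 y.2
      simp only [Prod.fst_add, Prod.snd_add]
      nlinarith)
    (fun x => by
      obtain ⟨⟨x, y⟩, hxy⟩ := x
      have hy : y = -x := by
        have : x + y = 0 := hxy
        exact (neg_eq_of_add_eq_zero_right this).symm
      subst hy
      change g x ≤ (3 * C) * (upperNorm x + upperNorm (-x))
      have h1 := norm_le_upperNorm x
      nlinarith [hg x])
  have hneg : ∀ z : selfAdjoint B × selfAdjoint B, (z.1 : B) ≤ 0 → (z.2 : B) ≤ 0 → G z ≤ 0 := fun z h1 h2 => by
    refine (hGle z).trans ?_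
    have := upperNorm_nonpos h1
    have := upperNorm_nonpos h2
    nlinarith
  refine ⟨positiveExtension (G ∘ₗ LinearMap.inl ℝ _ _) fun x hx => ?_,
    positiveExtension (G ∘ₗ LinearMap.inr ℝ _ _) fun x hx => ?_, fun b => ?_⟩
  · have h := hneg (-x, 0) (by simpa using hx) (by simp)
    have h' : G (-x, 0) = - G (x, 0) := by rw [← map_neg]; simp
    rw [h'] at h
    simpa using h
  · have h := hneg (0, -x) (by simp) (by simpa using hx)
    have h' : G (0, -x) = - G (0, x) := by rw [← map_neg]; simp
    rw [h'] at h
    simpa using h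
  · have key : ∀ x, G (x, 0) - G (0, x) = g x := fun x => by
      rw [← map_sub]
      have := hG ⟨(x, -x), by simp [D]⟩
      simpa using this
    simp only [positiveExtension_apply, LinearMap.comp_apply, LinearMap.inl_apply,
      LinearMap.inr_apply, ← key]
    push_cast
    ring

theorem norm_positive_star_mul_le (p : B →ₚ[ℂ] ℂ) (b c : B) :
    ‖p (star b * c)‖ ≤ ‖p.toPreGNS b‖ * ‖p.toPreGNS c‖ :=
  norm_inner_le_norm (𝕜 := ℂ) (p.toPreGNS b) (p.toPreGNS c)

theorem norm_toPreGNS_le_add_left (p q : B →ₚ[ℂ] ℂ) (b : B) :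
    ‖p.toPreGNS b‖ ≤ ‖(p + q).toPreGNS b‖ := by
  rw [PositiveLinearMap.preGNS_norm_def, PositiveLinearMap.preGNS_norm_def]
  refine Real.sqrt_le_sqrt ?_
  have h := (Complex.le_def.1 (q.map_nonneg (star_mul_self_nonneg b))).1
  simpa using h

/-- Every bounded functional is dominated, as a form `f (b⋆ c)`, by a positive functional. -/
theorem exists_positive_dominating (f : B →L[ℂ] ℂ) :
    ∃ p : B →ₚ[ℂ] ℂ, ∀ b c, ‖f (star b * c)‖ ≤ 4 * (‖p.toPreGNS b‖ * ‖p.toPreGNS c‖) := by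
  let gr : selfAdjoint B →ₗ[ℝ] ℝ :=
    { toFun := fun x => (f x).re
      map_add' := fun x y => by simp
      map_smul' := fun t x => by simp }
  let gi : selfAdjoint B →ₗ[ℝ] ℝ :=
    { toFun := fun x => (f x).im
      map_add' := fun x y => by simp
      map_smul' := fun t x => by simp }
  obtain ⟨p, q, hpq⟩ := exists_positive_sub_positive gr ‖f‖ (norm_nonneg _) fun x =>
    (Complex.re_le_norm _).trans (f.le_opNorm x)
  obtain ⟨r, s, hrs⟩ := exists_positive_sub_positive gi ‖f‖ (norm_nonneg _) fun x =>
    (Complex.im_le_norm _).trans (f.le_opNorm x)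
  -- Real and imaginary part of $f$ on self-adjoint elements are each a difference of two positive
  -- functionals. Four positive functionals occur, each with its Cauchy–Schwarz inequality, which is
  -- the constant $4$.
  have hf : ∀ b, f b = p b - q b + Complex.I * (r b - s b) := fun b => by
    rw [hpq, hrs]
    conv_lhs => rw [← realPart_add_I_smul_imaginaryPart b, map_add, map_smul]
    apply Complex.ext <;> simp [gr, gi] <;> ring
  refine ⟨p + q + (r + s), fun b c => ?_⟩
  have key : ∀ t t' : B →ₚ[ℂ] ℂ, t + t' = p + q + (r + s) → ‖t (star b * c)‖ ≤
      ‖(p + q + (r + s)).toPreGNS b‖ * ‖(p + q + (r + s)).toPreGNS c‖ := fun t t' h => by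
    refine (norm_positive_star_mul_le t b c).trans ?_
    rw [← h]
    exact mul_le_mul (norm_toPreGNS_le_add_left t t' b) (norm_toPreGNS_le_add_left t t' c)
      (norm_nonneg _) (norm_nonneg _)
  have h1 := key p (q + (r + s)) (by abel)
  have h2 := key q (p + (r + s)) (by abel)
  have h3 := key r (p + q + s) (by abel)
  have h4 := key s (p + q + r) (by abel)
  rw [hf]
  have e1 := norm_add_le (p (star b * c) - q (star b * c))
    (Complex.I * (r (star b * c) - s (star b * c)))
  rw [norm_mul, Complex.norm_I, one_mul] at e1
  linarith [norm_sub_le (p (star b * c)) (q (star b * c)),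
    norm_sub_le (r (star b * c)) (s (star b * c))]

theorem norm_toPreGNS_le_sum {J : Type*} (s : Finset J) (p : J → B →ₚ[ℂ] ℂ) {j : J} (hj : j ∈ s)
    (b : B) : ‖(p j).toPreGNS b‖ ≤ ‖(∑ j ∈ s, p j).toPreGNS b‖ := by
  classical
  rw [← Finset.add_sum_erase s p hj]
  exact norm_toPreGNS_le_add_left _ _ b

theorem exists_positive_dominating_family {J : Type*} [Fintype J] (f : J → B →L[ℂ] ℂ) :
    ∃ p : B →ₚ[ℂ] ℂ, ∀ j b c, ‖f j (star b * c)‖ ≤ 4 * (‖p.toPreGNS b‖ * ‖p.toPreGNS c‖) := by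
  choose p hp using fun j => exists_positive_dominating (f j)
  refine ⟨∑ j, p j, fun j b c => (hp j b c).trans ?_⟩
  have h1 := norm_toPreGNS_le_sum Finset.univ p (Finset.mem_univ j) b
  have h2 := norm_toPreGNS_le_sum Finset.univ p (Finset.mem_univ j) c
  gcongr

/-- Finitely many bounded functionals, not all of them zero, are dominated by a state. -/
theorem exists_state_dominating {J : Type*} [Fintype J] (f : J → B →L[ℂ] ℂ)
    (hf : ∃ j b c, f j (star b * c) ≠ 0) :
    ∃ (φ : State B) (K : ℝ), ∀ j b c,
      ‖f j (star b * c)‖ ≤ K * (‖φ.1.toPreGNS b‖ * ‖φ.1.toPreGNS c‖) := by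
  obtain ⟨p, hp⟩ := exists_positive_dominating_family f
  obtain ⟨C, hC⟩ := p.exists_norm_apply_le
  -- The supremum of this set is the norm of $p$, and dividing by it turns $p$ into a state. If it
  -- were $0$, then $p=0$ and all the dominated forms would vanish, against `hf`.
  set S : Set ℝ := (fun b => ‖p b‖) '' Metric.closedBall (0 : B) 1 with hS
  have hne : S.Nonempty := ⟨_, 0, by simp, rfl⟩
  have hbdd : BddAbove S := ⟨C, by
    rintro _ ⟨b, hb, rfl⟩
    refine (hC b).trans ?_
    rw [mem_closedBall_zero_iff] at hb
    exact mul_le_of_le_one_right C.2 hb⟩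
  have hlub := isLUB_csSup hne hbdd
  have hpos : 0 < sSup S := by
    refine lt_of_le_of_ne (hlub.1 ⟨0, by simp, by simp⟩) fun h0 => ?_
    obtain ⟨j, b, c, hj⟩ := hf
    have hz : ∀ d : B, p d = 0 := fun d => by
      by_contra hd
      have hd0 : d ≠ 0 := fun h => hd (by rw [h, map_zero])
      have h1 := hlub.1 ⟨((‖d‖⁻¹ : ℝ) : ℂ) • d, by
        simp [norm_smul, inv_mul_cancel₀ (norm_ne_zero_iff.2 hd0)], rfl⟩
      rw [← h0] at h1
      have h2 := norm_le_zero_iff.1 h1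
      rw [map_smul, smul_eq_zero] at h2
      rcases h2 with h2 | h2
      · simp [hd0] at h2
      · exact hd h2
    have h3 := hp j b c
    rw [PositiveLinearMap.preGNS_norm_def p, hz] at h3
    simp at h3
    exact hj h3
  set r : ℝ := sSup S
  let q : B →ₚ[ℂ] ℂ := { (((r⁻¹ : ℝ) : ℂ) • p.toLinearMap : B →ₗ[ℂ] ℂ) with
    monotone' := fun b c hbc => by
      have h := OrderHomClass.mono p hbc
      exact smul_le_smul_of_nonneg_left h (by exact_mod_cast (inv_pos.2 hpos).le) }
  have hq : ∀ b, q b = ((r⁻¹ : ℝ) : ℂ) * p b := fun b => rfl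
  have hqn : ∀ b, ‖q b‖ = r⁻¹ * ‖p b‖ := fun b => by
    rw [hq, norm_mul, Complex.norm_real, Real.norm_of_nonneg (inv_pos.2 hpos).le]
  have hstate : IsLUB ((fun b => ‖q b‖) '' Metric.closedBall (0 : B) 1) 1 := by
    constructor
    · rintro _ ⟨b, hb, rfl⟩
      change ‖q b‖ ≤ 1
      rw [hqn, inv_mul_le_iff₀ hpos, mul_one]
      exact hlub.1 ⟨b, hb, rfl⟩
    · intro t ht
      have h1 : r ≤ r * t := hlub.2 (by
        rintro _ ⟨b, hb, rfl⟩
        have h2 := ht ⟨b, hb, rfl⟩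
        change ‖q b‖ ≤ t at h2
        rwa [hqn, inv_mul_le_iff₀ hpos] at h2)
      exact (le_mul_iff_one_le_right hpos).1 h1
  have hnorm : ∀ b, ‖p.toPreGNS b‖ = √r * ‖q.toPreGNS b‖ := fun b => by
    rw [PositiveLinearMap.preGNS_norm_def, PositiveLinearMap.preGNS_norm_def, hq,
      ← Real.sqrt_mul hpos.le, Complex.re_ofReal_mul, ← mul_assoc, mul_inv_cancel₀ hpos.ne', one_mul]
    rfl
  refine ⟨⟨q, hstate⟩, 4 * r, fun j b c => (hp j b c).trans_eq ?_⟩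
  rw [hnorm, hnorm]
  calc _ = 4 * (√r * √r) * (‖q.toPreGNS b‖ * ‖q.toPreGNS c‖) := by ring
    _ = _ := by rw [Real.mul_self_sqrt hpos.le]

end Jordan

/-! ## Operators in the commutant of the universal representation -/

section HilbertSum

variable {ι : Type*} {G : ι → Type*} [∀ i, NormedAddCommGroup (G i)]
  [∀ i, InnerProductSpace ℂ (G i)]

open scoped Classical in
/-- The inclusion of a summand into a Hilbert sum. -/
def l2Incl (i : ι) : G i →L[ℂ] lp G 2 :=
  (lp.lsingle (𝕜 := ℂ) 2 i).mkContinuous 1 fun v => by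
    rw [one_mul]
    exact (lp.norm_single (by norm_num) i v).le

/-- The projection of a Hilbert sum onto a summand. -/
def l2Proj (i : ι) : lp G 2 →L[ℂ] G i :=
  LinearMap.mkContinuous
    { toFun := fun v => v i
      map_add' := fun _ _ => rfl
      map_smul' := fun _ _ => rfl } 1 fun v => by
    rw [one_mul]
    exact lp.norm_apply_le_norm (by norm_num) v i

theorem l2Proj_l2Incl (i : ι) (v : G i) : l2Proj i (l2Incl i v) = v := by
  classical
  exact lp.single_apply_self 2 i v

theorem l2Incl_apply_of_ne {i j : ι} (h : j ≠ i) (v : G i) : l2Incl i v j = 0 := by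
  classical
  exact lp.single_apply_ne 2 i v h

theorem inner_l2Incl_left (i : ι) (v : G i) (w : lp G 2) :
    ⟪l2Incl i v, w⟫_ℂ = ⟪v, l2Proj i w⟫_ℂ := by
  classical
  exact lp.inner_single_left i v w

end HilbertSum

section CommutantOperators

variable {B : Type*} [NonUnitalCStarAlgebra B] [PartialOrder B] [StarOrderedRing B]

open scoped ComplexOrder

/-- The operator on the GNS space of `φ` which represents the form `(b, c) ↦ f (b⋆ c)`. -/
theorem exists_gns_operator (φ : B →ₚ[ℂ] ℂ) (f : B →L[ℂ] ℂ) (K : ℝ)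
    (hK : ∀ b c, ‖f (star b * c)‖ ≤ K * (‖φ.toPreGNS b‖ * ‖φ.toPreGNS c‖)) :
    ∃ y : φ.GNS →L[ℂ] φ.GNS, ∀ b c : B,
      ⟪((φ.toPreGNS b : φ.PreGNS) : φ.GNS), y ((φ.toPreGNS c : φ.PreGNS) : φ.GNS)⟫_ℂ
        = f (star b * c) := by
  -- For fixed $c$ the map $b\mapsto f(b^*c)$ is conjugate linear, so its conjugate is a bounded
  -- functional. Its Riesz vector is the value of the operator at $[c]$.
  let Ψ : B → φ.PreGNS →L[ℂ] ℂ := fun c => LinearMap.mkContinuous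
    { toFun := fun b => star (f (star (φ.ofPreGNS b) * c))
      map_add' := fun b b' => by simp [add_mul]
      map_smul' := fun t b => by simp [smul_mul_assoc] } (K * ‖φ.toPreGNS c‖) fun b => by
    change ‖star (f (star (φ.ofPreGNS b) * c))‖ ≤ _
    rw [norm_star]
    refine (hK _ _).trans_eq ?_
    rw [PositiveLinearMap.toPreGNS_ofPreGNS]
    ring
  let Ψ' : B → φ.GNS →L[ℂ] ℂ := fun c => (Ψ c).extend UniformSpace.Completion.toComplL
  have hΨ' : ∀ b c, Ψ' c ((φ.toPreGNS b : φ.PreGNS) : φ.GNS) = star (f (star b * c)) := fun b c =>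
    ContinuousLinearMap.extend_eq _ UniformSpace.Completion.denseRange_coe
      (UniformSpace.Completion.isUniformInducing_coe _) (φ.toPreGNS b)
  let v : B → φ.GNS := fun c => (InnerProductSpace.toDual ℂ φ.GNS).symm (Ψ' c)
  have hv : ∀ b c, ⟪((φ.toPreGNS b : φ.PreGNS) : φ.GNS), v c⟫_ℂ = f (star b * c) := fun b c => by
    rw [← inner_conj_symm, InnerProductSpace.toDual_symm_apply, hΨ']
    exact star_star _
  have hext : ∀ w w' : φ.GNS, (∀ b, ⟪((φ.toPreGNS b : φ.PreGNS) : φ.GNS), w⟫_ℂ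
      = ⟪((φ.toPreGNS b : φ.PreGNS) : φ.GNS), w'⟫_ℂ) → w = w' := fun w w' h => by
    refine ext_inner_left ℂ fun u => ?_
    induction u using UniformSpace.Completion.induction_on with
    | hp => apply isClosed_eq <;> fun_prop
    | ih u => exact h (φ.ofPreGNS u)
  have hvn : ∀ c, ‖v c‖ ≤ K * ‖φ.toPreGNS c‖ := fun c => by
    rw [LinearIsometryEquiv.norm_map]
    -- Nonnegativity of $K$ can be read off only from some $c$ with $\|[c]\|>0$; for a null vector
    -- the Riesz vector is zero.
    rcases (norm_nonneg (φ.toPreGNS c)).eq_or_lt with h0 | h0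
    · have : v c = 0 := hext _ _ fun b => by
        rw [hv, inner_zero_right, ← norm_le_zero_iff]
        refine (hK b c).trans ?_
        rw [← h0]; simp
      rw [← LinearIsometryEquiv.norm_map (InnerProductSpace.toDual ℂ φ.GNS).symm]
      change ‖v c‖ ≤ _
      rw [this, ← h0]; simp
    · have hK0 : 0 ≤ K := by
        have := (norm_nonneg _).trans (hK c c)
        exact nonneg_of_mul_nonneg_left this (mul_pos h0 h0)
      refine ContinuousLinearMap.opNorm_le_bound _ (by positivity) fun w => ?_
      induction w using UniformSpace.Completion.induction_on with
      | hp => exact isClosed_le (by fun_prop) (by fun_prop)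
      | ih w =>
        have h1 := hΨ' (φ.ofPreGNS w) c
        rw [PositiveLinearMap.toPreGNS_ofPreGNS] at h1
        rw [h1, norm_star, UniformSpace.Completion.norm_coe]
        refine (hK _ _).trans_eq ?_
        rw [PositiveLinearMap.toPreGNS_ofPreGNS]
        ring
  let V : φ.PreGNS →L[ℂ] φ.GNS := LinearMap.mkContinuous
    { toFun := fun c => v (φ.ofPreGNS c)
      map_add' := fun c c' => hext _ _ fun b => by
        simp only [inner_add_right, hv, map_add, mul_add]
      map_smul' := fun t c => hext _ _ fun b => by
        simp only [inner_smul_right, hv, map_smul, mul_smul_comm, RingHom.id_apply, smul_eq_mul] } K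
    fun c => hvn (φ.ofPreGNS c)
  refine ⟨V.extend UniformSpace.Completion.toComplL, fun b c => ?_⟩
  have h2 : V.extend UniformSpace.Completion.toComplL ((φ.toPreGNS c : φ.PreGNS) : φ.GNS) = v c :=
    ContinuousLinearMap.extend_eq _ UniformSpace.Completion.denseRange_coe
      (UniformSpace.Completion.isUniformInducing_coe _) (φ.toPreGNS c)
  rw [h2, hv]

/-- The form depends on $b^*c$ only: tested on $[b]$ and $[c]$, both sides give $f(b^*dc)$. -/
theorem gns_operator_commute (φ : B →ₚ[ℂ] ℂ) (f : B →L[ℂ] ℂ) (y : φ.GNS →L[ℂ] φ.GNS)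
    (hy : ∀ b c : B,
      ⟪((φ.toPreGNS b : φ.PreGNS) : φ.GNS), y ((φ.toPreGNS c : φ.PreGNS) : φ.GNS)⟫_ℂ
        = f (star b * c)) (d : B) (w : φ.GNS) :
    φ.gnsNonUnitalStarAlgHom d (y w) = y (φ.gnsNonUnitalStarAlgHom d w) := by
  refine ext_inner_left ℂ fun u => ?_
  induction u, w using UniformSpace.Completion.induction_on₂ with
  | hp => apply isClosed_eq <;> fun_prop
  | ih u w =>
    obtain ⟨b, rfl⟩ := φ.toPreGNS.surjective u
    obtain ⟨c, rfl⟩ := φ.toPreGNS.surjective w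
    have h1 : φ.gnsNonUnitalStarAlgHom d ((φ.toPreGNS c : φ.PreGNS) : φ.GNS)
        = ((φ.toPreGNS (d * c) : φ.PreGNS) : φ.GNS) :=
      PositiveLinearMap.gnsNonUnitalStarAlgHom_apply_coe φ
    have h2 : φ.gnsNonUnitalStarAlgHom (star d) ((φ.toPreGNS b : φ.PreGNS) : φ.GNS)
        = ((φ.toPreGNS (star d * b) : φ.PreGNS) : φ.GNS) :=
      PositiveLinearMap.gnsNonUnitalStarAlgHom_apply_coe φ
    rw [← ContinuousLinearMap.adjoint_inner_left, ← ContinuousLinearMap.star_eq_adjoint, ← map_star,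
      h1, h2, hy, hy, star_mul, star_star, mul_assoc]

/-- The inclusion of the GNS space of `φ` into the universal representation. -/
def stateIncl (φ : State B) : φ.1.GNS →L[ℂ] UnivSpace B :=
  l2Incl (G := fun φ : State B => φ.1.GNS) φ

/-- The projection of the universal representation onto the GNS space of `φ`. -/
def stateProj (φ : State B) : UnivSpace B →L[ℂ] φ.1.GNS :=
  l2Proj (G := fun φ : State B => φ.1.GNS) φ

theorem stateProj_stateIncl (φ : State B) (v : φ.1.GNS) : stateProj φ (stateIncl φ v) = v :=
  l2Proj_l2Incl (G := fun φ : State B => φ.1.GNS) φ v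

theorem inner_stateIncl_left (φ : State B) (v : φ.1.GNS) (w : UnivSpace B) :
    ⟪stateIncl φ v, w⟫_ℂ = ⟪v, stateProj φ w⟫_ℂ :=
  inner_l2Incl_left (G := fun φ : State B => φ.1.GNS) φ v w

theorem univRep_stateIncl (φ : State B) (b : B) (v : φ.1.GNS) :
    univRep B b (stateIncl φ v) = stateIncl φ (φ.1.gnsNonUnitalStarAlgHom b v) := by
  refine lp.ext (funext fun ψ => ?_)
  rcases eq_or_ne ψ φ with rfl | h
  · exact (congrArg (ψ.1.gnsNonUnitalStarAlgHom b) (stateProj_stateIncl ψ v)).trans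
      (stateProj_stateIncl ψ _).symm
  · exact (congrArg (ψ.1.gnsNonUnitalStarAlgHom b) (l2Incl_apply_of_ne (G := fun φ : State B => φ.1.GNS) h v)).trans
      ((map_zero _).trans (l2Incl_apply_of_ne (G := fun φ : State B => φ.1.GNS) h _).symm)

theorem stateProj_univRep (φ : State B) (b : B) (v : UnivSpace B) :
    stateProj φ (univRep B b v) = φ.1.gnsNonUnitalStarAlgHom b (stateProj φ v) := rfl

/-- The operator on the universal representation given by an operator in the commutant of the GNS
representation of `φ`. -/
def stateCommutant (φ : State B) (y : φ.1.GNS →L[ℂ] φ.1.GNS)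
    (hy : ∀ d w, φ.1.gnsNonUnitalStarAlgHom d (y w) = y (φ.1.gnsNonUnitalStarAlgHom d w)) :
    Commutant (univRep B) :=
  ⟨stateIncl φ ∘L y ∘L stateProj φ, by
    have h : ∀ b, univRep B b * (stateIncl φ ∘L y ∘L stateProj φ)
        = (stateIncl φ ∘L y ∘L stateProj φ) * univRep B b := fun b => by
      ext1 v
      change univRep B b (stateIncl φ (y (stateProj φ v)))
        = stateIncl φ (y (stateProj φ (univRep B b v)))
      rw [univRep_stateIncl, stateProj_univRep, hy]
    rw [StarSubalgebra.mem_centralizer_iff]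
    rintro _ ⟨b, rfl⟩
    exact ⟨h b, by rw [← map_star]; exact h _⟩⟩

theorem stateCommutant_apply (φ : State B) (y : φ.1.GNS →L[ℂ] φ.1.GNS)
    (hy : ∀ d w, φ.1.gnsNonUnitalStarAlgHom d (y w) = y (φ.1.gnsNonUnitalStarAlgHom d w))
    (v : UnivSpace B) : (stateCommutant φ y hy).1 v = stateIncl φ (y (stateProj φ v)) := rfl

/-- The projection onto the GNS space of `φ`, as an element of the commutant. -/
def stateSupport (φ : State B) : Commutant (univRep B) :=
  stateCommutant φ (ContinuousLinearMap.id ℂ _) fun _ _ => rfl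

theorem stateSupport_apply (φ : State B) (v : UnivSpace B) :
    (stateSupport φ).1 v = stateIncl φ (stateProj φ v) := rfl

theorem star_stateSupport (φ : State B) : star (stateSupport φ) = stateSupport φ := by
  refine Subtype.ext ?_
  change star (stateSupport φ).1 = (stateSupport φ).1
  rw [ContinuousLinearMap.star_eq_adjoint, eq_comm, ContinuousLinearMap.eq_adjoint_iff]
  intro v w
  rw [stateSupport_apply, stateSupport_apply, inner_stateIncl_left, ← inner_conj_symm v,
    inner_stateIncl_left, inner_conj_symm]

theorem stateSupport_mul_mul (φ : State B) (y : φ.1.GNS →L[ℂ] φ.1.GNS)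
    (hy : ∀ d w, φ.1.gnsNonUnitalStarAlgHom d (y w) = y (φ.1.gnsNonUnitalStarAlgHom d w)) :
    stateSupport φ * stateCommutant φ y hy * stateSupport φ = stateCommutant φ y hy := by
  refine Subtype.ext (ContinuousLinearMap.ext fun v => ?_)
  change (stateSupport φ).1 ((stateCommutant φ y hy).1 ((stateSupport φ).1 v)) = _
  simp only [stateSupport_apply, stateCommutant_apply, stateProj_stateIncl]

/-- The vector of the universal representation given by `b ∈ B` in the GNS space of `φ`. -/
def stateVec (φ : State B) : B →ₗ[ℂ] UnivSpace B where
  toFun b := stateIncl φ ((φ.1.toPreGNS b : φ.1.PreGNS) : φ.1.GNS)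
  map_add' b c := by rw [map_add, UniformSpace.Completion.coe_add, map_add]
  map_smul' t b := by rw [map_smul, UniformSpace.Completion.coe_smul, map_smul]; rfl

theorem univRep_stateVec (φ : State B) (b c : B) :
    univRep B b (stateVec φ c) = stateVec φ (b * c) := by
  change univRep B b (stateIncl φ _) = stateIncl φ _
  rw [univRep_stateIncl]
  exact congrArg _ (PositiveLinearMap.gnsNonUnitalStarAlgHom_apply_coe φ.1)

theorem stateSupport_mem_closure (φ : State B) (v : UnivSpace B) :
    (stateSupport φ).1 v ∈ closure (Set.range (stateVec φ)) := by
  rw [stateSupport_apply]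
  generalize stateProj φ v = w
  induction w using UniformSpace.Completion.induction_on with
  | hp => exact isClosed_closure.preimage (stateIncl φ).continuous
  | ih w => exact subset_closure ⟨φ.1.ofPreGNS w, rfl⟩

/-- A bounded functional dominated by `φ` is represented by an operator in the commutant of the
universal representation. -/
theorem exists_commutant_of_dominated (φ : State B) (f : B →L[ℂ] ℂ) (K : ℝ)
    (hK : ∀ b c, ‖f (star b * c)‖ ≤ K * (‖φ.1.toPreGNS b‖ * ‖φ.1.toPreGNS c‖)) :
    ∃ x : Commutant (univRep B), stateSupport φ * x * stateSupport φ = x ∧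
      ∀ b c : B, ⟪stateVec φ b, x.1 (stateVec φ c)⟫_ℂ = f (star b * c) := by
  obtain ⟨y, hy⟩ := exists_gns_operator φ.1 f K hK
  refine ⟨stateCommutant φ y (gns_operator_commute φ.1 f y hy), stateSupport_mul_mul φ y _,
    fun b c => ?_⟩
  rw [stateCommutant_apply]
  change ⟪stateIncl φ _, stateIncl φ (y (stateProj φ (stateIncl φ _)))⟫_ℂ = _
  rw [inner_stateIncl_left, stateProj_stateIncl, stateProj_stateIncl, hy]

end CommutantOperators

/-! ## Module identities -/

section ModuleIdentities

variable {D E : Type*} [NonUnitalCStarAlgebra D] [PartialOrder D] [StarOrderedRing D]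
  [NormedAddCommGroup E] [NormedSpace ℂ E] [SMul D E] [CStarModule D E]

theorem smul_add' (d : D) (x y : E) : d • (x + y) = d • x + d • y :=
  ext_inner D fun z => by simp [mul_add]

theorem smul_smul_comm' (c : ℂ) (d : D) (x : E) : d • (c • x) = c • (d • x) :=
  ext_inner D fun z => by simp [mul_smul_comm]

theorem IsAdjoint.map_smul {F : Type*} [NormedAddCommGroup F] [NormedSpace ℂ F] [SMul D F]
    [CStarModule D F] {T : E →L[ℂ] F} {S : F →L[ℂ] E} (h : IsAdjoint D T S) (d : D) (x : E) :
    T (d • x) = d • T x :=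
  ext_inner D fun z => by
    rw [← h.symm, CStarModule.inner_op_smul_right, CStarModule.inner_op_smul_right, ← h.symm]

theorem AdjEnd.isAdjoint (T : AdjEnd D E) : IsAdjoint D T.val (star T).val := T.inner_apply_left

/-- With $k=\langle x,x\rangle$ and $d=d^*$, $\|d\|\le1$, the inner square of $dx-x$ is
$(k-dk)-(k-dk)d$, of norm at most $2\|k-dk\|$. -/
theorem tendsto_smul_approximateUnit (x : E) :
    Tendsto (fun d : D => d • x) (CStarAlgebra.approximateUnit D) (𝓝 x) := by
  have hu := CStarAlgebra.increasingApproximateUnit D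
  rw [tendsto_iff_norm_sub_tendsto_zero]
  have h1 : Tendsto (fun d : D => ‖inner D x x - d * inner D x x‖ * 2)
      (CStarAlgebra.approximateUnit D) (𝓝 0) := by
    have := ((hu.tendsto_mul_right (inner D x x)).const_sub (inner D x x)).norm.mul_const 2
    simpa using this
  have h2 : Tendsto (fun d : D => ‖d • x - x‖ ^ 2) (CStarAlgebra.approximateUnit D) (𝓝 0) := by
    refine squeeze_zero' (Eventually.of_forall fun _ => by positivity) ?_ h1
    filter_upwards [hu.eventually_norm, hu.eventually_star_eq] with d hd hs
    have h3 : (inner D (d • x - x) (d • x - x) : D)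
        = (inner D x x - d * inner D x x) - (inner D x x - d * inner D x x) * d := by
      simp [hs, sub_mul, mul_sub, mul_assoc]
      abel
    rw [CStarModule.norm_sq_eq D, h3]
    calc _ ≤ ‖(inner D x x : D) - d * inner D x x‖ + ‖((inner D x x : D) - d * inner D x x) * d‖ :=
          norm_sub_le _ _
      _ ≤ ‖(inner D x x : D) - d * inner D x x‖ + ‖(inner D x x : D) - d * inner D x x‖ * 1 := by
        gcongr
        exact (norm_mul_le _ _).trans (by gcongr)
      _ = _ := by ring
  have h3 := h2.sqrt
  simpa using h3

end ModuleIdentities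

/-! ## Positivity of forms under weak containment -/

section FormTransfer

variable {A B X Y H : Type*} [CStarAlgebra A]
  [NonUnitalCStarAlgebra B] [PartialOrder B] [StarOrderedRing B]
  [NormedAddCommGroup X] [NormedSpace ℂ X] [SMul Bᵐᵒᵖ X] [CStarModule Bᵐᵒᵖ X] [CompleteSpace X]
  [NormedAddCommGroup Y] [NormedSpace ℂ Y] [SMul Bᵐᵒᵖ Y] [CStarModule Bᵐᵒᵖ Y] [CompleteSpace Y]
  [NormedAddCommGroup H] [InnerProductSpace ℂ H] [CompleteSpace H]

/-- This reduces to the criterion for matrices over a C⋆-algebra: the operator $\sum b_i^*M_{ij}b_j$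
is positive because its quadratic form at $x$ is the given form at the vectors $b_ix$. -/
theorem exists_matrix_star_mul_self {K n : Type*} [NormedAddCommGroup K] [InnerProductSpace ℂ K]
    [CompleteSpace K] [Fintype n] (M : CStarMatrix n n (K →L[ℂ] K)) (hM : IsSelfAdjoint M)
    (h : ∀ u : n → K, 0 ≤ (∑ i, ∑ j, ⟪u i, M i j (u j)⟫_ℂ).re) :
    ∃ y : CStarMatrix n n (K →L[ℂ] K), M = star y * y := by
  refine exists_eq_star_mul_self_of_form_nonneg M hM fun b => ?_
  rw [ContinuousLinearMap.nonneg_iff_isPositive, ContinuousLinearMap.isPositive_def']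
  constructor
  · have hM' : ∀ i j, star (M i j) = M j i := fun i j => by
      conv_rhs => rw [← hM.star_eq]
      rfl
    rw [IsSelfAdjoint]
    simp only [star_sum, star_mul, star_star, hM', mul_assoc]
    exact Finset.sum_comm
  · intro x
    have h1 := h fun i => b i x
    rw [ContinuousLinearMap.reApplyInnerSelf_apply, ← inner_re_symm]
    refine h1.trans_eq ?_
    simp only [sum_apply, inner_sum, mul_apply_eq_comp, ContinuousLinearMap.star_eq_adjoint,
      ContinuousLinearMap.adjoint_inner_right]
    rfl

theorem form_star_mul_self_nonneg {K n : Type*} [NormedAddCommGroup K] [InnerProductSpace ℂ K]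
    [CompleteSpace K] [Fintype n] (y : CStarMatrix n n (K →L[ℂ] K)) (u : n → K) :
    0 ≤ (∑ i, ∑ j, ⟪u i, (star y * y) i j (u j)⟫_ℂ).re := by
  have h : ∑ i, ∑ j, ⟪u i, (star y * y) i j (u j)⟫_ℂ
      = ∑ l, ⟪∑ i, y l i (u i), ∑ j, y l j (u j)⟫_ℂ := by
    have hy : ∀ i j, (star y * y) i j = ∑ l, star (y l i) * y l j := fun i j => by
      rw [CStarMatrix.mul_apply]; rfl
    simp only [hy, sum_apply, inner_sum, sum_inner, mul_apply_eq_comp,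
      ContinuousLinearMap.star_eq_adjoint, ContinuousLinearMap.adjoint_inner_right]
    rw [Finset.sum_comm]
    exact (Finset.sum_congr rfl fun _ _ => Finset.sum_comm).trans
      Finset.sum_comm
  rw [h, Complex.re_sum]
  exact Finset.sum_nonneg fun l _ => inner_self_nonneg (𝕜 := ℂ)

/-- Under weak containment, positivity of the form of a matrix over `A ⊗_max π(B)'` passes
from `Y` to `X`. -/
theorem WeaklyContainedWrt.form_nonneg {π : B →⋆ₙₐ[ℂ] (H →L[ℂ] H)}
    {πX : A →⋆ₐ[ℂ] AdjEnd Bᵐᵒᵖ X} {πY : A →⋆ₐ[ℂ] AdjEnd Bᵐᵒᵖ Y}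
    (hXY : WeaklyContainedWrt π πX πY) {n : Type*} [Fintype n]
    (M : CStarMatrix n n (MaxTensor A (Commutant π))) (hM : IsSelfAdjoint M)
    (h : ∀ u : n → IntTensor Y π, 0 ≤ (∑ i, ∑ j, ⟪u i, theta πY π (M i j) (u j)⟫_ℂ).re)
    (u : n → IntTensor X π) : 0 ≤ (∑ i, ∑ j, ⟪u i, theta πX π (M i j) (u j)⟫_ℂ).re := by
  let _ := CStarAlgebra.spectralOrder (MaxTensor A (Commutant π))
  have := CStarAlgebra.spectralOrderedRing (MaxTensor A (Commutant π))
  -- The homomorphisms are applied entrywise, so the inclusion of kernels passes from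
  -- $A\otimes_{\max}\pi(B)'$ to matrices over it and positivity can be transferred there.
  obtain ⟨y, hy⟩ := exists_matrix_star_mul_self (CStarMatrix.mapₙₐ (thetaHom πY π) M)
    (hM.map (CStarMatrix.mapₙₐ (thetaHom πY π))) h
  obtain ⟨y', hy'⟩ := exists_eq_star_mul_self_of_ker_le (CStarMatrix.mapₙₐ (n := n) (thetaHom πY π))
    (CStarMatrix.mapₙₐ (thetaHom πX π)) (fun z hz => by
      refine CStarMatrix.ext fun i j => ?_
      have h1 : theta πY π (z i j) = 0 := congrFun (congrFun hz i) j
      exact hXY _ h1) M hM y hy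
  have h2 := form_star_mul_self_nonneg y' u
  rw [← hy'] at h2
  exact h2

end FormTransfer

/-! ## Vectors over a state -/

section StateTensor

variable {A B Y : Type*} [CStarAlgebra A]
  [NonUnitalCStarAlgebra B] [PartialOrder B] [StarOrderedRing B]
  [NormedAddCommGroup Y] [NormedSpace ℂ Y] [SMul Bᵐᵒᵖ Y] [CStarModule Bᵐᵒᵖ Y] [CompleteSpace Y]

theorem rinner_op_smul_right (x y : Y) (b : B) :
    rinner B x (MulOpposite.op b • y) = rinner B x y * b := by simp [rinner]

theorem rinner_op_smul_left (x y : Y) (b : B) :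
    rinner B (MulOpposite.op b • x) y = star b * rinner B x y := by simp [rinner]

variable (B Y) in
/-- The right action `Y ⊙ B → Y`. -/
def actionMap : Y ⊗[ℂ] B →ₗ[ℂ] Y :=
  TensorProduct.lift <| LinearMap.mk₂ ℂ (fun y b => MulOpposite.op b • y)
    (fun y y' b => smul_add' _ y y') (fun c y b => smul_smul_comm' c _ y)
    (fun y b b' => by rw [MulOpposite.op_add, add_smul'])
    (fun c y b => by rw [MulOpposite.op_smul, smul_smul_comm])

@[simp] theorem actionMap_tmul (y : Y) (b : B) :
    actionMap B Y (y ⊗ₜ b) = MulOpposite.op b • y := rfl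

variable (Y) in
/-- The map `Y ⊙ B → Y ⊗_B H` given by `b ↦ [b] ∈ H_φ ⊆ H`. -/
def stateTensor (φ : State B) : Y ⊗[ℂ] B →ₗ[ℂ] IntTensor Y (univRep B) :=
  (UniformSpace.Completion.toComplL (𝕜 := ℂ) (E := PreTensor Y (univRep B))).toLinearMap ∘ₗ
    (PreTensor.of Y (univRep B)).toLinearMap ∘ₗ TensorProduct.map LinearMap.id (stateVec φ)

theorem stateTensor_tmul (φ : State B) (y : Y) (b : B) :
    stateTensor Y φ (y ⊗ₜ b)
      = ((PreTensor.of Y (univRep B) (y ⊗ₜ stateVec φ b) : PreTensor Y (univRep B)) :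
        IntTensor Y (univRep B)) := rfl

/-- This is the dictionary between functionals of $B$-valued coefficients and matrix coefficients of
$\theta$: for elementary tensors, $\langle y\otimes[b],(T\otimes
x)(y'\otimes[c])\rangle=\langle[b],x[\langle y,Ty'\rangle c]\rangle=f(\langle yb,T(y'c)\rangle)$, as
$x$ commutes with $B$. -/
theorem inner_stateTensor (φ : State B) (f : B →L[ℂ] ℂ) (x : Commutant (univRep B))
    (hx : ∀ b c : B, ⟪stateVec φ b, x.1 (stateVec φ c)⟫_ℂ = f (star b * c)) (T : AdjEnd Bᵐᵒᵖ Y)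
    (s t : Y ⊗[ℂ] B) :
    ⟪stateTensor Y φ s, tensorOp (univRep B) T x (stateTensor Y φ t)⟫_ℂ
      = f (rinner B (actionMap B Y s) (T.val (actionMap B Y t))) := by
  induction s with
  | zero => simp [rinner]
  | add s s' hs hs' => simp only [map_add, inner_add_left, hs, hs', rinner_add_left]
  | tmul y b =>
    induction t with
    | zero => simp [rinner]
    | add t t' ht ht' => simp only [map_add, inner_add_right, ht, ht', rinner_add_right]
    | tmul y' c =>
      rw [stateTensor_tmul, stateTensor_tmul, tensorOp_coe, UniformSpace.Completion.inner_coe,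
        tensorLinear_tmul, PreTensor.inner_def, tensorForm_tmul, commutant_apply, univRep_stateVec,
        hx, actionMap_tmul, actionMap_tmul, T.isAdjoint.map_smul, rinner_op_smul_left,
        rinner_op_smul_right]

theorem continuous_coe_tmul {H : Type*} [NormedAddCommGroup H] [InnerProductSpace ℂ H]
    [CompleteSpace H] (π : B →⋆ₙₐ[ℂ] (H →L[ℂ] H)) (y : Y) :
    Continuous fun v : H => ((PreTensor.of Y π (y ⊗ₜ v) : PreTensor Y π) : IntTensor Y π) := by
  have h : ∀ v : H, ‖PreTensor.of Y π (y ⊗ₜ v)‖ ≤ √‖π (rinner B y y)‖ * ‖v‖ := fun v => by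
    refine abs_le_of_sq_le_sq' ?_ (by positivity) |>.2
    rw [mul_pow, Real.sq_sqrt (norm_nonneg _), ← inner_self_eq_norm_sq (𝕜 := ℂ), PreTensor.inner_def,
      tensorForm_tmul]
    calc _ ≤ ‖⟪v, π (rinner B y y) v⟫_ℂ‖ := Complex.re_le_norm _
      _ ≤ ‖v‖ * ‖π (rinner B y y) v‖ := norm_inner_le_norm _ _
      _ ≤ ‖v‖ * (‖π (rinner B y y)‖ * ‖v‖) := by gcongr; exact (π (rinner B y y)).le_opNorm v
      _ = _ := by ring
  let L : H →ₗ[ℂ] PreTensor Y π :=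
    (PreTensor.of Y π).toLinearMap ∘ₗ TensorProduct.mk ℂ Y H y
  exact (UniformSpace.Completion.continuous_coe _).comp (L.mkContinuous _ h).continuous

/-- The vectors $[b]$ are dense in the GNS space of $\varphi$, and $v\mapsto y\otimes v$ is
continuous. -/
theorem tensorOp_stateSupport_mem_closure (φ : State B) (u : IntTensor Y (univRep B)) :
    tensorOp (univRep B) (1 : AdjEnd Bᵐᵒᵖ Y) (stateSupport φ) u
      ∈ (LinearMap.range (stateTensor Y φ)).topologicalClosure := by
  induction u using UniformSpace.Completion.induction_on with
  | hp =>
    exact (LinearMap.range (stateTensor Y φ)).isClosed_topologicalClosure.preimage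
      (tensorOp (univRep B) (1 : AdjEnd Bᵐᵒᵖ Y) (stateSupport φ)).continuous
  | ih z =>
    obtain ⟨z, rfl⟩ := (PreTensor.of Y (univRep B)).surjective z
    induction z with
    | zero =>
      rw [map_zero, UniformSpace.Completion.coe_zero, map_zero]
      exact zero_mem _
    | add z z' hz hz' =>
      rw [map_add, UniformSpace.Completion.coe_add, map_add]
      exact add_mem hz hz'
    | tmul y v =>
      rw [tensorOp_coe, tensorLinear_tmul]
      have h1 : (fun v : UnivSpace B => ((PreTensor.of Y (univRep B) (y ⊗ₜ v) :
          PreTensor Y (univRep B)) : IntTensor Y (univRep B))) ((stateSupport φ).1 v)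
          ∈ closure ((fun v : UnivSpace B => ((PreTensor.of Y (univRep B) (y ⊗ₜ v) :
          PreTensor Y (univRep B)) : IntTensor Y (univRep B))) '' Set.range (stateVec φ)) :=
        image_closure_subset_closure_image (continuous_coe_tmul (univRep B) y)
          ⟨_, stateSupport_mem_closure φ v, rfl⟩
      refine closure_mono ?_ h1
      rintro _ ⟨_, ⟨b, rfl⟩, rfl⟩
      exact ⟨y ⊗ₜ b, stateTensor_tmul φ y b⟩

end StateTensor

/-! ## Approximation of coefficients -/

section CPApprox

/-- Every finite system of coefficients `⟨ξₗ, π(a) ξₖ⟩` is, approximately and for finitely many `a`,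
a sum of systems of coefficients of `ρ`. -/
def CoefficientApprox {A D E F : Type*} [CStarAlgebra A] [NonUnitalCStarAlgebra D] [PartialOrder D]
    [StarOrderedRing D]
    [NormedAddCommGroup E] [NormedSpace ℂ E] [SMul D E] [CStarModule D E]
    [NormedAddCommGroup F] [NormedSpace ℂ F] [SMul D F] [CStarModule D F]
    (π : A →⋆ₐ[ℂ] AdjEnd D E) (ρ : A →⋆ₐ[ℂ] AdjEnd D F) : Prop :=
  ∀ (m : ℕ) (ξ : Fin m → E) (S : Finset A) (ε : ℝ), 0 < ε →
    ∃ (n : ℕ) (η : Fin n → Fin m → F), ∀ a ∈ S, ∀ l k,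
      ‖inner D (ξ l) ((π a).val (ξ k)) - ∑ j, inner D (η j l) ((ρ a).val (η j k))‖ < ε

variable {A B X Y : Type*} [CStarAlgebra A]
  [NonUnitalCStarAlgebra B] [PartialOrder B] [StarOrderedRing B]
  [NormedAddCommGroup X] [NormedSpace ℂ X] [SMul Bᵐᵒᵖ X] [CStarModule Bᵐᵒᵖ X] [CompleteSpace X]
  [NormedAddCommGroup Y] [NormedSpace ℂ Y] [SMul Bᵐᵒᵖ Y] [CStarModule Bᵐᵒᵖ Y] [CompleteSpace Y]

theorem continuous_rinner {α : Type*} [TopologicalSpace α] {f g : α → Y} (hf : Continuous f)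
    (hg : Continuous g) : Continuous fun t => rinner B (f t) (g t) :=
  MulOpposite.continuous_unop.comp
    ((CStarModule.continuous_inner (A := Bᵐᵒᵖ) (E := Y)).comp (hf.prodMk hg))

variable {ι m : Type*} [Fintype ι] [Fintype m]

theorem sum_inner_stateTensor (πY : A →⋆ₐ[ℂ] AdjEnd Bᵐᵒᵖ Y) (φ : State B) (a : ι → A)
    (f : ι → m → m → B →L[ℂ] ℂ) (x : ι → m → m → Commutant (univRep B))
    (hx : ∀ i l k b c, ⟪stateVec φ b, (x i l k).1 (stateVec φ c)⟫_ℂ = f i l k (star b * c))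
    (s : m → Y ⊗[ℂ] B) :
    ∑ l, ∑ k, ⟪stateTensor Y φ (s l),
        thetaAlg πY (univRep B) (∑ i, a i ⊗ₜ x i l k) (stateTensor Y φ (s k))⟫_ℂ
      = ∑ l, ∑ k, ∑ i, f i l k (rinner B (actionMap B Y (s l))
        ((πY (a i)).val (actionMap B Y (s k)))) := by
  refine Finset.sum_congr rfl fun l _ => Finset.sum_congr rfl fun k _ => ?_
  rw [map_sum, sum_apply, inner_sum]
  refine Finset.sum_congr rfl fun i _ => ?_
  rw [thetaAlg_tmul, inner_stateTensor φ (f i l k) (x i l k) (hx i l k)]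

theorem inner_mul_mul_self {K : Type*} [NormedAddCommGroup K] [InnerProductSpace ℂ K]
    [CompleteSpace K] {P T : K →L[ℂ] K} (hP : star P = P) (hT : P * T * P = T) (u v : K) :
    ⟪u, T v⟫_ℂ = ⟪P u, T (P v)⟫_ℂ := by
  conv_lhs => rw [← hT]
  rw [mul_apply_eq_comp, mul_apply_eq_comp, ← ContinuousLinearMap.adjoint_inner_left,
    ← ContinuousLinearMap.star_eq_adjoint, hP]

theorem tensorOp_one_mul_mul (T : AdjEnd Bᵐᵒᵖ Y) {p x : Commutant (univRep B)}
    (hx : p * x * p = x) :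
    tensorOp (univRep B) (1 : AdjEnd Bᵐᵒᵖ Y) p * tensorOp (univRep B) T x *
      tensorOp (univRep B) (1 : AdjEnd Bᵐᵒᵖ Y) p = tensorOp (univRep B) T x := by
  have h1 := tensorOp_mul (univRep B) 1 T p x
  have h2 := tensorOp_mul (univRep B) (1 * T) 1 (p * x) p
  rw [h1, hx, one_mul, mul_one] at h2
  exact h2.symm

theorem star_tensorOp_stateSupport (φ : State B) :
    star (tensorOp (univRep B) (1 : AdjEnd Bᵐᵒᵖ Y) (stateSupport φ))
      = tensorOp (univRep B) (1 : AdjEnd Bᵐᵒᵖ Y) (stateSupport φ) := by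
  rw [← tensorOp_star, star_one, star_stateSupport]

theorem tensorOp_one_mul_thetaAlg_mul (πY : A →⋆ₐ[ℂ] AdjEnd Bᵐᵒᵖ Y) {p : Commutant (univRep B)}
    (a : ι → A) (x : ι → Commutant (univRep B)) (hx : ∀ i, p * x i * p = x i) :
    tensorOp (univRep B) (1 : AdjEnd Bᵐᵒᵖ Y) p * thetaAlg πY (univRep B) (∑ i, a i ⊗ₜ x i) *
      tensorOp (univRep B) (1 : AdjEnd Bᵐᵒᵖ Y) p = thetaAlg πY (univRep B) (∑ i, a i ⊗ₜ x i) := by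
  have h : thetaAlg πY (univRep B) (∑ i, a i ⊗ₜ x i)
      = ∑ i, tensorOp (univRep B) (πY (a i)) (x i) := by
    rw [map_sum]
    exact Finset.sum_congr rfl fun i _ => thetaAlg_tmul πY (univRep B) (a i) (x i)
  rw [h, Finset.mul_sum, Finset.sum_mul]
  exact Finset.sum_congr rfl fun i _ => tensorOp_one_mul_mul (πY (a i)) (hx i)

theorem sum_inner_stateSupport (πY : A →⋆ₐ[ℂ] AdjEnd Bᵐᵒᵖ Y) (φ : State B) (a : ι → A)
    (x : ι → m → m → Commutant (univRep B))
    (hx : ∀ i l k, stateSupport φ * x i l k * stateSupport φ = x i l k)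
    (u : m → IntTensor Y (univRep B)) :
    ∑ l, ∑ k, ⟪u l, thetaAlg πY (univRep B) (∑ i, a i ⊗ₜ x i l k) (u k)⟫_ℂ
      = ∑ l, ∑ k, ⟪tensorOp (univRep B) (1 : AdjEnd Bᵐᵒᵖ Y) (stateSupport φ) (u l),
          thetaAlg πY (univRep B) (∑ i, a i ⊗ₜ x i l k)
            (tensorOp (univRep B) (1 : AdjEnd Bᵐᵒᵖ Y) (stateSupport φ) (u k))⟫_ℂ :=
  Finset.sum_congr rfl fun l _ => Finset.sum_congr rfl fun k _ =>
    inner_mul_mul_self (star_tensorOp_stateSupport φ)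
      (tensorOp_one_mul_thetaAlg_mul πY a (fun i => x i l k) fun i => hx i l k) (u l) (u k)

/-- The operators $x_{ilk}$ live on the GNS space $H_\varphi$, so only the components of $u$ in
$Y\otimes_B H_\varphi$ matter. These are limits of images of $Y\odot B$, for which the form is the
one in `h`. -/
theorem sum_inner_nonneg_of_stateTensor (πY : A →⋆ₐ[ℂ] AdjEnd Bᵐᵒᵖ Y) (φ : State B) (a : ι → A)
    (f : ι → m → m → B →L[ℂ] ℂ) (x : ι → m → m → Commutant (univRep B))
    (hx : ∀ i l k b c, ⟪stateVec φ b, (x i l k).1 (stateVec φ c)⟫_ℂ = f i l k (star b * c))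
    (hx' : ∀ i l k, stateSupport φ * x i l k * stateSupport φ = x i l k)
    (h : ∀ η : m → Y,
      0 ≤ (∑ l, ∑ k, ∑ i, f i l k (rinner B (η l) ((πY (a i)).val (η k)))).re)
    (u : m → IntTensor Y (univRep B)) :
    0 ≤ (∑ l, ∑ k, ⟪u l, thetaAlg πY (univRep B) (∑ i, a i ⊗ₜ x i l k) (u k)⟫_ℂ).re := by
  rw [sum_inner_stateSupport πY φ a x hx' u]
  let S : Set (m → IntTensor Y (univRep B)) := {w | 0 ≤ (∑ l, ∑ k,
    ⟪w l, thetaAlg πY (univRep B) (∑ i, a i ⊗ₜ x i l k) (w k)⟫_ℂ).re}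
  have hS : IsClosed S := by
    refine isClosed_le continuous_const (Complex.continuous_re.comp ?_)
    refine continuous_finsetSum _ fun l _ => continuous_finsetSum _ fun k _ => ?_
    exact (continuous_apply l).inner ((ContinuousLinearMap.continuous _).comp (continuous_apply k))
  have hsub : Set.pi Set.univ (fun _ : m => (LinearMap.range (stateTensor Y φ) :
      Set (IntTensor Y (univRep B)))) ⊆ S := fun w hw => by
    choose s hs using fun l => hw l (Set.mem_univ l)
    have hw' : w = fun l => stateTensor Y φ (s l) := funext fun l => (hs l).symm
    change 0 ≤ (∑ l, ∑ k, ⟪w l, thetaAlg πY (univRep B) (∑ i, a i ⊗ₜ x i l k) (w k)⟫_ℂ).re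
    rw [hw', sum_inner_stateTensor πY φ a f x hx]
    exact h _
  have hmem : (fun l => tensorOp (univRep B) (1 : AdjEnd Bᵐᵒᵖ Y) (stateSupport φ) (u l))
      ∈ closure (Set.pi Set.univ (fun _ : m => (LinearMap.range (stateTensor Y φ) :
        Set (IntTensor Y (univRep B))))) := by
    rw [closure_pi_set]
    exact fun l _ => tensorOp_stateSupport_mem_closure φ (u l)
  exact closure_minimal hsub hS hmem

/-- A functional on coefficients yields a matrix $Z$ with no symmetry. Passing to $Z+Z^*$ gives the
self-adjointness required by `WeaklyContainedWrt.form_nonneg`, and the real part of the form only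
doubles. -/
theorem re_sum_inner_add_star {K N : Type*} [NormedAddCommGroup K] [InnerProductSpace ℂ K]
    [CompleteSpace K] [NonUnitalCStarAlgebra N] (θ : N →⋆ₙₐ[ℂ] (K →L[ℂ] K))
    (Z : CStarMatrix m m N) (u : m → K) :
    (∑ l, ∑ k, ⟪u l, θ ((Z + star Z) l k) (u k)⟫_ℂ).re
      = 2 * (∑ l, ∑ k, ⟪u l, θ (Z l k) (u k)⟫_ℂ).re := by
  have h : ∑ l, ∑ k, ⟪u l, θ ((Z + star Z) l k) (u k)⟫_ℂ
      = (∑ l, ∑ k, ⟪u l, θ (Z l k) (u k)⟫_ℂ)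
        + starRingEnd ℂ (∑ l, ∑ k, ⟪u l, θ (Z l k) (u k)⟫_ℂ) := by
    have h1 : ∀ l k, ⟪u l, θ ((Z + star Z) l k) (u k)⟫_ℂ
        = ⟪u l, θ (Z l k) (u k)⟫_ℂ + starRingEnd ℂ ⟪u k, θ (Z k l) (u l)⟫_ℂ := fun l k => by
      rw [CStarMatrix.add_apply, CStarMatrix.star_apply, map_add, map_star, add_apply,
        inner_add_right, inner_conj_symm, ContinuousLinearMap.star_eq_adjoint,
        ContinuousLinearMap.adjoint_inner_right]
    simp only [h1, Finset.sum_add_distrib, map_sum]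
    congr 1
    exact Finset.sum_comm
  rw [h, Complex.add_re, Complex.conj_re]
  ring

/-- Separating functionals on coefficients of `Y` separate coefficients of `X`. -/
theorem WeaklyContainedUniv.coefficient_nonneg {πX : A →⋆ₐ[ℂ] AdjEnd Bᵐᵒᵖ X}
    {πY : A →⋆ₐ[ℂ] AdjEnd Bᵐᵒᵖ Y} (hXY : WeaklyContainedUniv πX πY) (a : ι → A)
    (f : ι → m → m → B →L[ℂ] ℂ)
    (h : ∀ η : m → Y,
      0 ≤ (∑ l, ∑ k, ∑ i, f i l k (rinner B (η l) ((πY (a i)).val (η k)))).re)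
    (ξ : m → X) : 0 ≤ (∑ l, ∑ k, ∑ i, f i l k (rinner B (ξ l) ((πX (a i)).val (ξ k)))).re := by
  by_contra hneg
  have hcont : Continuous fun ξ : m → X =>
      (∑ l, ∑ k, ∑ i, f i l k (rinner B (ξ l) ((πX (a i)).val (ξ k)))).re := by
    refine Complex.continuous_re.comp (continuous_finsetSum _ fun l _ =>
      continuous_finsetSum _ fun k _ => continuous_finsetSum _ fun i _ => ?_)
    exact (f i l k).continuous.comp (continuous_rinner (continuous_apply l)
      ((ContinuousLinearMap.continuous _).comp (continuous_apply k)))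
  -- Only vectors in the image of $X\odot B\to X$ are visible in $X\otimes_B H_\varphi$. By
  -- continuity the strict inequality survives when all $\xi_l$ are replaced by $\xi_lb$ with a
  -- common $b$ from an approximate unit.
  have htend : Tendsto (fun d : Bᵐᵒᵖ => fun l => d • ξ l) (CStarAlgebra.approximateUnit Bᵐᵒᵖ) (𝓝 ξ) :=
    tendsto_pi_nhds.2 fun l => tendsto_smul_approximateUnit (ξ l)
  have hev := ((hcont.tendsto ξ).comp htend).eventually (gt_mem_nhds (not_le.1 hneg))
  have hne := (CStarAlgebra.increasingApproximateUnit Bᵐᵒᵖ).neBot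
  obtain ⟨d, hd⟩ := hev.exists
  obtain ⟨b, rfl⟩ : ∃ b, d = MulOpposite.op b := ⟨d.unop, rfl⟩
  simp only [Function.comp_apply] at hd
  -- A dominating state requires some form $f_{ilk}(b^*c)$ to be nonzero; otherwise the sum at the
  -- vectors $\xi_lb$ would be $0$, against `hd`.
  obtain ⟨φ, K, hK⟩ := exists_state_dominating (fun j : ι × m × m => f j.1 j.2.1 j.2.2) (by
    by_contra hall
    push Not at hall
    refine hd.ne ?_
    rw [Finset.sum_eq_zero fun l _ => Finset.sum_eq_zero fun k _ => Finset.sum_eq_zero fun i _ => ?_,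
      Complex.zero_re]
    rw [rinner_op_smul_left]
    exact hall (i, l, k) b _)
  choose x hx' hx using fun i l k =>
    exists_commutant_of_dominated φ (f i l k) K (hK (i, l, k))
  -- The separating functional written as the matrix $(\sum_i a_i\otimes x_{ilk})_{l,k}$ over
  -- $A\otimes_{\max}\pi_H(B)'$.
  let Z : CStarMatrix m m (MaxTensor A (Commutant (univRep B))) :=
    CStarMatrix.ofMatrix (Matrix.of fun l k =>
      ((PreMax.of A (Commutant (univRep B)) (∑ i, a i ⊗ₜ x i l k) :
        PreMax A (Commutant (univRep B))) : MaxTensor A (Commutant (univRep B))))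
  have hZX : ∀ l k, theta πX (univRep B) (Z l k)
      = thetaAlg πX (univRep B) (∑ i, a i ⊗ₜ x i l k) := fun l k => theta_coe πX _ _
  have hZY : ∀ l k, theta πY (univRep B) (Z l k)
      = thetaAlg πY (univRep B) (∑ i, a i ⊗ₜ x i l k) := fun l k => theta_coe πY _ _
  have hfin := WeaklyContainedWrt.form_nonneg hXY (Z + star Z) (IsSelfAdjoint.add_star_self Z)
    (fun u => by
      have h1 := re_sum_inner_add_star (thetaHom πY (univRep B)) Z u
      simp only [thetaHom_apply, hZY] at h1
      rw [h1]
      have h2 := sum_inner_nonneg_of_stateTensor πY φ a f x hx hx' h u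
      positivity)
    (fun l => stateTensor X φ (ξ l ⊗ₜ b))
  have h3 := re_sum_inner_add_star (thetaHom πX (univRep B)) Z
    (fun l => stateTensor X φ (ξ l ⊗ₜ b))
  simp only [thetaHom_apply, hZX] at h3
  rw [h3, sum_inner_stateTensor πX φ a f x hx] at hfin
  simp only [actionMap_tmul] at hfin
  linarith

/-- The coefficients `⟨ηₗ, π(aᵢ) ηₖ⟩`. -/
def coefficients (πY : A →⋆ₐ[ℂ] AdjEnd Bᵐᵒᵖ Y) (a : ι → A) (η : m → Y) : ι × m × m → B :=
  fun j => rinner B (η j.2.1) ((πY (a j.1)).val (η j.2.2))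

theorem coefficients_smul (πY : A →⋆ₐ[ℂ] AdjEnd Bᵐᵒᵖ Y) (a : ι → A) (η : m → Y) (t : ℝ)
    (ht : 0 ≤ t) :
    coefficients πY a (fun l => ((√t : ℝ) : ℂ) • η l) = t • coefficients πY a η := by
  funext j
  simp only [coefficients, map_smul, rinner_smul_left, rinner_smul_right, Pi.smul_apply, smul_smul]
  rw [Complex.star_def, Complex.conj_ofReal, ← Complex.ofReal_mul, Real.mul_self_sqrt ht,
    Complex.coe_smul]

/-- Coefficients are quadratic in $\eta$, so a scalar $t\ge0$ is absorbed into $\sqrt t\,\eta$: the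
cone consists of sums without weights. -/
theorem exists_coefficients_of_mem_span (πY : A →⋆ₐ[ℂ] AdjEnd Bᵐᵒᵖ Y) (a : ι → A)
    (e : ι × m × m → B)
    (he : e ∈ Submodule.span {r : ℝ // 0 ≤ r} (Set.range (coefficients (m := m) πY a))) :
    ∃ (n : ℕ) (η : Fin n → m → Y), e = ∑ j, coefficients πY a (η j) := by
  induction he using Submodule.span_induction with
  | mem e he =>
    obtain ⟨η, rfl⟩ := he
    exact ⟨1, fun _ => η, by simp⟩
  | zero => exact ⟨0, fun _ _ => 0, by simp⟩
  | add e e' _ _ he he' =>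
    obtain ⟨n, η, rfl⟩ := he
    obtain ⟨n', η', rfl⟩ := he'
    exact ⟨n + n', Fin.append η η', by simp [Fin.sum_univ_add]⟩
  | smul t e _ he =>
    obtain ⟨n, η, rfl⟩ := he
    refine ⟨n, fun j l => ((√t.1 : ℝ) : ℂ) • η j l, ?_⟩
    simp only [coefficients_smul πY a _ t.1 t.2, ← Finset.smul_sum]
    rfl

/-- A real functional separating a point from the closed cone is the real part of a complex one. Its
components on the finite product are bounded functionals on $B$, to which
`WeaklyContainedUniv.coefficient_nonneg` applies. -/
theorem WeaklyContainedUniv.coefficients_mem_closure {πX : A →⋆ₐ[ℂ] AdjEnd Bᵐᵒᵖ X}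
    {πY : A →⋆ₐ[ℂ] AdjEnd Bᵐᵒᵖ Y} (hXY : WeaklyContainedUniv πX πY) (a : ι → A) (ξ : m → X) :
    coefficients πX a ξ ∈
      (Submodule.span {r : ℝ // 0 ≤ r} (Set.range (coefficients (m := m) πY a))).closure := by
  classical
  by_contra hnot
  obtain ⟨f, hf, hf0⟩ := ProperCone.hyperplane_separation_point
    ((Submodule.span {r : ℝ // 0 ≤ r} (Set.range (coefficients (m := m) πY a))).closure :
      ProperCone ℝ (ι × m × m → B)) hnot
  let g : StrongDual ℂ (ι × m × m → B) := f.extendRCLike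
  let gj : ι → m → m → B →L[ℂ] ℂ := fun i l k =>
    g ∘L ContinuousLinearMap.single ℂ (fun _ => B) (i, l, k)
  have hg : ∀ e : ι × m × m → B, f e = (∑ l, ∑ k, ∑ i, gj i l k (e (i, l, k))).re := fun e => by
    have h1 : (g e).re = f e := StrongDual.re_extendRCLike_apply (𝕜 := ℂ) f e
    rw [← h1]
    congr 1
    conv_lhs => rw [← Finset.univ_sum_single e, map_sum]
    simp only [Fintype.sum_prod_type]
    rw [Finset.sum_comm]
    exact Finset.sum_congr rfl fun l _ => Finset.sum_comm
  have h2 := hXY.coefficient_nonneg a gj (fun η => by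
    have h3 := hf (coefficients πY a η)
      (Submodule.mem_closure_iff.2 (Submodule.le_topologicalClosure _
        (Submodule.subset_span ⟨η, rfl⟩)))
    rw [hg] at h3
    exact h3) ξ
  rw [hg] at hf0
  exact hf0.not_ge h2

theorem WeaklyContainedUniv.coefficientApprox {πX : A →⋆ₐ[ℂ] AdjEnd Bᵐᵒᵖ X}
    {πY : A →⋆ₐ[ℂ] AdjEnd Bᵐᵒᵖ Y} (hXY : WeaklyContainedUniv πX πY) :
    CoefficientApprox πX πY := by
  intro m ξ S ε hε
  have h := hXY.coefficients_mem_closure (fun a : S => (a : A)) ξ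
  rw [Submodule.mem_closure_iff] at h
  obtain ⟨e, he, hdist⟩ := Metric.mem_closure_iff.1 h ε hε
  obtain ⟨n, η, rfl⟩ := exists_coefficients_of_mem_span πY _ e he
  refine ⟨n, η, fun a ha l k => ?_⟩
  rw [dist_eq_norm] at hdist
  refine lt_of_le_of_lt ?_ hdist
  have h1 := norm_le_pi_norm (coefficients πX (fun a : S => (a : A)) ξ -
    ∑ j, coefficients πY (fun a : S => (a : A)) (η j)) (⟨a, ha⟩, l, k)
  refine le_of_eq_of_le ?_ h1
  rw [← MulOpposite.norm_unop]
  congr 1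
  simp [coefficients, rinner]

end CPApprox

/-! ## Adjointable and compact maps between Hilbert modules -/

section CompactMaps

variable {D E F G : Type*} [NonUnitalCStarAlgebra D] [PartialOrder D] [StarOrderedRing D]
  [NormedAddCommGroup E] [NormedSpace ℂ E] [SMul D E] [CStarModule D E]
  [NormedAddCommGroup F] [NormedSpace ℂ F] [SMul D F] [CStarModule D F]
  [NormedAddCommGroup G] [NormedSpace ℂ G] [SMul D G] [CStarModule D G]

theorem IsAdjoint.comp {T : F →L[ℂ] G} {T' : G →L[ℂ] F} {S : E →L[ℂ] F} {S' : F →L[ℂ] E}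
    (hT : IsAdjoint D T T') (hS : IsAdjoint D S S') : IsAdjoint D (T ∘L S) (S' ∘L T') :=
  fun x y => by rw [ContinuousLinearMap.comp_apply, hT, hS, ContinuousLinearMap.comp_apply]

theorem IsAdjoint.add {T S : E →L[ℂ] F} {T' S' : F →L[ℂ] E} (hT : IsAdjoint D T T')
    (hS : IsAdjoint D S S') : IsAdjoint D (T + S) (T' + S') := fun x y => by
  simp [hT x y, hS x y]

theorem IsAdjoint.sub {T S : E →L[ℂ] F} {T' S' : F →L[ℂ] E} (hT : IsAdjoint D T T')
    (hS : IsAdjoint D S S') : IsAdjoint D (T - S) (T' - S') := fun x y => by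
  simp [hT x y, hS x y]

theorem IsAdjoint.id : IsAdjoint D (ContinuousLinearMap.id ℂ E) (ContinuousLinearMap.id ℂ E) :=
  fun _ _ => rfl

theorem IsAdjoint.sum {ι : Type*} (s : Finset ι) {T : ι → E →L[ℂ] F} {T' : ι → F →L[ℂ] E}
    (h : ∀ i ∈ s, IsAdjoint D (T i) (T' i)) : IsAdjoint D (∑ i ∈ s, T i) (∑ i ∈ s, T' i) := by
  intro x y
  rw [sum_apply, sum_apply, CStarModule.inner_sum_left, CStarModule.inner_sum_right]
  exact Finset.sum_congr rfl fun i hi => h i hi x y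

theorem IsAdjoint.norm_sq_le {T : E →L[ℂ] F} {S : F →L[ℂ] E} (h : IsAdjoint D T S) :
    ‖T‖ ^ 2 ≤ ‖S ∘L T‖ := by
  have h1 : ∀ x, ‖T x‖ ≤ √‖S ∘L T‖ * ‖x‖ := fun x => by
    refine abs_le_of_sq_le_sq' ?_ (by positivity) |>.2
    rw [mul_pow, Real.sq_sqrt (norm_nonneg _), CStarModule.norm_sq_eq D, h]
    calc _ ≤ ‖x‖ * ‖(S ∘L T) x‖ := CStarModule.norm_inner_le E
      _ ≤ ‖x‖ * (‖S ∘L T‖ * ‖x‖) := by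
        gcongr
        exact (S ∘L T).le_opNorm x
      _ = _ := by ring
  have h2 : ‖T‖ ≤ √‖S ∘L T‖ := T.opNorm_le_bound (by positivity) h1
  calc ‖T‖ ^ 2 ≤ √‖S ∘L T‖ ^ 2 := by gcongr
    _ = _ := Real.sq_sqrt (norm_nonneg _)

theorem IsAdjoint.norm_le {T : E →L[ℂ] F} {S : F →L[ℂ] E} (h : IsAdjoint D T S) : ‖T‖ ≤ ‖S‖ := by
  have h1 := h.norm_sq_le.trans (S.opNorm_comp_le T)
  rcases (norm_nonneg T).eq_or_lt with h0 | h0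
  · rw [← h0]
    exact norm_nonneg S
  · nlinarith

theorem IsAdjoint.norm_eq {T : E →L[ℂ] F} {S : F →L[ℂ] E} (h : IsAdjoint D T S) : ‖S‖ = ‖T‖ :=
  le_antisymm h.symm.norm_le h.norm_le

variable (D) in
/-- The rank one operator `ζ ↦ ξ ⟨η, ζ⟩` between two Hilbert modules. -/
def rankOneMap (ξ : F) (η : E) : E →L[ℂ] F :=
  LinearMap.mkContinuous
    { toFun := fun ζ => (inner D η ζ : D) • ξ
      map_add' := fun x y => by simp [add_smul']
      map_smul' := fun c x => by simp [smul_smul_comm] }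
    (‖η‖ * ‖ξ‖) fun ζ => by
      calc _ ≤ ‖inner D η ζ‖ * ‖ξ‖ := norm_smul_le' _ _
        _ ≤ (‖η‖ * ‖ζ‖) * ‖ξ‖ := by gcongr; exact CStarModule.norm_inner_le E
        _ = _ := by ring

@[simp] theorem rankOneMap_apply (ξ : F) (η ζ : E) :
    rankOneMap D ξ η ζ = (inner D η ζ : D) • ξ := rfl

theorem isAdjoint_rankOneMap (ξ : F) (η : E) :
    IsAdjoint D (rankOneMap D ξ η) (rankOneMap D η ξ) := fun x y => by simp

theorem val_rankOne (ξ η : E) : (rankOne D ξ η).val = rankOneMap D ξ η := rfl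

theorem star_rankOne (ξ η : E) : star (rankOne D ξ η) = rankOne D η ξ :=
  AdjEnd.star_eq (isAdjoint_rankOneMap ξ η)

theorem comp_rankOneMap {S : F →L[ℂ] G} {S' : G →L[ℂ] F} (hS : IsAdjoint D S S') (ξ : F) (η : E) :
    S ∘L rankOneMap D ξ η = rankOneMap D (S ξ) η :=
  ContinuousLinearMap.ext fun _ => hS.map_smul _ _

theorem rankOneMap_comp {S : E →L[ℂ] F} {S' : F →L[ℂ] E} (hS : IsAdjoint D S S') (ξ : G) (η : F) :
    rankOneMap D ξ η ∘L S = rankOneMap D ξ (S' η) :=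
  ContinuousLinearMap.ext fun _ => by
    rw [ContinuousLinearMap.comp_apply, rankOneMap_apply, rankOneMap_apply, hS.symm]

/-- Evaluate at $x$: with $d=\langle x,x\rangle$ one has $\|dx\|^2=\|d^3\|$, and
$\|d^3\|\ge\|d\|^3=\|x\|^6$. This converts operator estimates on $\theta_{x,x}$ into estimates on
vectors. -/
theorem norm_sq_le_norm_rankOneMap (x : E) : ‖x‖ ^ 2 ≤ ‖rankOneMap D x x‖ := by
  rcases eq_or_ne x 0 with rfl | hx
  · simp
  have hpos : 0 < ‖x‖ := norm_pos_iff.2 hx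
  have h1 : ‖x‖ ^ 3 ≤ ‖(inner D x x : D) • x‖ := by
    have hsa : IsSelfAdjoint (inner D x x : D) := CStarModule.star_inner x x
    refine abs_le_of_sq_le_sq' ?_ (norm_nonneg _) |>.2
    rw [CStarModule.norm_sq_eq D (x := (inner D x x : D) • x), CStarModule.inner_op_smul_right,
      CStarModule.inner_op_smul_left, hsa.star_eq]
    have hx2 := CStarModule.norm_sq_eq D (x := x)
    generalize (inner D x x : D) = d at hsa hx2 ⊢
    have h5 : ‖d‖ ^ 4 ≤ ‖d‖ * ‖d * (d * d)‖ := by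
      have h6 : ‖d * (d * (d * d))‖ = ‖d‖ ^ 4 := by
        have hsa2 : IsSelfAdjoint (d * d) := by
          rw [IsSelfAdjoint, star_mul, hsa.star_eq]
        rw [← mul_assoc, hsa2.norm_mul_self, hsa.norm_mul_self]
        ring
      rw [← h6]
      exact norm_mul_le _ _
    have h7 : 0 < ‖d‖ := by rw [← hx2]; positivity
    have h8 : (‖x‖ ^ 3) ^ 2 = ‖d‖ ^ 3 := by rw [← hx2]; ring
    rw [h8]
    nlinarith
  have h3 := (rankOneMap D x x).le_opNorm x
  rw [rankOneMap_apply] at h3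
  have h9 := h1.trans h3
  rw [pow_succ] at h9
  exact le_of_mul_le_mul_right h9 hpos

variable (D E F) in
/-- The compact maps `𝓚(E, F)`: the closed linear span of the rank one operators. -/
def CompactMaps : Submodule ℂ (E →L[ℂ] F) :=
  (Submodule.span ℂ {T | ∃ (ξ : F) (η : E), T = rankOneMap D ξ η}).topologicalClosure

theorem isClosed_compactMaps : IsClosed (CompactMaps D E F : Set (E →L[ℂ] F)) :=
  Submodule.isClosed_topologicalClosure _

theorem rankOneMap_mem (ξ : F) (η : E) : rankOneMap D ξ η ∈ CompactMaps D E F :=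
  Submodule.le_topologicalClosure _ (Submodule.subset_span ⟨ξ, η, rfl⟩)

theorem comp_mem_compactMaps {S : F →L[ℂ] G} {S' : G →L[ℂ] F} (hS : IsAdjoint D S S')
    {T : E →L[ℂ] F} (hT : T ∈ CompactMaps D E F) : S ∘L T ∈ CompactMaps D E G := by
  let L := ContinuousLinearMap.compL ℂ E F G S
  have h : CompactMaps D E F ≤ (CompactMaps D E G).comap (L : (E →L[ℂ] F) →ₗ[ℂ] (E →L[ℂ] G)) := by
    refine Submodule.topologicalClosure_minimal _ (Submodule.span_le.2 ?_)
      (isClosed_compactMaps.preimage L.continuous)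
    rintro _ ⟨ξ, η, rfl⟩
    change S ∘L rankOneMap D ξ η ∈ CompactMaps D E G
    rw [comp_rankOneMap hS]
    exact rankOneMap_mem _ _
  exact h hT

theorem mem_compactMaps_comp {S : E →L[ℂ] F} {S' : F →L[ℂ] E} (hS : IsAdjoint D S S')
    {T : F →L[ℂ] G} (hT : T ∈ CompactMaps D F G) : T ∘L S ∈ CompactMaps D E G := by
  let L := (ContinuousLinearMap.compL ℂ E F G).flip S
  have h : CompactMaps D F G ≤ (CompactMaps D E G).comap (L : (F →L[ℂ] G) →ₗ[ℂ] (E →L[ℂ] G)) := by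
    refine Submodule.topologicalClosure_minimal _ (Submodule.span_le.2 ?_)
      (isClosed_compactMaps.preimage L.continuous)
    rintro _ ⟨ξ, η, rfl⟩
    change rankOneMap D ξ η ∘L S ∈ CompactMaps D E G
    rw [rankOneMap_comp hS]
    exact rankOneMap_mem _ _
  exact h hT

/-- The inclusion of $\mathcal L(E)$ into the bounded operators is isometric, so a closure in
$\mathcal L(E)$ is the preimage of the closure of the image. -/
theorem mem_compacts_iff {T : AdjEnd D E} : T ∈ Compacts D E ↔ T.val ∈ CompactMaps D E E := by
  have h : (AdjEnd.val (D := D) (E := E)) ''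
      (Submodule.span ℂ {T | ∃ ξ η : E, T = rankOne D ξ η} : Set (AdjEnd D E))
      = (Submodule.span ℂ {T | ∃ (ξ : E) (η : E), T = rankOneMap D ξ η} : Set (E →L[ℂ] E)) := by
    have h1 := Submodule.map_span (AdjEnd.val (D := D) (E := E)).toLinearMap
      {T | ∃ ξ η : E, T = rankOne D ξ η}
    have h2 := congrArg (fun s : Submodule ℂ (E →L[ℂ] E) => (s : Set (E →L[ℂ] E))) h1
    refine h2.trans ?_
    congr 2
    ext T
    constructor
    · rintro ⟨_, ⟨ξ, η, rfl⟩, rfl⟩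
      exact ⟨ξ, η, rfl⟩
    · rintro ⟨ξ, η, rfl⟩
      exact ⟨_, ⟨ξ, η, rfl⟩, rfl⟩
  have h3 := AdjEnd.isometry_val (D := D) (E := E) |>.isEmbedding.isInducing.closure_eq_preimage_closure_image
    (Submodule.span ℂ {T | ∃ ξ η : E, T = rankOne D ξ η} : Set (AdjEnd D E))
  rw [h] at h3
  exact Set.ext_iff.1 h3 T

theorem isClosed_compacts : IsClosed (Compacts D E : Set (AdjEnd D E)) :=
  Submodule.isClosed_topologicalClosure _

theorem rankOne_mem (ξ η : E) : rankOne D ξ η ∈ Compacts D E :=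
  Submodule.le_topologicalClosure _ (Submodule.subset_span ⟨ξ, η, rfl⟩)

theorem mul_mem_compacts (S : AdjEnd D E) {T : AdjEnd D E} (hT : T ∈ Compacts D E) :
    S * T ∈ Compacts D E := by
  rw [mem_compacts_iff] at hT ⊢
  rw [map_mul]
  exact comp_mem_compactMaps S.isAdjoint hT

theorem mem_compacts_mul {T : AdjEnd D E} (hT : T ∈ Compacts D E) (S : AdjEnd D E) :
    T * S ∈ Compacts D E := by
  rw [mem_compacts_iff] at hT ⊢
  rw [map_mul]
  exact mem_compactMaps_comp S.isAdjoint hT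

theorem star_mem_compacts {T : AdjEnd D E} (hT : T ∈ Compacts D E) : star T ∈ Compacts D E := by
  refine map_mem_closure (f := star) continuous_star hT fun T hT => ?_
  change T ∈ Submodule.span ℂ _ at hT
  change star T ∈ Submodule.span ℂ _
  induction hT using Submodule.span_induction with
  | mem T hT =>
    obtain ⟨ξ, η, rfl⟩ := hT
    rw [star_rankOne]
    exact Submodule.subset_span ⟨η, ξ, rfl⟩
  | zero => simp
  | add T S _ _ hT hS => rw [star_add]; exact add_mem hT hS
  | smul c T _ hT => rw [star_smul]; exact Submodule.smul_mem _ _ hT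

theorem exists_sum_rankOne_of_mem_compacts {T : AdjEnd D E} (hT : T ∈ Compacts D E) {ε : ℝ}
    (hε : 0 < ε) : ∃ (m : ℕ) (ξ ζ : Fin m → E), ‖T - ∑ l, rankOne D (ξ l) (ζ l)‖ < ε := by
  have hspan : ∀ S ∈ Submodule.span ℂ {T | ∃ ξ η : E, T = rankOne D ξ η},
      ∃ (m : ℕ) (ξ ζ : Fin m → E), S = ∑ l, rankOne D (ξ l) (ζ l) := by
    intro S hS
    induction hS using Submodule.span_induction with
    | mem S hS =>
      obtain ⟨ξ, η, rfl⟩ := hS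
      exact ⟨1, fun _ => ξ, fun _ => η, by simp⟩
    | zero => exact ⟨0, fun _ => 0, fun _ => 0, by simp⟩
    | add S S' _ _ hS hS' =>
      obtain ⟨m, ξ, ζ, rfl⟩ := hS
      obtain ⟨m', ξ', ζ', rfl⟩ := hS'
      exact ⟨m + m', Fin.append ξ ξ', Fin.append ζ ζ', by simp [Fin.sum_univ_add]⟩
    | smul c S _ hS =>
      obtain ⟨m, ξ, ζ, rfl⟩ := hS
      refine ⟨m, fun l => c • ξ l, ζ, ?_⟩
      rw [Finset.smul_sum]
      refine Finset.sum_congr rfl fun l _ => AdjEnd.val_injective ?_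
      rw [map_smul, val_rankOne, val_rankOne]
      exact ContinuousLinearMap.ext fun x => (smul_smul_comm' c _ _).symm
  obtain ⟨S, hS, hST⟩ := Metric.mem_closure_iff.1 hT ε hε
  obtain ⟨m, ξ, ζ, rfl⟩ := hspan S hS
  exact ⟨m, ξ, ζ, by rwa [← dist_eq_norm]⟩

variable (D E) in
/-- The compact operators as a closed star subalgebra of `𝓛(E)`. -/
def compactsSubalgebra : NonUnitalStarSubalgebra ℂ (AdjEnd D E) where
  carrier := Compacts D E
  add_mem' := add_mem
  zero_mem' := zero_mem _
  mul_mem' _ hT := mul_mem_compacts _ hT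
  smul_mem' c _ hT := Submodule.smul_mem _ c hT
  star_mem' := star_mem_compacts

instance : IsClosed (compactsSubalgebra D E : Set (AdjEnd D E)) := isClosed_compacts

variable (D E) in
/-- The compact operators have an approximate unit. -/
theorem exists_approximateUnit_compacts [CompleteSpace E] :
    ∃ l : Filter (AdjEnd D E), l.NeBot ∧
      (∀ᶠ e in l, e ∈ Compacts D E ∧ star e = e ∧ ‖e‖ ≤ 1) ∧
      ∀ k ∈ Compacts D E, Tendsto (fun e => k * e) l (𝓝 k) := by
  let _ := CStarAlgebra.spectralOrder (compactsSubalgebra D E)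
  have := CStarAlgebra.spectralOrderedRing (compactsSubalgebra D E)
  have hu := CStarAlgebra.increasingApproximateUnit (compactsSubalgebra D E)
  have hne := hu.neBot
  refine ⟨(CStarAlgebra.approximateUnit (compactsSubalgebra D E)).map
    (fun e : compactsSubalgebra D E => (e : AdjEnd D E)),
    inferInstance, ?_, fun k hk => ?_⟩
  · rw [eventually_map]
    filter_upwards [hu.eventually_norm, hu.eventually_star_eq] with e he hs
    exact ⟨e.2, congrArg (fun e : compactsSubalgebra D E => (e : AdjEnd D E)) hs, he⟩
  · rw [tendsto_map'_iff]
    exact (continuous_subtype_val.tendsto _).comp (hu.tendsto_mul_left ⟨k, hk⟩)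

/-- If `T⋆T` is compact then so is `T`. -/
theorem IsAdjoint.mem_compactMaps [CompleteSpace E] {T : E →L[ℂ] F} {T' : F →L[ℂ] E}
    (h : IsAdjoint D T T') (hK : T' ∘L T ∈ CompactMaps D E E) : T ∈ CompactMaps D E F := by
  obtain ⟨l, hl, hev, ht⟩ := exists_approximateUnit_compacts D E
  let k : AdjEnd D E := .mk (T' ∘L T) (T' ∘L T) (h.symm.comp h)
  have hk : k ∈ Compacts D E := mem_compacts_iff.2 hK
  have h1 : Tendsto (fun e : AdjEnd D E => ‖k - k * e‖ * 2) l (𝓝 0) := by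
    simpa using ((ht k hk).const_sub k).norm.mul_const 2
  -- With $k=T^*T$ one has $(Te-T)^*(Te-T)=(1-e)(k-ke)$ up to sign, and $\|1-e\|\le2$.
  have h2 : Tendsto (fun e : AdjEnd D E => ‖T ∘L e.val - T‖ ^ 2) l (𝓝 0) := by
    refine squeeze_zero' (Eventually.of_forall fun _ => by positivity) ?_ h1
    filter_upwards [hev] with e ⟨_, he, he1⟩
    have hadj : IsAdjoint D (T ∘L e.val - T) (e.val ∘L T' - T') := by
      have h3 := e.isAdjoint
      rw [he] at h3
      exact (h.comp h3).sub h
    have h4 : (e.val ∘L T' - T') ∘L (T ∘L e.val - T) = ((1 - e) * (k - k * e)).val := by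
      ext x
      simp [k]
      abel
    refine hadj.norm_sq_le.trans ?_
    rw [h4, AdjEnd.norm_val]
    calc _ ≤ ‖1 - e‖ * ‖k - k * e‖ := norm_mul_le _ _
      _ ≤ 2 * ‖k - k * e‖ := by
        gcongr
        calc _ ≤ ‖(1 : AdjEnd D E)‖ + ‖e‖ := norm_sub_le _ _
          _ ≤ 1 + 1 := by
            gcongr
            exact ContinuousLinearMap.norm_id_le
          _ = 2 := by norm_num
      _ = _ := mul_comm _ _
  have h5 : Tendsto (fun e : AdjEnd D E => T ∘L e.val) l (𝓝 T) := by
    rw [tendsto_iff_norm_sub_tendsto_zero]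
    simpa using h2.sqrt
  refine isClosed_compactMaps.mem_of_tendsto h5 ?_
  filter_upwards [hev] with e ⟨he, _⟩
  exact comp_mem_compactMaps h (mem_compacts_iff.1 he)

end CompactMaps

/-! ## Quasicentral elements of ideals -/

section Quasicentral

variable {M : Type*} [CStarAlgebra M]

theorem norm_one_le_one : ‖(1 : M)‖ ≤ 1 := by
  have h := CStarRing.norm_star_mul_self (x := (1 : M))
  rw [star_one, mul_one] at h
  nlinarith [norm_nonneg (1 : M)]

/-- Expanding $(\sum v_i)^*(\sum v_j)$ leaves $N$ diagonal terms of size $C^2$ and at most $N^2$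
terms of size $\delta$. The average of the $v_j$ thus has squared norm at most $C^2/N+\delta$. -/
theorem norm_sum_sq_le_of_almost_orthogonal {v : ℕ → M} {C δ : ℝ} (hC : ∀ j, ‖v j‖ ≤ C)
    (hδ : ∀ i j, i < j → ‖star (v i) * v j‖ ≤ δ) (N : ℕ) :
    ‖∑ j ∈ Finset.range N, v j‖ ^ 2 ≤ N * C ^ 2 + N ^ 2 * δ := by
  have hC0 : 0 ≤ C := (norm_nonneg _).trans (hC 0)
  have hδ0 : 0 ≤ δ := (norm_nonneg _).trans (hδ 0 1 one_pos)
  have hij : ∀ i j, ‖star (v i) * v j‖ ≤ (if i = j then C ^ 2 else 0) + δ := fun i j => by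
    rcases lt_trichotomy i j with h | h | h
    · rw [if_neg h.ne, zero_add]
      exact hδ i j h
    · rw [if_pos h, h, CStarRing.norm_star_mul_self]
      nlinarith [hC j, norm_nonneg (v j)]
    · rw [if_neg h.ne', zero_add, ← norm_star, star_mul, star_star]
      exact hδ j i h
  rw [sq, ← CStarRing.norm_star_mul_self, star_sum, Finset.sum_mul]
  simp only [Finset.mul_sum]
  calc _ ≤ ∑ i ∈ Finset.range N, ∑ j ∈ Finset.range N, ‖star (v i) * v j‖ :=
        (norm_sum_le _ _).trans (Finset.sum_le_sum fun i _ => norm_sum_le _ _)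
    _ ≤ ∑ i ∈ Finset.range N, ∑ j ∈ Finset.range N, ((if i = j then C ^ 2 else 0) + δ) :=
        Finset.sum_le_sum fun i _ => Finset.sum_le_sum fun j _ => hij i j
    _ ≤ ∑ i ∈ Finset.range N, (C ^ 2 + N * δ) := by
      refine Finset.sum_le_sum fun i hi => ?_
      rw [Finset.sum_add_distrib, Finset.sum_ite_eq, if_pos hi]
      simp
    _ = _ := by
      simp only [Finset.sum_const, Finset.card_range, nsmul_eq_mul]
      ring

/-- Elements of an approximate unit are picked one after the other so that their commutators with
each $a\in S$ become almost orthogonal; averaging then makes the commutators small. The remaining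
conditions are convex and survive averaging. -/
theorem exists_quasicentral (I : Submodule ℂ M) (hmul : ∀ m, ∀ k ∈ I, m * k ∈ I)
    (hmul' : ∀ m, ∀ k ∈ I, k * m ∈ I) (hstar : ∀ k ∈ I, star k ∈ I) (l : Filter M) [l.NeBot]
    (hl : ∀ᶠ e in l, e ∈ I ∧ star e = e ∧ ‖e‖ ≤ 1)
    (hlt : ∀ k ∈ I, Tendsto (fun e => k * e) l (𝓝 k)) (S : Finset M) (T : Finset M)
    (hT : ∀ k ∈ T, k ∈ I) {ε : ℝ} (hε : 0 < ε) :
    ∃ t ∈ I, star t = t ∧ ‖t‖ ≤ 1 ∧ (∀ k ∈ T, ‖k - k * t‖ ≤ ε) ∧ ∀ a ∈ S, ‖t * a - a * t‖ ≤ ε := by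
  obtain ⟨f, hf, hr⟩ := exists_seq_of_forall_finset_exists
    (fun e : M => (e ∈ I ∧ star e = e ∧ ‖e‖ ≤ 1) ∧ ∀ k ∈ T, ‖k - k * e‖ ≤ ε)
    (fun x y => ∀ a ∈ S, ‖star (x * a - a * x) * (y * a - a * y)‖ ≤ ε ^ 2 / 2) (by
      intro s hs
      have h1 : ∀ᶠ e in l, ∀ k ∈ T, ‖k - k * e‖ ≤ ε := by
        refine (Filter.eventually_all_finset T).2 fun k hk => ?_
        have h2 : Tendsto (fun e => ‖k - k * e‖) l (𝓝 0) := by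
          simpa using ((hlt k (hT k hk)).const_sub k).norm
        exact (h2.eventually (gt_mem_nhds hε)).mono fun e he => he.le
      have h3 : ∀ᶠ e in l, ∀ x ∈ s, ∀ a ∈ S,
          ‖star (x * a - a * x) * (e * a - a * e)‖ ≤ ε ^ 2 / 2 := by
        refine (Filter.eventually_all_finset s).2 fun x hx =>
          (Filter.eventually_all_finset S).2 fun a _ => ?_
        have hk : star (x * a - a * x) ∈ I :=
          hstar _ (sub_mem (hmul' _ _ (hs x hx).1.1) (hmul _ _ (hs x hx).1.1))
        generalize star (x * a - a * x) = k at hk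
        -- Both $k$, the adjoint of an earlier commutator, and $ka$ lie in $I$; so $kea$ and $kae$
        -- have the same limit $ka$.
        have h4 : Tendsto (fun e => ‖k * e * a - k * a * e‖) l (𝓝 0) := by
          simpa using (((hlt k hk).mul_const a).sub (hlt (k * a) (hmul' _ _ hk))).norm
        refine (h4.eventually (gt_mem_nhds (show (0 : ℝ) < ε ^ 2 / 2 by positivity))).mono
          fun e he => le_of_eq_of_le ?_ he.le
        rw [mul_sub, mul_assoc, mul_assoc]
      obtain ⟨e, h5, h6, h7⟩ := (hl.and (h1.and h3)).exists
      exact ⟨e, ⟨h5, h6⟩, h7⟩)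
  let C : ℝ := ∑ a ∈ S, 2 * ‖a‖
  -- The constant $C$ bounds all commutators, so the averaged commutator has squared norm at most
  -- $C^2/N+\varepsilon^2/2\le\varepsilon^2$.
  obtain ⟨N, hN⟩ := exists_nat_gt (C ^ 2 / (ε ^ 2 / 2))
  have hN0 : (0 : ℝ) < N := lt_of_le_of_lt (by positivity) hN
  have hN1 : C ^ 2 ≤ N * (ε ^ 2 / 2) := by
    rw [div_lt_iff₀ (by positivity)] at hN
    exact hN.le
  have havg : ∀ (v : ℕ → M) (K : ℝ), (∀ j, ‖v j‖ ≤ K) →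
      ‖((N : ℂ)⁻¹) • ∑ j ∈ Finset.range N, v j‖ ≤ K := fun v K hv => by
    rw [norm_smul, norm_inv, Complex.norm_natCast, inv_mul_le_iff₀ hN0]
    refine (norm_sum_le _ _).trans ((Finset.sum_le_sum fun j _ => hv j).trans ?_)
    simp
  have hlin : ∀ k : M, ((N : ℂ)⁻¹) • ∑ j ∈ Finset.range N, k = k := fun k => by
    rw [Finset.sum_const, Finset.card_range, ← Nat.cast_smul_eq_nsmul ℂ, smul_smul,
      inv_mul_cancel₀ (by exact_mod_cast hN0.ne'), one_smul]
  refine ⟨((N : ℂ)⁻¹) • ∑ j ∈ Finset.range N, f j, I.smul_mem _ (sum_mem fun j _ => (hf j).1.1),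
    ?_, havg f 1 fun j => (hf j).1.2.2, fun k hk => ?_, fun a ha => ?_⟩
  · rw [star_smul, star_sum, Complex.star_def, map_inv₀, Complex.conj_natCast]
    simp only [(hf _).1.2.1]
  · have h8 := havg (fun j => k - k * f j) ε fun j => (hf j).2 k hk
    rwa [Finset.sum_sub_distrib, smul_sub, hlin, ← Finset.mul_sum, ← mul_smul_comm] at h8
  · have h9 := norm_sum_sq_le_of_almost_orthogonal (v := fun j => f j * a - a * f j) (C := C)
      (δ := ε ^ 2 / 2) (fun j => by
        calc _ ≤ ‖f j * a‖ + ‖a * f j‖ := norm_sub_le _ _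
          _ ≤ ‖f j‖ * ‖a‖ + ‖a‖ * ‖f j‖ := add_le_add (norm_mul_le _ _) (norm_mul_le _ _)
          _ ≤ 2 * ‖a‖ := by nlinarith [(hf j).1.2.2, norm_nonneg a]
          _ ≤ C := Finset.single_le_sum (f := fun a => 2 * ‖a‖) (fun a _ => by positivity) ha)
      (fun i j hij => hr i j hij a ha) N
    have h10 : ((N : ℂ)⁻¹ • ∑ j ∈ Finset.range N, f j) * a - a * ((N : ℂ)⁻¹ • ∑ j ∈ Finset.range N, f j)
        = (N : ℂ)⁻¹ • ∑ j ∈ Finset.range N, (f j * a - a * f j) := by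
      rw [Finset.sum_sub_distrib, smul_sub, ← Finset.sum_mul, ← Finset.mul_sum, smul_mul_assoc,
        mul_smul_comm]
    rw [h10, norm_smul, norm_inv, Complex.norm_natCast, inv_mul_le_iff₀ hN0]
    refine abs_le_of_sq_le_sq' (h9.trans ?_) (by positivity) |>.2
    nlinarith

theorem norm_le_one_of_star_mul_self_add {x y : M} (h : star x * x + star y * y = 1) : ‖x‖ ≤ 1 := by
  let _ := CStarAlgebra.spectralOrder M
  have := CStarAlgebra.spectralOrderedRing M
  have h1 : star x * x ≤ 1 := by
    rw [← h]
    exact le_add_of_nonneg_right (star_mul_self_nonneg y)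
  have h2 := CStarAlgebra.norm_le_norm_of_nonneg_of_le (star_mul_self_nonneg x) h1
  rw [CStarRing.norm_star_mul_self] at h2
  nlinarith [norm_nonneg x, norm_one_le_one (M := M)]

/-- A self-adjoint contraction `t` gives rise to a rotation `(c, s)` with `c² + s² = 1`, which almost
commutes with whatever `t` almost commutes with. -/
theorem exists_rotation (I : Submodule ℂ M) (hmul' : ∀ m, ∀ k ∈ I, k * m ∈ I) {t : M} (htI : t ∈ I)
    (ht : star t = t) (ht1 : ‖t‖ ≤ 1) :
    ∃ c s h : M, star c = c ∧ star s = s ∧ c * c + s * s = 1 ∧ c ∈ I ∧ s - 1 ∈ I ∧ ‖h‖ ≤ 2 ∧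
      s = h * (1 - t) ∧ ‖s‖ ≤ 1 ∧ ‖c‖ ≤ 1 ∧
      ∀ a, ‖c * a * c + s * a * s - a‖ ≤ 10 * ‖t * a - a * t‖ := by
  have hsa : IsSelfAdjoint t := ht
  -- Rational parametrization of the circle: $c=2t/(1+t^2)$ and $s=2g-1=(1-t^2)/(1+t^2)$ with
  -- $g=(1+t^2)^{-1}$. Being rational in $t$, they have commutators that are controlled by algebra
  -- alone.
  let φ : ℝ → ℝ := fun x => (1 + x ^ 2)⁻¹
  have hφ : Continuous φ := by
    refine Continuous.inv₀ (by fun_prop) fun x => by positivity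
  let g : M := cfc φ t
  have hg : star g = g := cfc_predicate φ t
  have hgn : ‖g‖ ≤ 1 := norm_cfc_le zero_le_one fun x _ => by
    rw [Real.norm_of_nonneg (by positivity)]
    exact inv_le_one_of_one_le₀ (by nlinarith [sq_nonneg x])
  have hcomm : Commute t g := by
    have h1 := cfc_commute_cfc (id : ℝ → ℝ) φ t
    rwa [cfc_id ℝ t] at h1
  have hgt : g * (1 + t * t) = 1 := by
    have h1 : cfc (fun x : ℝ => 1 + x ^ 2) t = 1 + t * t := by
      rw [cfc_add t (fun _ : ℝ => (1 : ℝ)) (fun x => x ^ 2), cfc_const_one ℝ t, cfc_pow_id t 2, sq]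
    rw [← h1, ← cfc_mul φ (fun x : ℝ => 1 + x ^ 2) t hφ.continuousOn (by fun_prop)]
    conv_rhs => rw [← cfc_const_one ℝ t]
    exact cfc_congr fun x _ => inv_mul_cancel₀ (by positivity)
  have htg : (1 + t * t) * g = 1 :=
    ((Commute.one_left g).add_left (hcomm.mul_left hcomm)).eq.trans hgt
  have hgt' : g * t * t = 1 - g := by
    rw [eq_sub_iff_add_eq', mul_assoc, ← hgt, mul_add, mul_one]
  have htg' : t * t * g = 1 - g := by
    rw [eq_sub_iff_add_eq', ← htg, add_mul, one_mul]
  have hone := norm_one_le_one (M := M)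
  have hcomm' : ∀ a : M, ‖g * a - a * g‖ ≤ 2 * ‖t * a - a * t‖ := fun a => by
    -- The resolvent identity $[g,a]=-g[t^2,a]g$.
    have h1 : g * a - a * g = -(g * (t * (t * a - a * t) + (t * a - a * t) * t) * g) := by
      have h2 : g * (t * (t * a - a * t) + (t * a - a * t) * t) * g
          = g * t * t * (a * g) - g * a * (t * t * g) := by noncomm_ring
      rw [h2, hgt', htg']
      noncomm_ring
    rw [h1, norm_neg]
    have h3 : ‖t * (t * a - a * t) + (t * a - a * t) * t‖ ≤ 2 * ‖t * a - a * t‖ := by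
      calc _ ≤ ‖t‖ * ‖t * a - a * t‖ + ‖t * a - a * t‖ * ‖t‖ :=
            (norm_add_le _ _).trans (add_le_add (norm_mul_le _ _) (norm_mul_le _ _))
        _ ≤ 1 * ‖t * a - a * t‖ + ‖t * a - a * t‖ * 1 := by gcongr
        _ = _ := by ring
    calc _ ≤ ‖g‖ * ‖t * (t * a - a * t) + (t * a - a * t) * t‖ * ‖g‖ :=
          (norm_mul_le _ _).trans (by gcongr; exact norm_mul_le _ _)
      _ ≤ 1 * (2 * ‖t * a - a * t‖) * 1 := by gcongr
      _ = _ := by ring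
  have hc : star ((2 : ℂ) • (t * g)) = (2 : ℂ) • (t * g) := by
    rw [star_smul, star_mul, hg, ht, hcomm.eq]
    simp
  have hs : star ((2 : ℂ) • g - 1) = (2 : ℂ) • g - 1 := by
    rw [star_sub, star_smul, hg, star_one]
    simp
  have hcs : ((2 : ℂ) • (t * g)) * ((2 : ℂ) • (t * g)) + ((2 : ℂ) • g - 1) * ((2 : ℂ) • g - 1) = 1 := by
    have h1 : t * g * (t * g) = g - g * g := by
      have h2 : t * g * (t * g) = t * t * g * g := by
        rw [mul_assoc t g, ← mul_assoc g t, ← hcomm.eq]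
        noncomm_ring
      rw [h2, htg', sub_mul, one_mul]
    rw [smul_mul_smul_comm, h1, sub_mul, mul_sub, mul_sub, smul_mul_smul_comm, mul_one, one_mul,
      mul_one]
    module
  obtain ⟨hc1, hs1⟩ : ‖(2 : ℂ) • (t * g)‖ ≤ 1 ∧ ‖(2 : ℂ) • g - 1‖ ≤ 1 := by
    constructor
    · refine norm_le_one_of_star_mul_self_add (y := (2 : ℂ) • g - 1) ?_
      rw [hc, hs, hcs]
    · refine norm_le_one_of_star_mul_self_add (y := (2 : ℂ) • (t * g)) ?_
      rw [hc, hs, add_comm, hcs]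
  -- The factorization $s=g(1+t)\cdot(1-t)$ makes $s$ small on every vector that $1-t$ almost kills.
  refine ⟨(2 : ℂ) • (t * g), (2 : ℂ) • g - 1, g * (1 + t), hc, hs, hcs,
    I.smul_mem _ (hmul' _ _ htI), ?_, ?_, ?_, hs1, hc1, fun a => ?_⟩
  · have h1 : (2 : ℂ) • g - 1 - 1 = (-2 : ℂ) • (t * (t * g)) := by
      rw [← mul_assoc, htg']
      module
    rw [h1]
    exact I.smul_mem _ (hmul' _ _ htI)
  · calc _ ≤ ‖g‖ * (‖(1 : M)‖ + ‖t‖) :=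
          (norm_mul_le _ _).trans (by gcongr; exact norm_add_le _ _)
      _ ≤ 1 * (1 + 1) := by gcongr
      _ = 2 := by norm_num
  · have h1 : g * (1 + t) * (1 - t) = g - g * t * t := by noncomm_ring
    rw [h1, hgt']
    module
  · generalize hcdef : (2 : ℂ) • (t * g) = c at *
    generalize hsdef : (2 : ℂ) • g - 1 = s at *
    -- Because $c^2+s^2=1$, the defect is $c[a,c]+s[a,s]$; the commutators contribute $6$ and $4$ to
    -- the constant $10$.
    have h1 : c * a * c + s * a * s - a = c * (a * c - c * a) + s * (a * s - s * a) := by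
      calc _ = c * a * c + s * a * s - (c * c + s * s) * a := by rw [hcs, one_mul]
        _ = _ := by noncomm_ring
    have h2 : ‖a * c - c * a‖ ≤ 6 * ‖t * a - a * t‖ := by
      have h3 : a * c - c * a = (-2 : ℂ) • (t * (g * a - a * g) + (t * a - a * t) * g) := by
        rw [← hcdef, mul_smul_comm, smul_mul_assoc, ← smul_sub, neg_smul, ← smul_neg]
        congr 1
        noncomm_ring
      rw [h3, norm_smul, norm_neg, Complex.norm_ofNat]
      calc _ ≤ 2 * (‖t‖ * ‖g * a - a * g‖ + ‖t * a - a * t‖ * ‖g‖) := by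
            gcongr
            exact (norm_add_le _ _).trans (add_le_add (norm_mul_le _ _) (norm_mul_le _ _))
        _ ≤ 2 * (1 * (2 * ‖t * a - a * t‖) + ‖t * a - a * t‖ * 1) := by
          gcongr
          exact hcomm' a
        _ = _ := by ring
    have h4 : ‖a * s - s * a‖ ≤ 4 * ‖t * a - a * t‖ := by
      have h5 : a * s - s * a = (-2 : ℂ) • (g * a - a * g) := by
        rw [← hsdef, mul_sub, sub_mul, mul_smul_comm, smul_mul_assoc, mul_one, one_mul]
        module
      rw [h5, norm_smul, norm_neg, Complex.norm_ofNat]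
      linarith [hcomm' a]
    rw [h1]
    calc _ ≤ ‖c‖ * ‖a * c - c * a‖ + ‖s‖ * ‖a * s - s * a‖ :=
          (norm_add_le _ _).trans (add_le_add (norm_mul_le _ _) (norm_mul_le _ _))
      _ ≤ 1 * (6 * ‖t * a - a * t‖) + 1 * (4 * ‖t * a - a * t‖) := by gcongr
      _ = _ := by ring

end Quasicentral

/-! ## Operators into infinite direct sums -/

section Columns

variable {D E F : Type*} [NonUnitalCStarAlgebra D] [PartialOrder D] [StarOrderedRing D]
  [NormedAddCommGroup E] [NormedSpace ℂ E] [SMul D E] [CStarModule D E]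
  [NormedAddCommGroup F] [NormedSpace ℂ F] [SMul D F] [CStarModule D F]

/-- The finite set of indices of the first `N` blocks of lengths `K 0, K 1, …`, together with
everything below `N`. -/
def blockIndices (K : ℕ → ℕ) (N : ℕ) : Finset ℕ :=
  ((Finset.range N).sigma fun n => Finset.range (K n)).image (fun p => Nat.pair p.1 p.2) ∪
    Finset.range N

theorem monotone_blockIndices (K : ℕ → ℕ) : Monotone (blockIndices K) := fun _ _ h =>
  Finset.union_subset_union (Finset.image_subset_image
    (Finset.sigma_mono (Finset.range_mono h) fun _ => subset_rfl)) (Finset.range_mono h)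

theorem tendsto_blockIndices (K : ℕ → ℕ) : Tendsto (blockIndices K) atTop atTop :=
  tendsto_atTop_finset_of_monotone (monotone_blockIndices K) fun m =>
    ⟨m + 1, Finset.mem_union_right _ (Finset.self_mem_range_succ m)⟩

/-- The indices below $N$ are included only so that the sets exhaust $\mathbb N$. They add nothing:
an index $(n,k)$ among them has $n<N$, so it lies in the first $N$ blocks or satisfies $k\ge K_n$.
-/
theorem sum_blockIndices {V : Type*} [AddCommMonoid V] {K : ℕ → ℕ} {g : ℕ → V}
    (hg : ∀ n k, K n ≤ k → g (Nat.pair n k) = 0) (N : ℕ) :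
    ∑ m ∈ blockIndices K N, g m = ∑ n ∈ Finset.range N, ∑ k ∈ Finset.range (K n), g (Nat.pair n k) := by
  rw [Finset.sum_sigma', blockIndices, ← Finset.sum_subset Finset.subset_union_left]
  · rw [Finset.sum_image]
    rintro ⟨n, k⟩ _ ⟨n', k'⟩ _ h
    obtain ⟨h1, h2⟩ := Nat.pair_eq_pair.1 h
    simp only at h1 h2
    rw [h1, h2]
  · intro m hm hm'
    have hr : m < N := by
      rcases Finset.mem_union.1 hm with h | h
      · exact absurd h hm'
      · exact Finset.mem_range.1 h
    have h1 := hg (Nat.unpair m).1 (Nat.unpair m).2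
    rw [Nat.pair_unpair] at h1
    refine h1 (not_lt.1 fun hlt => hm' (Finset.mem_image.2 ⟨⟨(Nat.unpair m).1, (Nat.unpair m).2⟩,
      Finset.mem_sigma.2 ⟨Finset.mem_range.2 ((Nat.unpair_left_le m).trans_lt hr),
        Finset.mem_range.2 hlt⟩, Nat.pair_unpair m⟩))

/-- Finite sums increase and are bounded by $L$. Once some $s_N$ comes within $\varepsilon$ of $L$,
every larger finite set lies between it and $L$. -/
theorem hasSum_of_nonneg_of_tendsto {ι : Type*} {f : ι → D} (hf : ∀ i, 0 ≤ f i) {s : ℕ → Finset ι}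
    (hs : Tendsto s atTop atTop) {L : D}
    (hL : Tendsto (fun N => ∑ i ∈ s N, f i) atTop (𝓝 L)) : HasSum f L := by
  have hle : ∀ t : Finset ι, ∑ i ∈ t, f i ≤ L := fun t => by
    refine ge_of_tendsto hL ?_
    filter_upwards [hs.eventually (eventually_ge_atTop t)] with N hN
    exact Finset.sum_le_sum_of_subset_of_nonneg hN fun i _ _ => hf i
  rw [HasSum, SummationFilter.unconditional_filter]
  refine Metric.tendsto_nhds.2 fun ε hε => ?_
  obtain ⟨N, hN⟩ := (Metric.tendsto_nhds.1 hL ε hε).exists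
  filter_upwards [eventually_ge_atTop (s N)] with t ht
  refine lt_of_le_of_lt ?_ hN
  rw [dist_comm, dist_comm _ L, dist_eq_norm, dist_eq_norm]
  refine CStarAlgebra.norm_le_norm_of_nonneg_of_le (sub_nonneg.2 (hle t)) ?_
  exact sub_le_sub_left (Finset.sum_le_sum_of_subset_of_nonneg ht fun i _ _ => hf i) L

namespace InfSum

/-- The restriction of an element of `E^∞` to a finite set of indices. -/
def truncate (t : Finset ℕ) (y : ℕ → F) : InfSum D F :=
  mk (fun n => if n ∈ t then y n else 0)
    (summable_of_ne_finset_zero (s := t) fun n hn => by simp [hn])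

theorem seq_truncate (t : Finset ℕ) (y : ℕ → F) (n : ℕ) :
    (truncate (D := D) t y).seq n = if n ∈ t then y n else 0 := rfl

theorem inner_truncate (t : Finset ℕ) (x y : ℕ → F) :
    (inner D (truncate (D := D) t x) (truncate (D := D) t y) : D) = ∑ n ∈ t, inner D (x n) (y n) := by
  rw [inner_def, tsum_eq_sum (s := t) fun n hn => by simp [seq_truncate, hn]]
  exact Finset.sum_congr rfl fun n hn => by simp [seq_truncate, hn]

theorem norm_sum_inner_mul_le (t : Finset ℕ) (x y : ℕ → F) :
    ‖∑ n ∈ t, (inner D (x n) (y n) : D)‖ ≤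
      √‖∑ n ∈ t, (inner D (x n) (x n) : D)‖ * √‖∑ n ∈ t, (inner D (y n) (y n) : D)‖ := by
  rw [← inner_truncate, ← inner_truncate, ← inner_truncate,
    ← CStarModule.norm_eq_sqrt_norm_inner_self (A := D) (truncate (D := D) t x),
    ← CStarModule.norm_eq_sqrt_norm_inner_self (A := D) (truncate (D := D) t y)]
  exact CStarModule.norm_inner_le (InfSum D F)

/-- A sequence of adjointable operators whose squares sum up weakly to a bounded operator defines an
adjointable operator into the infinite direct sum. -/
theorem exists_column [CompleteSpace E] {r : ℕ → E →L[ℂ] F} {r' : ℕ → F →L[ℂ] E}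
    (hr : ∀ m, IsAdjoint D (r m) (r' m)) (Q : E →L[ℂ] E)
    (hQ : ∀ x, HasSum (fun m => (inner D (r m x) (r m x) : D)) (inner D x (Q x))) :
    ∃ (W : E →L[ℂ] InfSum D F) (W' : InfSum D F →L[ℂ] E), IsAdjoint D W W' ∧
      ∀ x m, (W x).seq m = r m x := by
  have hnn : ∀ x m, 0 ≤ (inner D (r m x) (r m x) : D) := fun x m => CStarModule.inner_self_nonneg
  have hb : ∀ x (t : Finset ℕ),
      √‖∑ m ∈ t, (inner D (r m x) (r m x) : D)‖ ≤ √‖Q‖ * ‖x‖ := fun x t => by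
    refine Real.sqrt_le_iff.2 ⟨by positivity, ?_⟩
    rw [mul_pow, Real.sq_sqrt (norm_nonneg _)]
    calc _ ≤ ‖(inner D x (Q x) : D)‖ := by
          refine CStarAlgebra.norm_le_norm_of_nonneg_of_le (Finset.sum_nonneg fun m _ => hnn x m) ?_
          rw [← (hQ x).tsum_eq]
          exact (hQ x).summable.sum_le_tsum t fun m _ => hnn x m
      _ ≤ ‖x‖ * ‖Q x‖ := CStarModule.norm_inner_le E
      _ ≤ ‖x‖ * (‖Q‖ * ‖x‖) := by gcongr; exact Q.le_opNorm x
      _ = _ := by ring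
  -- The point is adjointability. Cauchy–Schwarz bounds $\sum r_m^*y_m$ by the norm of the
  -- corresponding part of $y$, so this series converges and defines the adjoint.
  have hadj : ∀ (y : ℕ → F) (t : Finset ℕ),
      ‖∑ m ∈ t, r' m (y m)‖ ≤ √‖Q‖ * √‖∑ m ∈ t, (inner D (y m) (y m) : D)‖ := fun y t => by
    set x := ∑ m ∈ t, r' m (y m) with hx
    rcases (norm_nonneg x).eq_or_lt with h0 | h0
    · rw [← h0]
      positivity
    have h1 : ‖x‖ ^ 2 ≤ (√‖Q‖ * ‖x‖) * √‖∑ m ∈ t, (inner D (y m) (y m) : D)‖ := by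
      have h2 : (inner D x x : D) = ∑ m ∈ t, inner D (r m x) (y m) := by
        conv_lhs => rw [hx, CStarModule.inner_sum_right]
        exact Finset.sum_congr rfl fun m _ => (hr m x (y m)).symm
      rw [CStarModule.norm_sq_eq D, h2]
      refine (norm_sum_inner_mul_le t (fun m => r m x) y).trans ?_
      gcongr
      exact hb x t
    nlinarith
  have hs : ∀ y : InfSum D F, Summable fun m => r' m (y.seq m) := fun y => by
    rw [summable_iff_vanishing_norm]
    intro ε hε
    obtain ⟨s, hs⟩ := summable_iff_vanishing_norm.1 y.summable_self ((ε / (√‖Q‖ + 1)) ^ 2)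
      (by positivity)
    refine ⟨s, fun t ht => (hadj _ t).trans_lt ?_⟩
    have h1 : √‖∑ m ∈ t, (inner D (y.seq m) (y.seq m) : D)‖ < ε / (√‖Q‖ + 1) := by
      rw [← Real.sqrt_sq (show 0 ≤ ε / (√‖Q‖ + 1) by positivity)]
      exact Real.sqrt_lt_sqrt (norm_nonneg _) (hs t ht)
    calc _ ≤ √‖Q‖ * (ε / (√‖Q‖ + 1)) := by gcongr
      _ < (√‖Q‖ + 1) * (ε / (√‖Q‖ + 1)) := by gcongr; linarith
      _ = ε := by field_simp
  have hbound : ∀ y : InfSum D F, ‖∑' m, r' m (y.seq m)‖ ≤ √‖Q‖ * ‖y‖ := fun y => by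
    refine le_of_tendsto (hs y).hasSum.norm (Eventually.of_forall fun t => (hadj _ t).trans ?_)
    gcongr
    exact Real.sqrt_le_iff.2 ⟨norm_nonneg _, norm_sum_inner_le y t⟩
  refine ⟨LinearMap.mkContinuous
      { toFun := fun x => mk (fun m => r m x) (hQ x).summable
        map_add' := fun x y => ext fun m => by simp
        map_smul' := fun c x => ext fun m => by simp } √‖Q‖ fun x => ?_,
    LinearMap.mkContinuous
      { toFun := fun y => ∑' m, r' m (y.seq m)
        map_add' := fun x y => by
          simp only [map_add, Pi.add_apply]
          exact (hs x).tsum_add (hs y)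
        map_smul' := fun c x => by
          simp only [map_smul, Pi.smul_apply, RingHom.id_apply]
          exact (hs x).tsum_const_smul c } √‖Q‖ hbound, fun x y => ?_, fun x m => rfl⟩
  · have h1 : ‖(mk (fun m => r m x) (hQ x).summable : InfSum D F)‖
        = √‖(inner D x (Q x) : D)‖ := by
      rw [CStarModule.norm_eq_sqrt_norm_inner_self (A := D), inner_def]
      simp only [seq_mk]
      rw [(hQ x).tsum_eq]
    refine h1.le.trans (le_of_tendsto (hQ x).norm.sqrt (Eventually.of_forall fun t => hb x t))
  · change (inner D (mk (fun m => r m x) (hQ x).summable : InfSum D F) y : D)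
      = inner D x (∑' m, r' m (y.seq m))
    have h1 : HasSum (fun m => (inner D x (r' m (y.seq m)) : D)) (inner D x (∑' m, r' m (y.seq m))) := by
      have h2 : Continuous fun z : E => (inner D x z : D) :=
        (CStarModule.continuous_inner (A := D) (E := E)).comp (continuous_const.prodMk continuous_id)
      have h3 := (h2.tendsto _).comp (hs y).hasSum
      refine h3.congr fun t => ?_
      exact CStarModule.inner_sum_right
    rw [← h1.tsum_eq, inner_def]
    exact tsum_congr fun m => hr m x _

/-- The column operator obtained from finite blocks of operators. -/
theorem exists_column_of_blocks [CompleteSpace E] [CompleteSpace F] {R : ℕ → ℕ → E →L[ℂ] F}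
    {R' : ℕ → ℕ → F →L[ℂ] E} (hR : ∀ n k, IsAdjoint D (R n k) (R' n k)) {K : ℕ → ℕ}
    (hK : ∀ n k, K n ≤ k → R n k = 0) (Q : E →L[ℂ] E)
    (hQ : ∀ x, Tendsto (fun N => ∑ n ∈ Finset.range N, ∑ k ∈ Finset.range (K n),
      (inner D (R n k x) (R n k x) : D)) atTop (𝓝 (inner D x (Q x)))) :
    ∃ (W : E →L[ℂ] InfSum D F) (W' : InfSum D F →L[ℂ] E), IsAdjoint D W W' ∧
      ∀ (T : AdjEnd D F) x y, Tendsto (fun N => ∑ n ∈ Finset.range N, ∑ k ∈ Finset.range (K n),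
        (inner D (R n k x) (T.val (R n k y)) : D)) atTop
        (𝓝 (inner D x (W' ((diag T).val (W y))))) := by
  have hz : ∀ n k, K n ≤ k → ∀ x, R n k x = 0 := fun n k h x => by rw [hK n k h, zero_apply]
  obtain ⟨W, W', hW, hWs⟩ := exists_column
    (fun m => hR (Nat.unpair m).1 (Nat.unpair m).2) Q (fun x => by
      refine hasSum_of_nonneg_of_tendsto (fun m => CStarModule.inner_self_nonneg)
        (tendsto_blockIndices K) ((hQ x).congr fun N => ?_)
      rw [sum_blockIndices fun n k h => ?_]
      · simp only [Nat.unpair_pair]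
      · simp only [Nat.unpair_pair, hz n k h, CStarModule.inner_zero_left])
  refine ⟨W, W', hW, fun T x y => ?_⟩
  rw [← hW]
  have h1 := (summable_inner (W x) ((diag T).val (W y))).hasSum
  refine (h1.comp (tendsto_blockIndices K)).congr fun N => ?_
  simp only [Function.comp_apply, val_diag, diagCLM_seq, hWs]
  rw [sum_blockIndices fun n k h => ?_]
  · simp only [Nat.unpair_pair]
  · simp only [Nat.unpair_pair, hz n k h, CStarModule.inner_zero_left]

end InfSum

end Columns

/-! ## Approximate dilation of a correspondence into an infinite multiple of another one -/

section Dilation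

variable {A D E F : Type*} [CStarAlgebra A] [NonUnitalCStarAlgebra D] [PartialOrder D]
  [StarOrderedRing D]
  [NormedAddCommGroup E] [NormedSpace ℂ E] [SMul D E] [CStarModule D E] [CompleteSpace E]
  [NormedAddCommGroup F] [NormedSpace ℂ F] [SMul D F] [CStarModule D F] [CompleteSpace F]

theorem AdjEnd.norm_apply_le (T : AdjEnd D E) (x : E) : ‖T.val x‖ ≤ ‖T‖ * ‖x‖ := T.val.le_opNorm x

theorem mul_rankOne_mul (T S : AdjEnd D E) (ξ η : E) :
    T * rankOne D ξ η * S = rankOne D (T.val ξ) ((star S).val η) := by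
  refine AdjEnd.val_injective ?_
  rw [map_mul, map_mul, val_rankOne, val_rankOne, ← rankOneMap_comp S.isAdjoint,
    ← comp_rankOneMap T.isAdjoint]
  rfl

/-- A quasicentral compact $t$ with $\theta_{\eta,\eta}t\approx\theta_{\eta,\eta}$ almost fixes
$\eta$; the rotation built from $t$ then has $s\eta\approx0$ and almost commutes with $S$. One such
rotation splits off one block of the dilation. -/
theorem exists_compact_rotation (T : Finset E) (S : Finset (AdjEnd D E)) {ε : ℝ} (hε : 0 < ε) :
    ∃ c s : AdjEnd D E, star c = c ∧ star s = s ∧ c * c + s * s = 1 ∧ c ∈ Compacts D E ∧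
      s - 1 ∈ Compacts D E ∧ ‖s‖ ≤ 1 ∧ (∀ η ∈ T, ‖s.val η‖ ≤ ε) ∧
      ∀ a ∈ S, ‖c * a * c + s * a * s - a‖ ≤ ε := by
  classical
  obtain ⟨l, hne, hl, hlt⟩ := exists_approximateUnit_compacts D E
  -- The first bound gives $\|(1-t)\eta\|^2\le2\cdot\varepsilon^2/8=(\varepsilon/2)^2$, and
  -- $\|h\|\le2$ then gives $\|s\eta\|\le\varepsilon$. The second compensates the factor $10$ of
  -- `exists_rotation`.
  have hδ : 0 < min (ε ^ 2 / 8) (ε / 10) := by positivity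
  obtain ⟨t, htI, hts, ht1, htT, htS⟩ := exists_quasicentral (Compacts D E)
    (fun m k hk => mul_mem_compacts m hk) (fun m k hk => mem_compacts_mul hk m)
    (fun k hk => star_mem_compacts hk) l hl hlt S (T.image fun η => rankOne D η η)
    (fun k hk => by
      obtain ⟨η, _, rfl⟩ := Finset.mem_image.1 hk
      exact rankOne_mem η η) hδ
  obtain ⟨c, s, h, hc, hs, hcs, hcI, hsI, hh, hsh, hs1, _, hcomm⟩ := exists_rotation
    (Compacts D E) (fun m k hk => mem_compacts_mul hk m) htI hts ht1
  refine ⟨c, s, hc, hs, hcs, hcI, hsI, hs1, fun η hη => ?_, fun a ha => ?_⟩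
  · have h1 : ‖(1 - t).val η‖ ^ 2 ≤ (ε / 2) ^ 2 := by
      have h2 : rankOne D ((1 - t).val η) ((1 - t).val η)
          = (1 - t) * (rankOne D η η - rankOne D η η * t) := by
        have h3 := mul_rankOne_mul (1 - t) (1 - t) η η
        rw [star_sub, star_one, hts] at h3
        rw [← h3, mul_assoc, mul_sub, mul_one]
      calc _ ≤ ‖rankOne D ((1 - t).val η) ((1 - t).val η)‖ := norm_sq_le_norm_rankOneMap _
        _ ≤ ‖1 - t‖ * ‖rankOne D η η - rankOne D η η * t‖ := by
          rw [h2]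
          exact norm_mul_le _ _
        _ ≤ (1 + 1) * (ε ^ 2 / 8) := by
          gcongr
          · exact (norm_sub_le _ _).trans (add_le_add norm_one_le_one ht1)
          · exact (htT _ (Finset.mem_image_of_mem _ hη)).trans (min_le_left _ _)
        _ = _ := by ring
    have h4 : ‖(1 - t).val η‖ ≤ ε / 2 := abs_le_of_sq_le_sq' h1 (by positivity) |>.2
    calc ‖s.val η‖ = ‖h.val ((1 - t).val η)‖ := by
          rw [hsh, map_mul]
          rfl
      _ ≤ ‖h‖ * ‖(1 - t).val η‖ := h.norm_apply_le _
      _ ≤ 2 * (ε / 2) := by gcongr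
      _ = ε := by ring
  · calc _ ≤ 10 * ‖t * a - a * t‖ := hcomm a
      _ ≤ 10 * (ε / 10) := by
        gcongr
        exact (htS a ha).trans (min_le_right _ _)
      _ = ε := by ring

theorem norm_conj_sub_conj_le (a C C₀ : AdjEnd D E) :
    ‖star C * a * C - star C₀ * a * C₀‖ ≤ ‖C - C₀‖ * ‖a‖ * (‖C‖ + ‖C₀‖) := by
  have h1 : star C * a * C - star C₀ * a * C₀ = star (C - C₀) * a * C + star C₀ * a * (C - C₀) := by
    rw [star_sub]
    noncomm_ring
  rw [h1]
  calc _ ≤ ‖star (C - C₀)‖ * ‖a‖ * ‖C‖ + ‖star C₀‖ * ‖a‖ * ‖C - C₀‖ :=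
        (norm_add_le _ _).trans (add_le_add (norm_mul₃_le) (norm_mul₃_le))
    _ = _ := by rw [norm_star, norm_star]; ring

/-- The left-hand side depends on $\eta$ and $b$ only through the summed coefficients. The same
formula with the single system $\xi$ describes $C_0^*\pi(a)C_0$, so close coefficients give close
operators. -/
theorem sum_comp_rankOneMap_apply {m n : ℕ} (ζ : Fin m → E) (η : Fin n → Fin m → F) (b : AdjEnd D F)
    (x : E) :
    (∑ j, (∑ l, rankOneMap D (ζ l) (η j l)) ∘L b.val ∘L (∑ l, rankOneMap D (η j l) (ζ l))) x
      = ∑ l, ∑ k, ((inner D (ζ k) x : D) * ∑ j, inner D (η j l) (b.val (η j k))) • ζ l := by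
  refine ext_inner D fun z => ?_
  simp only [sum_apply, ContinuousLinearMap.comp_apply, rankOneMap_apply, map_sum,
    CStarModule.inner_sum_right, CStarModule.inner_op_smul_right, b.isAdjoint.map_smul,
    Finset.sum_mul, Finset.mul_sum]
  rw [Finset.sum_comm]
  conv_rhs => rw [Finset.sum_comm]
  exact Finset.sum_congr rfl fun k _ => Finset.sum_comm

/-- Replace $C$ by a finite rank $C_0=\sum_l\theta_{\xi_l,\zeta_l}$, approximate the coefficients of
$\xi$ by those of systems $\eta_j$, and take $r_j=\sum_l\theta_{\eta_{jl},\zeta_l}$. Beyond index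
$n$ the operators are zero. -/
theorem CoefficientApprox.exists_block {π : A →⋆ₐ[ℂ] AdjEnd D E} {ρ : A →⋆ₐ[ℂ] AdjEnd D F}
    (happ : CoefficientApprox π ρ) {C : AdjEnd D E} (hC : C ∈ Compacts D E) (S : Finset A) {ε : ℝ}
    (hε : 0 < ε) :
    ∃ (K : ℕ) (r : ℕ → E →L[ℂ] F) (r' : ℕ → F →L[ℂ] E), (∀ k, IsAdjoint D (r k) (r' k)) ∧
      (∀ k, K ≤ k → r k = 0) ∧ (∀ k, r k ∈ CompactMaps D E F) ∧
      ∀ a ∈ S, ‖∑ k ∈ Finset.range K, r' k ∘L (ρ a).val ∘L r k - (star C * π a * C).val‖ ≤ ε := by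
  set M : ℝ := 1 + ∑ a ∈ S, ‖π a‖ with hM
  have hM0 : 0 < M := by positivity
  have hMa : ∀ a ∈ S, ‖π a‖ ≤ M := fun a ha =>
    (Finset.single_le_sum (f := fun a => ‖π a‖) (fun a _ => norm_nonneg _) ha).trans (by linarith)
  -- Half of $\varepsilon$ pays for replacing $C$ by $C_0$, whose norm is at most $\|C\|+1$; the
  -- other half pays for the coefficients.
  have hδ : 0 < min 1 (ε / 2 / (M * (2 * ‖C‖ + 1))) := by positivity
  obtain ⟨m, ξ, ζ, hC₀⟩ := exists_sum_rankOne_of_mem_compacts hC hδ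
  set C₀ := ∑ l, rankOne D (ξ l) (ζ l) with hC₀def
  set Z : ℝ := ∑ l, ∑ k, ‖ζ k‖ * ‖ζ l‖ with hZ
  have hZ0 : 0 ≤ Z := Finset.sum_nonneg fun l _ => Finset.sum_nonneg fun k _ => by positivity
  have hδ' : 0 < ε / 2 / (Z + 1) := by positivity
  obtain ⟨n, η, hη⟩ := happ m ξ S _ hδ'
  let f : Fin n → E →L[ℂ] F := fun j => ∑ l, rankOneMap D (η j l) (ζ l)
  let f' : Fin n → F →L[ℂ] E := fun j => ∑ l, rankOneMap D (ζ l) (η j l)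
  refine ⟨n, fun k => if h : k < n then f ⟨k, h⟩ else 0, fun k => if h : k < n then f' ⟨k, h⟩ else 0,
    fun k => ?_, fun k hk => dif_neg hk.not_gt, fun k => ?_, fun a ha => ?_⟩
  · by_cases h : k < n
    · simp only [h, dite_true]
      exact IsAdjoint.sum _ fun l _ => isAdjoint_rankOneMap _ _
    · simp only [h, dite_false]
      exact fun x y => by simp
  · by_cases h : k < n
    · simp only [h, dite_true]
      exact sum_mem fun l _ => rankOneMap_mem _ _
    · simp only [h, dite_false]
      exact zero_mem _
  · have hsum : ∑ k ∈ Finset.range n, (if h : k < n then f' ⟨k, h⟩ else 0) ∘L (ρ a).val ∘L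
        (if h : k < n then f ⟨k, h⟩ else 0) = ∑ j, f' j ∘L (ρ a).val ∘L f j := by
      rw [Finset.sum_range]
      exact Finset.sum_congr rfl fun j _ => by simp
    rw [hsum]
    have h1 : ‖(star C₀ * π a * C₀).val - (star C * π a * C).val‖ ≤ ε / 2 := by
      rw [← map_sub, AdjEnd.norm_val, norm_sub_rev]
      refine (norm_conj_sub_conj_le _ _ _).trans ?_
      have h2 : ‖C - C₀‖ ≤ 1 := hC₀.le.trans (min_le_left _ _)
      have h3 : ‖C - C₀‖ ≤ ε / 2 / (M * (2 * ‖C‖ + 1)) := hC₀.le.trans (min_le_right _ _)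
      have h4 : ‖C₀‖ ≤ ‖C‖ + 1 := by
        calc ‖C₀‖ = ‖C - (C - C₀)‖ := by rw [sub_sub_cancel]
          _ ≤ ‖C‖ + 1 := (norm_sub_le _ _).trans (by gcongr)
      calc _ ≤ ε / 2 / (M * (2 * ‖C‖ + 1)) * M * (‖C‖ + (‖C‖ + 1)) := by
            gcongr
            exact hMa a ha
        _ = _ := by
          field_simp
          ring
    have h5 : ‖∑ j, f' j ∘L (ρ a).val ∘L f j - (star C₀ * π a * C₀).val‖ ≤ ε / 2 := by
      refine ContinuousLinearMap.opNorm_le_bound _ (by positivity) fun x => ?_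
      have h6 : (star C₀ * π a * C₀).val = ∑ _j : Fin 1, (∑ l, rankOneMap D (ζ l) (ξ l)) ∘L
          (π a).val ∘L (∑ l, rankOneMap D (ξ l) (ζ l)) := by
        rw [Fin.sum_univ_one, hC₀def, star_sum, map_mul, map_mul, map_sum, map_sum]
        simp only [star_rankOne, val_rankOne]
        rfl
      have h7 := sum_comp_rankOneMap_apply ζ (fun _ : Fin 1 => ξ) (π a) x
      rw [sub_apply, h6, h7, sum_comp_rankOneMap_apply ζ η (ρ a) x]
      simp only [Fin.sum_univ_one, ← Finset.sum_sub_distrib]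
      have h8 : ∀ l k, ‖((inner D (ζ k) x : D) * ∑ j, inner D (η j l) ((ρ a).val (η j k))) • ζ l
          - ((inner D (ζ k) x : D) * inner D (ξ l) ((π a).val (ξ k))) • ζ l‖
          ≤ ‖ζ k‖ * ‖ζ l‖ * (ε / 2 / (Z + 1) * ‖x‖) := fun l k => by
        have h9 : ∀ d d' : D, d • ζ l - d' • ζ l = (d - d') • ζ l := fun d d' => by
          rw [sub_eq_iff_eq_add, ← add_smul', sub_add_cancel]
        rw [h9, ← mul_sub]
        calc _ ≤ (‖ζ k‖ * ‖x‖) * (ε / 2 / (Z + 1)) * ‖ζ l‖ := by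
              refine (norm_smul_le' _ _).trans ?_
              gcongr
              refine (norm_mul_le _ _).trans ?_
              gcongr
              · exact CStarModule.norm_inner_le E
              · rw [norm_sub_rev]
                exact (hη a ha l k).le
          _ = _ := by ring
      calc _ ≤ ∑ l, ∑ k, ‖ζ k‖ * ‖ζ l‖ * (ε / 2 / (Z + 1) * ‖x‖) :=
            (norm_sum_le _ _).trans (Finset.sum_le_sum fun l _ =>
              (norm_sum_le _ _).trans (Finset.sum_le_sum fun k _ => h8 l k))
        _ = Z * (ε / 2 / (Z + 1)) * ‖x‖ := by
          simp only [← Finset.sum_mul, hZ]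
          ring
        _ ≤ (Z + 1) * (ε / 2 / (Z + 1)) * ‖x‖ := by gcongr; linarith
        _ = _ := by field_simp
    calc _ = ‖(∑ j, f' j ∘L (ρ a).val ∘L f j - (star C₀ * π a * C₀).val)
          + ((star C₀ * π a * C₀).val - (star C * π a * C).val)‖ := by rw [sub_add_sub_cancel]
      _ ≤ ε / 2 + ε / 2 := (norm_add_le _ _).trans (add_le_add h5 h1)
      _ = ε := add_halves ε

end Dilation

/-! ### Summing the blocks by telescoping -/

section AlmostDilation

variable {A D E F : Type*} [CStarAlgebra A] [NonUnitalCStarAlgebra D] [PartialOrder D]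
  [StarOrderedRing D]
  [NormedAddCommGroup E] [NormedSpace ℂ E] [SMul D E] [CStarModule D E] [CompleteSpace E]
  [NormedAddCommGroup F] [NormedSpace ℂ F] [SMul D F] [CStarModule D F] [CompleteSpace F]

/-- The $P_n$ are contractions and commute with the action of $D$, so strong convergence to zero
need only be checked on generators. -/
theorem tendsto_apply_zero_of_generating {P : ℕ → AdjEnd D E} (hP : ∀ n, ‖P n‖ ≤ 1) {ξ : ℕ → E}
    (hξ : (Submodule.span ℂ {x : E | ∃ (n : ℕ) (d : D), x = d • ξ n}).topologicalClosure = ⊤)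
    (h : ∀ i, Tendsto (fun n => (P n).val (ξ i)) atTop (𝓝 0)) (x : E) :
    Tendsto (fun n => (P n).val x) atTop (𝓝 0) := by
  have hspan : ∀ x ∈ Submodule.span ℂ {x : E | ∃ (n : ℕ) (d : D), x = d • ξ n},
      Tendsto (fun n => (P n).val x) atTop (𝓝 0) := fun x hx => by
    induction hx using Submodule.span_induction with
    | mem x hx =>
      obtain ⟨i, d, rfl⟩ := hx
      refine squeeze_zero_norm (a := fun n => ‖d‖ * ‖(P n).val (ξ i)‖) (fun n => ?_) ?_
      · rw [(P n).isAdjoint.map_smul]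
        exact norm_smul_le' _ _
      · simpa using (h i).norm.const_mul ‖d‖
    | zero => simp
    | add x y _ _ hx hy => simpa using hx.add hy
    | smul c x _ hx => simpa using hx.const_smul c
  have hx : x ∈ closure (Submodule.span ℂ {x : E | ∃ (n : ℕ) (d : D), x = d • ξ n} : Set E) := by
    have h1 : x ∈ (⊤ : Submodule ℂ E) := trivial
    rw [← hξ] at h1
    exact h1
  rw [Metric.tendsto_nhds]
  intro ε hε
  obtain ⟨y, hy, hxy⟩ := Metric.mem_closure_iff.1 hx (ε / 2) (by positivity)
  filter_upwards [Metric.tendsto_nhds.1 (hspan y hy) (ε / 2) (by positivity)] with n hn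
  rw [dist_zero_right] at hn ⊢
  calc ‖(P n).val x‖ = ‖(P n).val (x - y) + (P n).val y‖ := by rw [← map_add, sub_add_cancel]
    _ ≤ ‖(P n).val (x - y)‖ + ‖(P n).val y‖ := norm_add_le _ _
    _ < ε / 2 + ε / 2 := by
      refine add_lt_add ?_ hn
      refine ((P n).norm_apply_le _).trans_lt ?_
      rw [dist_eq_norm] at hxy
      nlinarith [hP n, norm_nonneg (x - y)]
    _ = ε := add_halves ε

/-- If coefficients of `π` are approximated by those of `ρ`, then `π` is, up to small compact
perturbations, a compression of `ρ^∞`. -/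
theorem CoefficientApprox.exists_almost_dilation {π : A →⋆ₐ[ℂ] AdjEnd D E}
    {ρ : A →⋆ₐ[ℂ] AdjEnd D F} (happ : CoefficientApprox π ρ) (hE : CountablyGenerated D E)
    {S : ℕ → Finset A} (hS : Monotone S) (hone : 1 ∈ S 0) {ε : ℝ} (hε : 0 < ε) :
    ∃ (W : E →L[ℂ] InfSum D F) (W' : InfSum D F →L[ℂ] E), IsAdjoint D W W' ∧
      (∀ n, ∀ a ∈ S n, W' ∘L (InfSum.rep ρ a).val ∘L W - (π a).val ∈ CompactMaps D E E) ∧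
      ∀ a ∈ S 0, ‖W' ∘L (InfSum.rep ρ a).val ∘L W - (π a).val‖ ≤ ε := by
  classical
  obtain ⟨ξ, hξ⟩ := hE
  -- Each stage makes two errors of size $e_n$, and $\sum 2e_n=\varepsilon$.
  let e : ℕ → ℝ := fun n => ε / 4 * (1 / 2) ^ n
  have he : ∀ n, 0 < e n := fun n => by positivity
  have hesum : HasSum (fun n => 2 * e n) ε := by
    have h1 := (hasSum_geometric_two.mul_left (ε / 4)).mul_left 2
    have h2 : 2 * (ε / 4 * 2) = ε := by ring
    rwa [h2] at h1
  have he0 : Tendsto e atTop (𝓝 0) := by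
    have h1 := hesum.summable.tendsto_atTop_zero.const_mul (1 / 2)
    simpa using h1
  choose c s hc hs hcs hcI hsI hs1 hsT hsS using fun (n : ℕ) (P : AdjEnd D E) =>
    exists_compact_rotation ((Finset.range (n + 1)).image fun i => P.val (ξ i))
      ((S n).image fun a => π a) (he n)
  -- $P_n=s_{n-1}\cdots s_0$ is the part not yet dilated. The rotation of stage $n$ depends on
  -- $P_n$: its $s_n$ is chosen to be small on $P_n\xi_0,\dots,P_n\xi_n$, so that $P_n\to0$
  -- strongly.
  let P : ℕ → AdjEnd D E := fun n => Nat.rec 1 (fun n P => s n P * P) n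
  have hPs : ∀ n, P (n + 1) = s n (P n) * P n := fun n => rfl
  have hP1 : ∀ n, ‖P n‖ ≤ 1 := fun n => by
    induction n with
    | zero => exact norm_one_le_one
    | succ n ih =>
      rw [hPs]
      exact (norm_mul_le _ _).trans (mul_le_one₀ (hs1 _ _) (norm_nonneg _) ih)
  have hP0 : ∀ x, Tendsto (fun n => (P n).val x) atTop (𝓝 0) := by
    refine tendsto_apply_zero_of_generating hP1 hξ fun i => ?_
    rw [← tendsto_add_atTop_iff_nat 1]
    refine squeeze_zero_norm' ?_ he0
    filter_upwards [eventually_ge_atTop i] with n hn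
    rw [hPs, map_mul]
    exact hsT n (P n) _ (Finset.mem_image_of_mem _ (Finset.mem_range.2 (by omega)))
  choose K r r' hadj hK hrK hr using fun n =>
    happ.exists_block (mem_compacts_mul (hcI n (P n)) (P n)) (S n) (he n)
  let B : ℕ → A → E →L[ℂ] E := fun n a =>
    ∑ k ∈ Finset.range (K n), r' n k ∘L (ρ a).val ∘L r n k
  let G : ℕ → A → AdjEnd D E := fun n a => star (P n) *
    (c n (P n) * π a * c n (P n) + s n (P n) * π a * s n (P n) - π a) * P n
  -- The error of stage $n$ combines the approximation of $(c_nP_n)^*\pi(a)(c_nP_n)$ by a block with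
  -- the failure `G` of the rotation to commute with $\pi(a)$. Both are compact for every $a$, and
  -- small for $a\in S_n$.
  let err : ℕ → A → E →L[ℂ] E := fun n a =>
    (B n a - (star (c n (P n) * P n) * π a * (c n (P n) * P n)).val) + (G n a).val
  have hGK : ∀ n a, G n a ∈ Compacts D E := fun n a => by
    refine mem_compacts_mul (mul_mem_compacts _ ?_) _
    have h1 : c n (P n) * π a * c n (P n) + s n (P n) * π a * s n (P n) - π a
        = c n (P n) * (π a * c n (P n)) + ((s n (P n) - 1) * (π a * s n (P n))
          + π a * (s n (P n) - 1)) := by noncomm_ring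
    rw [h1]
    exact add_mem (mem_compacts_mul (hcI _ _) _)
      (add_mem (mem_compacts_mul (hsI _ _) _) (mul_mem_compacts _ (hsI _ _)))
  have hGn : ∀ n, ∀ a ∈ S n, ‖G n a‖ ≤ e n := fun n a ha => by
    calc _ ≤ ‖star (P n)‖ * ‖c n (P n) * π a * c n (P n) + s n (P n) * π a * s n (P n) - π a‖
          * ‖P n‖ := norm_mul₃_le
      _ ≤ 1 * e n * 1 := by
        gcongr
        · rw [norm_star]
          exact hP1 n
        · exact hsS n (P n) _ (Finset.mem_image_of_mem _ ha)
        · exact hP1 n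
      _ = e n := by ring
  have herrK : ∀ n a, err n a ∈ CompactMaps D E E := fun n a => by
    refine add_mem (sub_mem (sum_mem fun k _ => ?_) ?_) (mem_compacts_iff.1 (hGK n a))
    · exact comp_mem_compactMaps (hadj n k).symm (comp_mem_compactMaps (ρ a).isAdjoint (hrK n k))
    · exact mem_compacts_iff.1 (mul_mem_compacts _ (mem_compacts_mul (hcI n (P n)) (P n)))
  have herrn : ∀ n, ∀ a ∈ S n, ‖err n a‖ ≤ 2 * e n := fun n a ha => by
    calc _ ≤ e n + e n := (norm_add_le _ _).trans (add_le_add (hr n a ha) (hGn n a ha))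
      _ = _ := by ring
  -- As $P_{n+1}=s_nP_n$, the identity
  -- $(c_nP_n)^*\pi(a)(c_nP_n)=P_n^*\pi(a)P_n-P_{n+1}^*\pi(a)P_{n+1}+G_n(a)$ telescopes, starting
  -- from $P_0=1$.
  have htel : ∀ a N, ∑ n ∈ Finset.range N, B n a
      = (π a).val + ∑ n ∈ Finset.range N, err n a - (star (P N) * π a * P N).val := fun a N => by
    induction N with
    | zero =>
      have h1 : P 0 = 1 := rfl
      simp [h1]
    | succ N ih =>
      have h2 : star (c N (P N) * P N) * π a * (c N (P N) * P N)
          = G N a + star (P N) * π a * P N - star (P (N + 1)) * π a * P (N + 1) := by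
        rw [hPs, star_mul, star_mul, hc, hs]
        simp only [G]
        noncomm_ring
      have h3 : B N a = err N a + (star (P N) * π a * P N).val
          - (star (P (N + 1)) * π a * P (N + 1)).val := by
        simp only [err]
        rw [h2, map_sub, map_add]
        abel
      rw [Finset.sum_range_succ, Finset.sum_range_succ, ih, h3]
      abel
  -- For $a\in S_m$ the norm estimates start at stage $m$; the finitely many earlier errors are
  -- compact but not necessarily small. This is why the norm bound is stated for $S_0$ only.
  have hsummable : ∀ m, ∀ a ∈ S m, Summable fun n => err n a := fun m a ha => by
    refine Summable.of_norm_bounded_eventually_nat hesum.summable ?_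
    filter_upwards [eventually_ge_atTop m] with n hn
    exact herrn n a (hS hn ha)
  have hlim : ∀ m, ∀ a ∈ S m, ∀ x y, Tendsto (fun N => ∑ n ∈ Finset.range N,
      ∑ k ∈ Finset.range (K n), (inner D (r n k x) ((ρ a).val (r n k y)) : D)) atTop
      (𝓝 (inner D x (((π a).val + ∑' n, err n a) y))) := fun m a ha x y => by
    have h1 : ∀ N, ∑ n ∈ Finset.range N, ∑ k ∈ Finset.range (K n),
        (inner D (r n k x) ((ρ a).val (r n k y)) : D)
        = inner D x (((π a).val + ∑ n ∈ Finset.range N, err n a) y)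
          - inner D ((P N).val x) ((π a).val ((P N).val y)) := fun N => by
      have h2 : (inner D x ((∑ n ∈ Finset.range N, B n a) y) : D) = ∑ n ∈ Finset.range N,
          ∑ k ∈ Finset.range (K n), inner D (r n k x) ((ρ a).val (r n k y)) := by
        simp only [B, sum_apply, CStarModule.inner_sum_right, ContinuousLinearMap.comp_apply]
        exact Finset.sum_congr rfl fun n _ => Finset.sum_congr rfl fun k _ => (hadj n k _ _).symm
      rw [← h2, htel, sub_apply, CStarModule.inner_sub_right, map_mul, map_mul,
        (P N).inner_apply_left]
      rfl
    simp only [h1]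
    have hcont := CStarModule.continuous_inner (A := D) (E := E)
    have h3 : Tendsto (fun N => ((π a).val + ∑ n ∈ Finset.range N, err n a) y) atTop
        (𝓝 (((π a).val + ∑' n, err n a) y)) :=
      ((ContinuousLinearMap.apply ℂ E y).continuous.tendsto _).comp
        ((hsummable m a ha).hasSum.tendsto_sum_nat.const_add _)
    have h4 := (hcont.tendsto (x, _)).comp (tendsto_const_nhds.prodMk_nhds h3)
    have h5 := (hcont.tendsto (0, (π a).val 0)).comp
      ((hP0 x).prodMk_nhds (((π a).val.continuous.tendsto 0).comp (hP0 y)))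
    have h6 := h4.sub h5
    simpa using h6
  -- The case $a=1$ supplies the operator $1+\sum_n \mathrm{err}_n(1)$, the future $W^*W$, needed
  -- before the column $W$ can be formed.
  have hQ := hlim 0 1 hone
  simp only [map_one, one_apply_eq_self] at hQ
  obtain ⟨W, W', hW, hWlim⟩ := InfSum.exists_column_of_blocks hadj hK _ (fun x => hQ x x)
  have hfin : ∀ m, ∀ a ∈ S m, W' ∘L (InfSum.rep ρ a).val ∘L W - (π a).val = ∑' n, err n a :=
    fun m a ha => by
      rw [sub_eq_iff_eq_add']
      refine ContinuousLinearMap.ext fun y => ext_inner D fun x => ?_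
      exact tendsto_nhds_unique (hWlim (ρ a) x y) (hlim m a ha x y)
  refine ⟨W, W', hW, fun m a ha => ?_, fun a ha => ?_⟩
  · rw [hfin m a ha]
    exact isClosed_compactMaps.mem_of_tendsto (hsummable m a ha).hasSum.tendsto_sum_nat
      (Eventually.of_forall fun N => sum_mem fun n _ => herrK n a)
  · rw [hfin 0 a ha]
    exact tsum_of_norm_bounded hesum fun n => herrn n a (hS (Nat.zero_le n) ha)

end AlmostDilation

/-! ## Passage to infinite multiples -/

section InfiniteMultiple

variable {A D E F : Type*} [CStarAlgebra A] [NonUnitalCStarAlgebra D] [PartialOrder D]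
  [StarOrderedRing D]
  [NormedAddCommGroup E] [NormedSpace ℂ E] [SMul D E] [CStarModule D E]
  [NormedAddCommGroup F] [NormedSpace ℂ F] [SMul D F] [CStarModule D F]

namespace InfSum

variable (D E) in
/-- The `n`-th coordinate `E^∞ → E`. -/
def proj (n : ℕ) : InfSum D E →L[ℂ] E :=
  LinearMap.mkContinuous (LinearMap.proj n ∘ₗ seq) 1 fun x => by
    rw [one_mul]
    exact norm_seq_le x n

@[simp] theorem proj_apply (n : ℕ) (x : InfSum D E) : proj D E n x = x.seq n := rfl

theorem inner_mk_single (n : ℕ) (x : E) (y : ℕ → E) :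
    (fun i => (inner D ((Pi.single n x : ℕ → E) i) (y i) : D)) = Pi.single n (inner D x (y n)) := by
  funext i
  rcases eq_or_ne i n with rfl | h
  · simp
  · simp [h]

theorem summable_single (n : ℕ) (x : E) :
    Summable fun i => (inner D ((Pi.single n x : ℕ → E) i) ((Pi.single n x : ℕ → E) i) : D) := by
  rw [inner_mk_single]
  exact (hasSum_pi_single n _).summable

variable (D E) in
/-- The inclusion of `E` into `E^∞` as the `n`-th summand. -/
def single (n : ℕ) : E →L[ℂ] InfSum D E :=
  LinearMap.mkContinuous
    { toFun := fun x => mk (Pi.single n x) (summable_single n x)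
      map_add' := fun x y => seq_injective <| by
        rw [map_add]
        exact Pi.single_add (f := fun _ : ℕ => E) n x y
      map_smul' := fun c x => seq_injective <| by
        rw [map_smul]
        exact Pi.single_smul' n c x } 1 fun x => by
    rw [one_mul]
    refine abs_le_of_sq_le_sq' (le_of_eq ?_) (norm_nonneg _) |>.2
    rw [CStarModule.norm_sq_eq D, CStarModule.norm_sq_eq D, inner_def]
    change ‖∑' i, (inner D ((Pi.single n x : ℕ → E) i) ((Pi.single n x : ℕ → E) i) : D)‖ = _
    rw [inner_mk_single, tsum_pi_single]
    simp

theorem seq_single (n : ℕ) (x : E) : (single D E n x).seq = Pi.single n x := rfl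

theorem isAdjoint_single (n : ℕ) : IsAdjoint D (single D E n) (proj D E n) := fun x y => by
  rw [inner_def, seq_single, inner_mk_single, tsum_pi_single, proj_apply]

theorem truncate_eq_sum (t : Finset ℕ) (y : ℕ → E) :
    truncate (D := D) t y = ∑ n ∈ t, single D E n (y n) := by
  refine ext fun i => ?_
  rw [seq_truncate, map_sum, Finset.sum_apply]
  simp only [seq_single]
  rw [Finset.sum_pi_single]

theorem tendsto_truncate (y : InfSum D E) :
    Tendsto (fun N => truncate (D := D) (Finset.range N) y.seq) atTop (𝓝 y) := by
  rw [tendsto_iff_norm_sub_tendsto_zero]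
  have h1 : ∀ N, ‖truncate (D := D) (Finset.range N) y.seq - y‖ ^ 2
      = ‖(inner D y y : D) - ∑ n ∈ Finset.range N, inner D (y.seq n) (y.seq n)‖ := fun N => by
    have h2 : (inner D y (truncate (D := D) (Finset.range N) y.seq) : D)
        = ∑ n ∈ Finset.range N, inner D (y.seq n) (y.seq n) := by
      rw [inner_def, tsum_eq_sum (s := Finset.range N) fun n hn => by simp only [seq_truncate, hn,
        if_false, CStarModule.inner_zero_right]]
      exact Finset.sum_congr rfl fun n hn => by simp only [seq_truncate, hn, if_true]
    have h3 : (inner D (truncate (D := D) (Finset.range N) y.seq) y : D)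
        = ∑ n ∈ Finset.range N, inner D (y.seq n) (y.seq n) := by
      rw [← CStarModule.star_inner (A := D) y, h2, star_sum]
      simp
    rw [CStarModule.norm_sq_eq D, CStarModule.inner_sub_left, CStarModule.inner_sub_right,
      CStarModule.inner_sub_right, inner_truncate, h2, h3, sub_self, zero_sub, neg_sub]
  have h4 : Tendsto (fun N => ‖truncate (D := D) (Finset.range N) y.seq - y‖ ^ 2) atTop (𝓝 0) := by
    simp only [h1]
    simpa [inner_def] using (y.summable_self.hasSum.tendsto_sum_nat.const_sub (inner D y y)).norm
  simpa using h4.sqrt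

end InfSum

theorem CountablyGenerated.infSum (h : CountablyGenerated D E) :
    CountablyGenerated D (InfSum D E) := by
  obtain ⟨ξ, hξ⟩ := h
  refine ⟨fun m => InfSum.single D E (Nat.unpair m).1 (ξ (Nat.unpair m).2), ?_⟩
  set V := (Submodule.span ℂ {x : InfSum D E | ∃ (m : ℕ) (d : D),
    x = d • InfSum.single D E (Nat.unpair m).1 (ξ (Nat.unpair m).2)}).topologicalClosure with hV
  have hclosed : IsClosed (V : Set (InfSum D E)) := Submodule.isClosed_topologicalClosure _
  have hsingle : ∀ n x, InfSum.single D E n x ∈ V := fun n x => by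
    have h1 : (⊤ : Submodule ℂ E) ≤ V.comap (InfSum.single D E n : E →ₗ[ℂ] InfSum D E) := by
      rw [← hξ]
      refine Submodule.topologicalClosure_minimal _ (Submodule.span_le.2 ?_)
        (hclosed.preimage (InfSum.single D E n).continuous)
      rintro _ ⟨i, d, rfl⟩
      change InfSum.single D E n (d • ξ i) ∈ V
      rw [(InfSum.isAdjoint_single n).map_smul]
      refine Submodule.le_topologicalClosure _ (Submodule.subset_span ⟨Nat.pair n i, d, ?_⟩)
      rw [Nat.unpair_pair]
    exact h1 trivial
  refine eq_top_iff.2 fun y _ => hclosed.mem_of_tendsto y.tendsto_truncate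
    (Eventually.of_forall fun N => ?_)
  rw [InfSum.truncate_eq_sum]
  exact sum_mem fun n _ => hsingle n _

/-- Coefficients of $\pi^\infty$ are norm convergent sums of coefficients of $\pi$. Cut off at a
common $N$, approximate each of the $N$ summands, and concatenate the systems found. -/
theorem CoefficientApprox.infSum [CompleteSpace E] {π : A →⋆ₐ[ℂ] AdjEnd D E}
    {ρ : A →⋆ₐ[ℂ] AdjEnd D F} (happ : CoefficientApprox π ρ) :
    CoefficientApprox (InfSum.rep π) ρ := by
  intro m ξ S ε hε
  have hev : ∀ᶠ N in atTop, ∀ a ∈ S, ∀ l k, ‖(inner D (ξ l) ((InfSum.rep π a).val (ξ k)) : D)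
      - ∑ i ∈ Finset.range N, inner D ((ξ l).seq i) ((π a).val ((ξ k).seq i))‖ < ε / 2 := by
    refine (Filter.eventually_all_finset S).2 fun a _ => eventually_all.2 fun l =>
      eventually_all.2 fun k => ?_
    have h1 := (((InfSum.summable_inner (ξ l)
      ((InfSum.rep π a).val (ξ k))).hasSum.tendsto_sum_nat.const_sub
        (inner D (ξ l) ((InfSum.rep π a).val (ξ k)))).norm)
    rw [← InfSum.inner_def, sub_self, norm_zero] at h1
    exact h1.eventually (gt_mem_nhds (by positivity))
  obtain ⟨N, hN⟩ := hev.exists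
  have hδ : 0 < ε / 2 / (N + 1) := by positivity
  have key : ∀ M : ℕ, ∃ (n : ℕ) (η : Fin n → Fin m → F), ∀ a ∈ S, ∀ l k,
      ‖∑ i ∈ Finset.range M, (inner D ((ξ l).seq i) ((π a).val ((ξ k).seq i)) : D)
        - ∑ j, inner D (η j l) ((ρ a).val (η j k))‖ ≤ M * (ε / 2 / (N + 1)) := fun M => by
    induction M with
    | zero => exact ⟨0, fun _ _ => 0, fun a _ l k => by simp⟩
    | succ M ih =>
      obtain ⟨n, η, h1⟩ := ih
      obtain ⟨n', η', h2⟩ := happ m (fun l => (ξ l).seq M) S _ hδ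
      refine ⟨n + n', Fin.append η η', fun a ha l k => ?_⟩
      rw [Finset.sum_range_succ, Fin.sum_univ_add]
      simp only [Fin.append_left, Fin.append_right]
      rw [add_sub_add_comm]
      refine (norm_add_le _ _).trans ((add_le_add (h1 a ha l k) (h2 a ha l k).le).trans ?_)
      push_cast
      linarith
  obtain ⟨n, η, h⟩ := key N
  refine ⟨n, η, fun a ha l k => ?_⟩
  rw [← sub_add_sub_cancel]
  refine (norm_add_le _ _).trans_lt ((add_lt_add_of_lt_of_le (hN a ha l k) (h a ha l k)).trans_le ?_)
  have h3 : (N : ℝ) * (ε / 2 / (N + 1)) ≤ ε / 2 := by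
    rw [mul_div_assoc', div_le_iff₀ (by positivity)]
    nlinarith
  linarith

end InfiniteMultiple

/-! ## Isometric dilations -/

section Isometry

/-- The spectrum of $Q$ lies in $[1/2,\infty)$, so $p=Q^{-1/2}$ exists. The factorization of $p-1$
through $Q-1$ makes $p-1$ compact and small whenever $Q-1$ is; it comes from
$x^{-1/2}-1=-(x-1)/(\sqrt x(1+\sqrt x))$. -/
theorem exists_inv_sqrt {M : Type*} [CStarAlgebra M] {Q : M} (hQ : star Q = Q)
    (hQ1 : ‖Q - 1‖ ≤ 1 / 2) :
    ∃ p w : M, star p = p ∧ p * Q * p = 1 ∧ p - 1 = (Q - 1) * w ∧ ‖w‖ ≤ 2 := by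
  have hsa : IsSelfAdjoint Q := hQ
  have hspec : ∀ x ∈ spectrum ℝ Q, 1 / 2 ≤ x := fun x hx => by
    have h1 : x - 1 ∈ spectrum ℝ (Q - 1) := by
      have h0 := spectrum.add_mem_iff (a := Q) (r := x - 1) (s := (1 : ℝ))
      rw [sub_add_cancel, map_one, neg_add_eq_sub] at h0
      exact h0.1 hx
    have h2 := spectrum.norm_le_norm_mul_of_mem h1
    have h3 : ‖x - 1‖ ≤ 1 / 2 := by
      refine h2.trans ?_
      nlinarith [norm_nonneg (Q - 1), norm_one_le_one (M := M)]
    rw [Real.norm_eq_abs, abs_le] at h3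
    linarith
  have hpos : ∀ x ∈ spectrum ℝ Q, 0 < √x := fun x hx =>
    Real.sqrt_pos.2 (lt_of_lt_of_le (by norm_num) (hspec x hx))
  let f : ℝ → ℝ := fun x => (√x)⁻¹
  let g : ℝ → ℝ := fun x => -(√x * (1 + √x))⁻¹
  have hf : ContinuousOn f (spectrum ℝ Q) :=
    Real.continuous_sqrt.continuousOn.inv₀ fun x hx => (hpos x hx).ne'
  have hg : ContinuousOn g (spectrum ℝ Q) := by
    refine (ContinuousOn.inv₀ (by fun_prop) fun x hx => ?_).neg
    have := hpos x hx
    positivity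
  have hid : ContinuousOn (fun x : ℝ => x) (spectrum ℝ Q) := continuousOn_id
  refine ⟨cfc f Q, cfc g Q, cfc_predicate f Q, ?_, ?_, ?_⟩
  · have h1 : cfc (fun x : ℝ => f x * x * f x) Q = cfc f Q * Q * cfc f Q := by
      rw [cfc_mul (fun x => f x * x) f Q (hf.mul hid) hf, cfc_mul f (fun x => x) Q hf hid,
        cfc_id' ℝ Q]
    rw [← h1, ← cfc_const_one ℝ Q]
    refine cfc_congr fun x hx => ?_
    have h2 := hpos x hx
    have h3 : √x * √x = x := Real.mul_self_sqrt (Real.sqrt_pos.1 h2).le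
    simp only [f]
    field_simp
    nlinarith
  · have h1 : cfc (fun x : ℝ => (x - 1) * g x) Q = (Q - 1) * cfc g Q := by
      rw [cfc_mul (fun x => x - 1) g Q (by fun_prop) hg, cfc_sub (fun x => x) (fun _ => 1) Q,
        cfc_id' ℝ Q, cfc_const_one ℝ Q]
    have h2 : cfc (fun x : ℝ => f x - 1) Q = cfc f Q - 1 := by
      rw [cfc_sub f (fun _ => 1) Q hf, cfc_const_one ℝ Q]
    rw [← h1, ← h2]
    refine cfc_congr fun x hx => ?_
    have h2 := hpos x hx
    have h3 : √x * √x = x := Real.mul_self_sqrt (Real.sqrt_pos.1 h2).le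
    simp only [f, g]
    field_simp
    nlinarith
  · refine norm_cfc_le (by norm_num) fun x hx => ?_
    have h2 := hpos x hx
    have h3 : √x * √x = x := Real.mul_self_sqrt (Real.sqrt_pos.1 h2).le
    have h4 := hspec x hx
    rw [norm_neg, Real.norm_of_nonneg (by positivity)]
    refine inv_le_of_inv_le₀ (by norm_num) ?_
    nlinarith

end Isometry

section IsometricDilation

variable {A D E F G : Type*} [CStarAlgebra A] [NonUnitalCStarAlgebra D] [PartialOrder D]
  [StarOrderedRing D]
  [NormedAddCommGroup E] [NormedSpace ℂ E] [SMul D E] [CStarModule D E] [CompleteSpace E]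
  [NormedAddCommGroup F] [NormedSpace ℂ F] [SMul D F] [CStarModule D F] [CompleteSpace F]
  [NormedAddCommGroup G] [NormedSpace ℂ G] [SMul D G] [CStarModule D G]

/-- The compression `W⋆ T W` of `T ∈ 𝓛(G)` by an adjointable `W : E → G`. -/
def IsAdjoint.compress {W : E →L[ℂ] G} {W' : G →L[ℂ] E} (h : IsAdjoint D W W') (T : AdjEnd D G) :
    AdjEnd D E :=
  .mk (W' ∘L T.val ∘L W) (W' ∘L (star T).val ∘L W) (h.symm.comp (T.isAdjoint.comp h))

theorem IsAdjoint.val_compress {W : E →L[ℂ] G} {W' : G →L[ℂ] E} (h : IsAdjoint D W W')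
    (T : AdjEnd D G) : (h.compress T).val = W' ∘L T.val ∘L W := rfl

theorem IsAdjoint.star_compress {W : E →L[ℂ] G} {W' : G →L[ℂ] E} (h : IsAdjoint D W W')
    (T : AdjEnd D G) : star (h.compress T) = h.compress (star T) :=
  AdjEnd.star_eq (h.symm.comp (T.isAdjoint.comp h))

/-- An isometry whose compressions of `ρ` differ from `π` by small or compact operators intertwines
`π` and `ρ` up to small or compact operators. -/
theorem intertwiner_comp_eq {π : A →⋆ₐ[ℂ] AdjEnd D E} {ρ : A →⋆ₐ[ℂ] AdjEnd D G}
    {V : E →L[ℂ] G} {V' : G →L[ℂ] E} (hV : IsAdjoint D V V')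
    (hiso : V' ∘L V = ContinuousLinearMap.id ℂ E) (a : A) :
    (V' ∘L (ρ (star a)).val - (π (star a)).val ∘L V') ∘L ((ρ a).val ∘L V - V ∘L (π a).val)
      = ((hV.compress (ρ (star a * a)) - π (star a * a))
        - (hV.compress (ρ (star a)) - π (star a)) * π a
        - π (star a) * (hV.compress (ρ a) - π a)).val := by
  ext x
  have h1 : V' (V ((π a).val x)) = (π a).val x := congrArg (fun T : E →L[ℂ] E => T ((π a).val x)) hiso
  simp [IsAdjoint.val_compress, h1]
  abel

theorem isAdjoint_intertwiner {π : A →⋆ₐ[ℂ] AdjEnd D E} {ρ : A →⋆ₐ[ℂ] AdjEnd D G}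
    {V : E →L[ℂ] G} {V' : G →L[ℂ] E} (hV : IsAdjoint D V V') (a : A) :
    IsAdjoint D ((ρ a).val ∘L V - V ∘L (π a).val)
      (V' ∘L (ρ (star a)).val - (π (star a)).val ∘L V') := by
  have h1 := (ρ a).isAdjoint
  have h2 := (π a).isAdjoint
  rw [← map_star] at h1 h2
  exact (h1.comp hV).sub (hV.comp h2)

/-- The almost dilation $W$ has $W^*W$ equal to $1$ up to a small compact operator, so
$V=W(W^*W)^{-1/2}$ is an isometry with the same compressions up to such operators. For
$T=\rho^\infty(a)V-V\pi(a)$ the operator $T^*T$ involves the compressions at $a$, $a^*$ and $a^*a$,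
hence the three memberships. -/
theorem CoefficientApprox.exists_isometric_dilation {π : A →⋆ₐ[ℂ] AdjEnd D E}
    {ρ : A →⋆ₐ[ℂ] AdjEnd D F} (happ : CoefficientApprox π ρ) (hE : CountablyGenerated D E)
    {S : ℕ → Finset A} (hS : Monotone S) (hone : 1 ∈ S 0) {ε : ℝ} (hε : 0 < ε) :
    ∃ (V : E →L[ℂ] InfSum D F) (V' : InfSum D F →L[ℂ] E), IsAdjoint D V V' ∧
      V' ∘L V = ContinuousLinearMap.id ℂ E ∧
      (∀ n a, a ∈ S n → star a ∈ S n → star a * a ∈ S n →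
        (InfSum.rep ρ a).val ∘L V - V ∘L (π a).val ∈ CompactMaps D E (InfSum D F)) ∧
      ∀ a, a ∈ S 0 → star a ∈ S 0 → star a * a ∈ S 0 →
        ‖(InfSum.rep ρ a).val ∘L V - V ∘L (π a).val‖ ≤ ε := by
  set M : ℝ := ∑ a ∈ S 0, ‖π a‖ with hM
  have hM0 : 0 ≤ M := Finset.sum_nonneg fun a _ => norm_nonneg _
  have hMa : ∀ a ∈ S 0, ‖π a‖ ≤ M := fun a ha =>
    Finset.single_le_sum (f := fun a => ‖π a‖) (fun a _ => norm_nonneg _) ha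
  -- The bound $1/2$ serves the inverse square root. The compressions of $V$ are within
  -- $(4+6M)\delta$ of $\pi$, and the three terms of $T^*T$ multiply this by $1+2M$.
  set δ : ℝ := min (1 / 2) (ε ^ 2 / ((4 + 6 * M) * (1 + 2 * M))) with hδ
  have hδ0 : 0 < δ := by positivity
  obtain ⟨W, W', hW, hWK, hWn⟩ := happ.exists_almost_dilation hE hS hone hδ0
  let τ : A → AdjEnd D E := fun a => hW.compress (InfSum.rep ρ a)
  have hτK : ∀ n, ∀ a ∈ S n, τ a - π a ∈ Compacts D E := fun n a ha => by
    rw [mem_compacts_iff, map_sub]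
    exact hWK n a ha
  have hτn : ∀ a ∈ S 0, ‖τ a - π a‖ ≤ δ := fun a ha => by
    rw [← AdjEnd.norm_val, map_sub]
    exact hWn a ha
  have hQK := hτK 0 1 hone
  have hQn := hτn 1 hone
  rw [map_one] at hQK hQn
  obtain ⟨p, w, hp, hpQ, hpw, hw⟩ := exists_inv_sqrt (Q := τ 1)
    (by rw [IsAdjoint.star_compress, ← map_star, star_one]) (hQn.trans (min_le_left _ _))
  have hpK : p - 1 ∈ Compacts D E := by
    rw [hpw]
    exact mem_compacts_mul hQK w
  have hpn : ‖p - 1‖ ≤ 2 * δ := by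
    rw [hpw]
    calc _ ≤ ‖τ 1 - 1‖ * ‖w‖ := norm_mul_le _ _
      _ ≤ δ * 2 := by gcongr
      _ = _ := mul_comm _ _
  have hp2 : ‖p‖ ≤ 2 := by
    calc ‖p‖ = ‖1 + (p - 1)‖ := by rw [add_sub_cancel]
      _ ≤ 1 + 2 * δ := (norm_add_le _ _).trans (add_le_add norm_one_le_one hpn)
      _ ≤ 2 := by linarith [min_le_left (1 / 2) (ε ^ 2 / ((4 + 6 * M) * (1 + 2 * M)))]
  have hpadj : IsAdjoint D p.val p.val := by
    have := p.isAdjoint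
    rwa [hp] at this
  have hV : IsAdjoint D (W ∘L p.val) (p.val ∘L W') := hW.comp hpadj
  have hcompress : ∀ a, hV.compress (InfSum.rep ρ a) = p * τ a * p := fun a =>
    AdjEnd.val_injective (by rw [map_mul, map_mul]; rfl)
  have hiso : (p.val ∘L W') ∘L (W ∘L p.val) = ContinuousLinearMap.id ℂ E := by
    have h1 := hcompress 1
    rw [hpQ, map_one] at h1
    exact congrArg AdjEnd.val h1
  have hk : ∀ a, hV.compress (InfSum.rep ρ a) - π a
      = p * (τ a - π a) * p + (p - 1) * (π a * p) + π a * (p - 1) := fun a => by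
    rw [hcompress]
    noncomm_ring
  have hkK : ∀ n, ∀ a ∈ S n, hV.compress (InfSum.rep ρ a) - π a ∈ Compacts D E := fun n a ha => by
    rw [hk]
    exact add_mem (add_mem (mem_compacts_mul (mul_mem_compacts _ (hτK n a ha)) _)
      (mem_compacts_mul hpK _)) (mul_mem_compacts _ hpK)
  have hkn : ∀ a ∈ S 0, ‖hV.compress (InfSum.rep ρ a) - π a‖ ≤ (4 + 6 * M) * δ := fun a ha => by
    rw [hk]
    calc _ ≤ ‖p‖ * ‖τ a - π a‖ * ‖p‖ + ‖p - 1‖ * (‖π a‖ * ‖p‖) + ‖π a‖ * ‖p - 1‖ := by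
          refine (norm_add_le _ _).trans (add_le_add ((norm_add_le _ _).trans
            (add_le_add norm_mul₃_le ?_)) (norm_mul_le _ _))
          exact (norm_mul_le _ _).trans (by gcongr; exact norm_mul_le _ _)
      _ ≤ 2 * δ * 2 + 2 * δ * (M * 2) + M * (2 * δ) := by
        have := hτn a ha
        have := hMa a ha
        gcongr
      _ = _ := by ring
  refine ⟨W ∘L p.val, p.val ∘L W', hV, hiso, fun n a ha has haa => ?_, fun a ha has haa => ?_⟩
  · refine (isAdjoint_intertwiner hV a).mem_compactMaps ?_
    rw [intertwiner_comp_eq hV hiso, ← mem_compacts_iff]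
    exact sub_mem (sub_mem (hkK n _ haa) (mem_compacts_mul (hkK n _ has) _))
      (mul_mem_compacts _ (hkK n _ ha))
  · refine abs_le_of_sq_le_sq' ((isAdjoint_intertwiner hV a).norm_sq_le.trans ?_) hε.le |>.2
    rw [intertwiner_comp_eq hV hiso, AdjEnd.norm_val]
    have h1 := hkn _ haa
    have h2 := hkn _ has
    have h3 := hkn _ ha
    have h4 := hMa _ ha
    have h5 := hMa _ has
    calc _ ≤ ‖hV.compress (InfSum.rep ρ (star a * a)) - π (star a * a)‖
          + ‖hV.compress (InfSum.rep ρ (star a)) - π (star a)‖ * ‖π a‖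
          + ‖π (star a)‖ * ‖hV.compress (InfSum.rep ρ a) - π a‖ :=
          (norm_sub_le _ _).trans (add_le_add ((norm_sub_le _ _).trans
            (add_le_add le_rfl (norm_mul_le _ _))) (norm_mul_le _ _))
      _ ≤ (4 + 6 * M) * δ + (4 + 6 * M) * δ * M + M * ((4 + 6 * M) * δ) := by gcongr
      _ = (4 + 6 * M) * (1 + 2 * M) * δ := by ring
      _ ≤ (4 + 6 * M) * (1 + 2 * M) * (ε ^ 2 / ((4 + 6 * M) * (1 + 2 * M))) := by
        gcongr
        exact min_le_right _ _
      _ = ε ^ 2 := by field_simp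

end IsometricDilation

/-! ## Absorption -/

section Absorption

variable {A D E F : Type*} [CStarAlgebra A] [NonUnitalCStarAlgebra D] [PartialOrder D]
  [StarOrderedRing D]
  [NormedAddCommGroup E] [NormedSpace ℂ E] [SMul D E] [CStarModule D E]
  [NormedAddCommGroup F] [NormedSpace ℂ F] [SMul D F] [CStarModule D F]

theorem IsAdjoint.norm_le_one_of_comp_eq_id {T : E →L[ℂ] F} {S : F →L[ℂ] E} (h : IsAdjoint D T S)
    (hST : S ∘L T = ContinuousLinearMap.id ℂ E) : ‖T‖ ≤ 1 := by
  have h1 := h.norm_sq_le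
  rw [hST] at h1
  have h2 := h1.trans ContinuousLinearMap.norm_id_le
  nlinarith [norm_nonneg T]

/-- The criterion that $S$ is compact if $S^*S$ is, applied to $S^*S=TS$. -/
theorem IsAdjoint.adjoint_mem_compactMaps [CompleteSpace F] {T : E →L[ℂ] F} {S : F →L[ℂ] E}
    (h : IsAdjoint D T S) (hT : T ∈ CompactMaps D E F) : S ∈ CompactMaps D F E :=
  h.symm.mem_compactMaps (mem_compactMaps_comp h.symm hT)

variable (D E F) in
/-- The first coordinate on `E ⊕ F`. -/
def prodFst : C⋆ᵐᵒᵈ(D, E × F) →L[ℂ] E :=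
  ContinuousLinearMap.fst ℂ E F ∘L
    (WithCStarModule.equivL ℂ (A := D) (E := E × F)).toContinuousLinearMap

variable (D E F) in
/-- The second coordinate on `E ⊕ F`. -/
def prodSnd : C⋆ᵐᵒᵈ(D, E × F) →L[ℂ] F :=
  ContinuousLinearMap.snd ℂ E F ∘L
    (WithCStarModule.equivL ℂ (A := D) (E := E × F)).toContinuousLinearMap

variable (D E F) in
/-- The inclusion of the first summand in `E ⊕ F`. -/
def prodInl : E →L[ℂ] C⋆ᵐᵒᵈ(D, E × F) :=
  (WithCStarModule.equivL ℂ (A := D) (E := E × F)).symm.toContinuousLinearMap ∘L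
    ContinuousLinearMap.inl ℂ E F

variable (D E F) in
/-- The inclusion of the second summand in `E ⊕ F`. -/
def prodInr : F →L[ℂ] C⋆ᵐᵒᵈ(D, E × F) :=
  (WithCStarModule.equivL ℂ (A := D) (E := E × F)).symm.toContinuousLinearMap ∘L
    ContinuousLinearMap.inr ℂ E F

@[simp] theorem prodFst_inl (x : E) : prodFst D E F (prodInl D E F x) = x := rfl

@[simp] theorem prodFst_inr (y : F) : prodFst D E F (prodInr D E F y) = 0 := rfl

@[simp] theorem prodSnd_inl (x : E) : prodSnd D E F (prodInl D E F x) = 0 := rfl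

@[simp] theorem prodSnd_inr (y : F) : prodSnd D E F (prodInr D E F y) = y := rfl

theorem prodInl_add_inr (z : C⋆ᵐᵒᵈ(D, E × F)) :
    prodInl D E F (prodFst D E F z) + prodInr D E F (prodSnd D E F z) = z :=
  Prod.ext (add_zero z.1) (zero_add z.2)

theorem isAdjoint_prodInl : IsAdjoint D (prodInl D E F) (prodFst D E F) := fun x z => by
  have h1 : (prodInl D E F x).1 = x := rfl
  have h2 : (prodInl D E F x).2 = 0 := rfl
  rw [WithCStarModule.prod_inner, h1, h2, CStarModule.inner_zero_left, add_zero]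
  rfl

theorem isAdjoint_prodInr : IsAdjoint D (prodInr D E F) (prodSnd D E F) := fun y z => by
  have h1 : (prodInr D E F y).1 = 0 := rfl
  have h2 : (prodInr D E F y).2 = y := rfl
  rw [WithCStarModule.prod_inner, h1, h2, CStarModule.inner_zero_left, zero_add]
  rfl

theorem norm_prodFst_le : ‖prodFst D E F‖ ≤ 1 := by
  rw [isAdjoint_prodInl.norm_eq]
  exact isAdjoint_prodInl.norm_le_one_of_comp_eq_id rfl

theorem norm_prodSnd_le : ‖prodSnd D E F‖ ≤ 1 := by
  rw [isAdjoint_prodInr.norm_eq]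
  exact isAdjoint_prodInr.norm_le_one_of_comp_eq_id rfl

variable [CompleteSpace E]

variable (D E) in
/-- The unilateral shift on `E^∞`. -/
theorem InfSum.exists_shift : ∃ sh sh' : InfSum D E →L[ℂ] InfSum D E, IsAdjoint D sh sh' ∧
    (∀ x, (sh x).seq 0 = 0) ∧ (∀ x n, (sh x).seq (n + 1) = x.seq n) ∧
    ∀ x n, (sh' x).seq n = x.seq (n + 1) := by
  let r : ℕ → InfSum D E →L[ℂ] E := fun n => Nat.casesOn n 0 fun n => proj D E n
  let r' : ℕ → E →L[ℂ] InfSum D E := fun n => Nat.casesOn n 0 fun n => single D E n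
  have hr : ∀ n, IsAdjoint D (r n) (r' n) := fun n => by
    cases n with
    | zero => exact fun x y => by simp [r, r']
    | succ n => exact (isAdjoint_single n).symm
  obtain ⟨sh, sh', hsh, hs⟩ := exists_column hr (ContinuousLinearMap.id ℂ _) fun x => by
    have h1 := x.summable_self.hasSum
    rw [← inner_def] at h1
    have h2 := (hasSum_nat_add_iff (f := fun m => (inner D (r m x) (r m x) : D)) 1).1 h1
    simpa [r] using h2
  refine ⟨sh, sh', hsh, fun x => hs x 0, fun x n => hs x (n + 1), fun x n => ?_⟩
  -- The column construction gives no formula for the adjoint. Its coordinates follow by uniqueness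
  -- of adjoints from the action of the shift on single summands.
  have h3 : sh ∘L single D E n = single D E (n + 1) := by
    refine ContinuousLinearMap.ext fun y => InfSum.ext fun m => ?_
    rw [ContinuousLinearMap.comp_apply, hs]
    cases m with
    | zero => simp [r, seq_single]
    | succ m =>
      change (single D E n y).seq m = _
      rw [seq_single, seq_single]
      rcases eq_or_ne m n with rfl | h
      · simp
      · simp [h]
  have h4 : IsAdjoint D (sh ∘L single D E n) (proj D E n ∘L sh') :=
    hsh.comp (isAdjoint_single n)
  rw [h3] at h4
  exact congrArg (fun T : InfSum D E →L[ℂ] E => T x) (h4.unique (isAdjoint_single (n + 1)))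

/-- If `π^∞` is almost contained in `ρ`, then `ρ` almost absorbs `π`. -/
theorem exists_unitary_of_isometry [CompleteSpace F] {π : A →⋆ₐ[ℂ] AdjEnd D E}
    {ρ : A →⋆ₐ[ℂ] AdjEnd D F} {V : InfSum D E →L[ℂ] F} {V' : F →L[ℂ] InfSum D E}
    (hV : IsAdjoint D V V') (hiso : V' ∘L V = ContinuousLinearMap.id ℂ _) :
    ∃ U : UnitaryMap D C⋆ᵐᵒᵈ(D, E × F) F, ∀ a,
      ((ρ a).val ∘L V - V ∘L (InfSum.rep π a).val ∈ CompactMaps D (InfSum D E) F →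
        (ρ (star a)).val ∘L V - V ∘L (InfSum.rep π (star a)).val ∈ CompactMaps D (InfSum D E) F →
        prodRep π ρ a - U.conj (ρ a) ∈ Compacts D C⋆ᵐᵒᵈ(D, E × F)) ∧
      ‖prodRep π ρ a - U.conj (ρ a)‖ ≤ 3 * ‖(ρ a).val ∘L V - V ∘L (InfSum.rep π a).val‖
        + 2 * ‖(ρ (star a)).val ∘L V - V ∘L (InfSum.rep π (star a)).val‖ := by
  obtain ⟨sh, sh', hsh, hsh0, hshs, hsh's⟩ := InfSum.exists_shift D E
  let e := InfSum.single D E 0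
  let e' := InfSum.proj D E 0
  have he : IsAdjoint D e e' := InfSum.isAdjoint_single 0
  have hee : ∀ x, e' (e x) = x := fun x => by simp [e, e', InfSum.seq_single]
  have hss : ∀ x, sh' (sh x) = x := fun x => InfSum.ext fun n => by rw [hsh's, hshs]
  have hes : ∀ x, e' (sh x) = 0 := fun x => hsh0 x
  have hse : ∀ x, sh' (e x) = 0 := fun x => InfSum.ext fun n => by
    rw [hsh's]
    simp [e, InfSum.seq_single]
  have hsum : ∀ x, e (e' x) + sh (sh' x) = x := fun x => InfSum.ext fun n => by
    rw [map_add, Pi.add_apply]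
    cases n with
    | zero => simp [hsh0, e, e', InfSum.seq_single]
    | succ n => simp [hshs, hsh's, e, e', InfSum.seq_single]
  have hVV : ∀ x, V' (V x) = x := fun x =>
    congrArg (fun T : InfSum D E →L[ℂ] InfSum D E => T x) hiso
  let P := ContinuousLinearMap.id ℂ F - V ∘L V'
  have hP : IsAdjoint D P P := IsAdjoint.id.sub (hV.comp hV.symm)
  let fst := prodFst D E F
  let snd := prodSnd D E F
  let inl := prodInl D E F
  let inr := prodInr D E F
  -- Write $F=VE^\infty\oplus PF$ with $P=1-VV^*$. The copy of $E^\infty$ inside $F$ is shifted by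
  -- one place, $E$ is put into the vacated coordinate $0$, and $PF$ is left fixed.
  let U₀ : C⋆ᵐᵒᵈ(D, E × F) →L[ℂ] F := V ∘L e ∘L fst + V ∘L sh ∘L V' ∘L snd + P ∘L snd
  let U₁ : F →L[ℂ] C⋆ᵐᵒᵈ(D, E × F) := inl ∘L e' ∘L V' + inr ∘L V ∘L sh' ∘L V' + inr ∘L P
  have hU : IsAdjoint D U₀ U₁ :=
    ((hV.comp (he.comp isAdjoint_prodInl.symm)).add
      (hV.comp (hsh.comp (hV.symm.comp isAdjoint_prodInr.symm)))).add
      (hP.comp isAdjoint_prodInr.symm)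
  have hPV : ∀ x, P (V x) = 0 := fun x => by simp [P, hVV]
  have hV'P : ∀ y, V' (P y) = 0 := fun y => by simp [P, hVV]
  have hPP : ∀ y, P (P y) = P y := fun y => by
    change P y - V (V' (P y)) = P y
    rw [hV'P, map_zero, sub_zero]
  have h10 : U₁ ∘L U₀ = ContinuousLinearMap.id ℂ _ := by
    refine ContinuousLinearMap.ext fun z => ?_
    have h1 : V' (U₀ z) = e (fst z) + sh (V' (snd z)) := by
      simp [U₀, hVV, hV'P]
    have h2 : P (U₀ z) = P (snd z) := by
      simp [U₀, hPV, hPP]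
    change inl (e' (V' (U₀ z))) + inr (V (sh' (V' (U₀ z)))) + inr (P (U₀ z)) = z
    rw [h1, h2, map_add e', map_add sh', hee, hes, hse, hss, add_zero, zero_add, add_assoc,
      ← map_add]
    have h3 : V (V' (snd z)) + P (snd z) = snd z := by simp [P]
    rw [h3]
    exact prodInl_add_inr z
  have h01 : U₀ ∘L U₁ = ContinuousLinearMap.id ℂ _ := by
    refine ContinuousLinearMap.ext fun y => ?_
    have h1 : fst (U₁ y) = e' (V' y) := by simp [U₁, fst, inl, inr]
    have h2 : snd (U₁ y) = V (sh' (V' y)) + P y := by simp [U₁, snd, inl, inr]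
    change V (e (fst (U₁ y))) + V (sh (V' (snd (U₁ y)))) + P (snd (U₁ y)) = y
    rw [h1, h2, map_add V', map_add P, hVV, hV'P, hPV, hPP, add_zero, zero_add, ← map_add, hsum]
    simp [P]
  have hU1n : ‖U₁‖ ≤ 1 := hU.symm.norm_le_one_of_comp_eq_id h01
  have hVn : ‖V‖ ≤ 1 := hV.norm_le_one_of_comp_eq_id hiso
  have hV'n : ‖V'‖ ≤ 1 := hV.norm_eq.le.trans hVn
  have hen : ‖e‖ ≤ 1 := he.norm_le_one_of_comp_eq_id (ContinuousLinearMap.ext hee)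
  have hshn : ‖sh‖ ≤ 1 := hsh.norm_le_one_of_comp_eq_id (ContinuousLinearMap.ext hss)
  refine ⟨⟨U₀, U₁, hU, h10, h01⟩, fun a => ?_⟩
  set Δ := (ρ a).val ∘L V - V ∘L (InfSum.rep π a).val with hΔ
  have hΔ' := isAdjoint_intertwiner (π := InfSum.rep π) (ρ := ρ) hV (star a)
  rw [star_star] at hΔ'
  set Γ := V' ∘L (ρ a).val - (InfSum.rep π a).val ∘L V' with hΓ
  -- The defect $\rho(a)U-U(\pi\oplus\rho)(a)$, rewritten so that every term contains $\Delta$ or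
  -- $\Gamma$: $e$ and the shift intertwine exactly, and $\rho(a)P-P\rho(a)=V\Gamma-\Delta V^*$.
  -- Here $\Gamma$ is the adjoint of the intertwining defect at $a^*$.
  let G : C⋆ᵐᵒᵈ(D, E × F) →L[ℂ] F := Δ ∘L (e ∘L fst + sh ∘L V' ∘L snd) - V ∘L sh ∘L Γ ∘L snd
    - Δ ∘L V' ∘L snd + V ∘L Γ ∘L snd
  have hdiff : (prodRep π ρ a - UnitaryMap.conj ⟨U₀, U₁, hU, h10, h01⟩ (ρ a)).val = -(U₁ ∘L G) := by
    have h1 : (prodRep π ρ a - UnitaryMap.conj ⟨U₀, U₁, hU, h10, h01⟩ (ρ a)).val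
        = (prodRep π ρ a).val - U₁ ∘L (ρ a).val ∘L U₀ := by
      rw [map_sub]
      rfl
    have h2 : G = (ρ a).val ∘L U₀ - U₀ ∘L (prodRep π ρ a).val := by
      refine ContinuousLinearMap.ext fun z => ?_
      have h3 : ∀ x, (InfSum.rep π a).val (e x) = e ((π a).val x) := fun x =>
        InfSum.ext fun n => by
          change (π a).val ((e x).seq n) = _
          rcases eq_or_ne n 0 with rfl | h
          · simp [e, InfSum.seq_single]
          · simp [e, InfSum.seq_single, h]
      have h4 : ∀ x, (InfSum.rep π a).val (sh x) = sh ((InfSum.rep π a).val x) := fun x =>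
        InfSum.ext fun n => by
          change (π a).val ((sh x).seq n) = _
          cases n with
          | zero => rw [hsh0, hsh0, map_zero]
          | succ n =>
            rw [hshs, hshs]
            rfl
      have h5 : fst ((prodRep π ρ a).val z) = (π a).val (fst z) := rfl
      have h6 : snd ((prodRep π ρ a).val z) = (ρ a).val (snd z) := rfl
      simp only [G, U₀, P, Δ, Γ, add_apply, sub_apply, ContinuousLinearMap.comp_apply, map_add,
        map_sub, h3, h4, h5, h6, ContinuousLinearMap.id_apply]
      abel
    rw [h1, h2]
    refine ContinuousLinearMap.ext fun z => ?_
    have h7 : U₁ (U₀ ((prodRep π ρ a).val z)) = (prodRep π ρ a).val z :=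
      congrArg (fun T : C⋆ᵐᵒᵈ(D, E × F) →L[ℂ] C⋆ᵐᵒᵈ(D, E × F) => T ((prodRep π ρ a).val z)) h10
    simp only [neg_apply, sub_apply, ContinuousLinearMap.comp_apply, map_sub, h7, neg_sub]
  constructor
  · intro hK hK'
    have hΓK : Γ ∈ CompactMaps D F (InfSum D E) := hΔ'.adjoint_mem_compactMaps hK'
    rw [mem_compacts_iff, hdiff]
    refine neg_mem (comp_mem_compactMaps hU.symm ?_)
    have hs := isAdjoint_prodInr (D := D) (E := E) (F := F) |>.symm
    refine add_mem (sub_mem (sub_mem ?_ ?_) ?_) ?_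
    · exact mem_compactMaps_comp ((he.comp isAdjoint_prodInl.symm).add
        (hsh.comp (hV.symm.comp hs))) hK
    · exact comp_mem_compactMaps hV (comp_mem_compactMaps hsh (mem_compactMaps_comp hs hΓK))
    · exact mem_compactMaps_comp (hV.symm.comp hs) hK
    · exact comp_mem_compactMaps hV (mem_compactMaps_comp hs hΓK)
  · rw [← hΔ'.norm_eq, ← AdjEnd.norm_val, hdiff, norm_neg]
    have hsn : ‖snd‖ ≤ 1 := norm_prodSnd_le
    have hfn : ‖fst‖ ≤ 1 := norm_prodFst_le
    refine ContinuousLinearMap.opNorm_le_bound _ (by positivity) fun z => ?_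
    -- $\Delta$ acts once on a vector of norm at most $2\|z\|$ and once on one of norm at most
    -- $\|z\|$, while $\Gamma$ occurs twice; this gives the constants $3$ and $2$.
    have k1 := fst.le_of_opNorm_le hfn z
    have k2 := snd.le_of_opNorm_le hsn z
    have k3 := e.le_of_opNorm_le hen (fst z)
    have k4 := V'.le_of_opNorm_le hV'n (snd z)
    have k5 := sh.le_of_opNorm_le hshn (V' (snd z))
    have k6 := Γ.le_opNorm (snd z)
    have k7 := V.le_of_opNorm_le hVn (Γ (snd z))
    have k8 := sh.le_of_opNorm_le hshn (Γ (snd z))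
    have k9 := V.le_of_opNorm_le hVn (sh (Γ (snd z)))
    have k10 := Δ.le_opNorm (V' (snd z))
    have k11 := Δ.le_opNorm (e (fst z) + sh (V' (snd z)))
    have k12 := norm_add_le (e (fst z)) (sh (V' (snd z)))
    have k13 := U₁.le_of_opNorm_le hU1n (G z)
    have k14 : ‖G z‖ ≤ ‖Δ (e (fst z) + sh (V' (snd z)))‖ + ‖V (sh (Γ (snd z)))‖
        + ‖Δ (V' (snd z))‖ + ‖V (Γ (snd z))‖ :=
      (norm_add_le _ _).trans (add_le_add_left ((norm_sub_le _ _).trans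
        (add_le_add_left (norm_sub_le _ _) _)) _)
    have k15 : ‖Δ‖ * ‖e (fst z) + sh (V' (snd z))‖ ≤ ‖Δ‖ * (2 * ‖z‖) := by
      gcongr
      linarith
    have k16 : ‖Δ‖ * ‖V' (snd z)‖ ≤ ‖Δ‖ * ‖z‖ := by
      gcongr
      linarith
    have k17 : ‖Γ‖ * ‖snd z‖ ≤ ‖Γ‖ * ‖z‖ := by
      gcongr
      linarith
    rw [ContinuousLinearMap.comp_apply]
    linarith

end Absorption

/-! ### From weak containment to absorbing unitaries -/

section Forward

variable {A B X Y : Type*} [CStarAlgebra A]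
  [NonUnitalCStarAlgebra B] [PartialOrder B] [StarOrderedRing B]
  [NormedAddCommGroup X] [NormedSpace ℂ X] [SMul Bᵐᵒᵖ X] [CStarModule Bᵐᵒᵖ X] [CompleteSpace X]
  [NormedAddCommGroup Y] [NormedSpace ℂ Y] [SMul Bᵐᵒᵖ Y] [CStarModule Bᵐᵒᵖ Y] [CompleteSpace Y]

open Classical in
/-- A finite set of elements of a C⋆-algebra together with `1`, the adjoints `a⋆` and the products
`a⋆a` and `aa⋆`. -/
def starExtend (s : Finset A) : Finset A :=
  insert 1 (s ∪ s.image star ∪ s.image (fun a => star a * a) ∪ s.image fun a => a * star a)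

theorem monotone_starExtend : Monotone (starExtend (A := A)) := fun _ _ h => by
  classical
  exact Finset.insert_subset_insert _ (Finset.union_subset_union (Finset.union_subset_union
    (Finset.union_subset_union h (Finset.image_subset_image h)) (Finset.image_subset_image h))
      (Finset.image_subset_image h))

theorem one_mem_starExtend (s : Finset A) : 1 ∈ starExtend s := by simp [starExtend]

theorem mem_starExtend {s : Finset A} {a : A} (ha : a ∈ s) : a ∈ starExtend s := by
  simp [starExtend, ha]

theorem star_mem_starExtend {s : Finset A} {a : A} (ha : a ∈ s) : star a ∈ starExtend s := by
  simp [starExtend, ha]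

theorem star_mul_self_mem_starExtend {s : Finset A} {a : A} (ha : a ∈ s) :
    star a * a ∈ starExtend s := by
  simp only [starExtend, Finset.mem_insert, Finset.mem_union, Finset.mem_image]
  exact Or.inr (Or.inl (Or.inr ⟨a, ha, rfl⟩))

theorem mul_star_self_mem_starExtend {s : Finset A} {a : A} (ha : a ∈ s) :
    a * star a ∈ starExtend s := by
  simp only [starExtend, Finset.mem_insert, Finset.mem_union, Finset.mem_image]
  exact Or.inr (Or.inr ⟨a, ha, rfl⟩)

/-- The dilation is taken for $\pi_X^\infty$, as the shift argument requires. That argument uses the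
intertwining defects at $a$ and $a^*$, hence the products $a^*a$ and $aa^*$ in `starExtend`; with
weights $3$ and $2$ a tolerance of $\varepsilon/5$ suffices. -/
theorem WeaklyContainedUniv.exists_unitary {πX : A →⋆ₐ[ℂ] AdjEnd Bᵐᵒᵖ X}
    {πY : A →⋆ₐ[ℂ] AdjEnd Bᵐᵒᵖ Y} (hXY : WeaklyContainedUniv πX πY) (hX : CountablyGenerated Bᵐᵒᵖ X)
    {S : ℕ → Finset A} (hS : Monotone S) {ε : ℝ} (hε : 0 < ε) :
    ∃ U : UnitaryMap Bᵐᵒᵖ C⋆ᵐᵒᵈ(Bᵐᵒᵖ, X × InfSum Bᵐᵒᵖ Y) (InfSum Bᵐᵒᵖ Y),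
      (∀ n, ∀ a ∈ S n, prodRep πX (InfSum.rep πY) a - U.conj (InfSum.rep πY a) ∈ Compacts Bᵐᵒᵖ _) ∧
      ∀ a ∈ S 0, ‖prodRep πX (InfSum.rep πY) a - U.conj (InfSum.rep πY a)‖ ≤ ε := by
  obtain ⟨V, V', hV, hiso, hK, hn⟩ := hXY.coefficientApprox.infSum.exists_isometric_dilation
    hX.infSum (monotone_starExtend.comp hS) (one_mem_starExtend _) (show 0 < ε / 5 by positivity)
  obtain ⟨U, hU⟩ := exists_unitary_of_isometry (ρ := InfSum.rep πY) hV hiso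
  refine ⟨U, fun n a ha => (hU a).1 ?_ ?_, fun a ha => (hU a).2.trans ?_⟩
  · exact hK n a (mem_starExtend ha) (star_mem_starExtend ha) (star_mul_self_mem_starExtend ha)
  · exact hK n (star a) (star_mem_starExtend ha) (by rw [star_star]; exact mem_starExtend ha)
      (by rw [star_star]; exact mul_star_self_mem_starExtend ha)
  · have h1 := hn a (mem_starExtend ha) (star_mem_starExtend ha) (star_mul_self_mem_starExtend ha)
    have h2 := hn (star a) (star_mem_starExtend ha) (by rw [star_star]; exact mem_starExtend ha)
      (by rw [star_star]; exact mul_star_self_mem_starExtend ha)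
    linarith

theorem WeaklyContainedUniv.exists_net {A : Type u} [CStarAlgebra A]
    {πX : A →⋆ₐ[ℂ] AdjEnd Bᵐᵒᵖ X}
    {πY : A →⋆ₐ[ℂ] AdjEnd Bᵐᵒᵖ Y} (hXY : WeaklyContainedUniv πX πY)
    (hX : CountablyGenerated Bᵐᵒᵖ X) :
    ∃ (ι : Type u) (_ : Preorder ι) (_ : IsDirectedOrder ι) (_ : Nonempty ι)
      (U : ι → UnitaryMap Bᵐᵒᵖ C⋆ᵐᵒᵈ(Bᵐᵒᵖ, X × InfSum Bᵐᵒᵖ Y) (InfSum Bᵐᵒᵖ Y)),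
      ∀ a : A, Tendsto
        (fun i => ‖prodRep πX (InfSum.rep πY) a - (U i).conj (InfSum.rep πY a)‖) atTop (𝓝 0) := by
  classical
  choose U _ hU using fun i : Finset A × ℕ =>
    hXY.exists_unitary hX (S := fun _ => i.1) monotone_const (ε := 1 / ((i.2 : ℝ) + 1))
      (by positivity)
  -- A finite set of elements paired with a tolerance $1/(n+1)$, in the product order; this index
  -- type lies in the universe of $A$.
  refine ⟨Finset A × ℕ, inferInstance, inferInstance, inferInstance, U, fun a => ?_⟩
  rw [Metric.tendsto_atTop]
  intro ε hε
  obtain ⟨N, hN⟩ := exists_nat_one_div_lt hε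
  refine ⟨({a}, N), fun i hi => ?_⟩
  have h1 := hU i a (hi.1 (Finset.mem_singleton_self a))
  have h2 : 1 / ((i.2 : ℝ) + 1) ≤ 1 / ((N : ℝ) + 1) := by
    have h3 : (N : ℝ) ≤ i.2 := by exact_mod_cast hi.2
    gcongr
  rw [dist_zero_right, norm_norm]
  linarith

theorem norm_conj_le {D E F : Type*} [NonUnitalCStarAlgebra D] [PartialOrder D] [StarOrderedRing D]
    [NormedAddCommGroup E] [NormedSpace ℂ E] [SMul D E] [CStarModule D E]
    [NormedAddCommGroup F] [NormedSpace ℂ F] [SMul D F] [CStarModule D F] (U : UnitaryMap D E F)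
    (T : AdjEnd D F) : ‖U.conj T‖ ≤ ‖T‖ := by
  have h1 := U.isAdjoint.norm_le_one_of_comp_eq_id U.adj_comp
  have h2 := U.isAdjoint.symm.norm_le_one_of_comp_eq_id U.comp_adj
  calc ‖U.conj T‖ = ‖U.adj ∘L T.val ∘L U.toCLM‖ := rfl
    _ ≤ ‖U.adj‖ * (‖T.val‖ * ‖U.toCLM‖) :=
      (ContinuousLinearMap.opNorm_comp_le _ _).trans
        (by gcongr; exact ContinuousLinearMap.opNorm_comp_le _ _)
    _ ≤ 1 * (‖T.val‖ * 1) := by gcongr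
    _ = ‖T‖ := by rw [one_mul, mul_one, AdjEnd.norm_val]

theorem conj_sub {D E F : Type*} [NonUnitalCStarAlgebra D] [PartialOrder D] [StarOrderedRing D]
    [NormedAddCommGroup E] [NormedSpace ℂ E] [SMul D E] [CStarModule D E]
    [NormedAddCommGroup F] [NormedSpace ℂ F] [SMul D F] [CStarModule D F] (U : UnitaryMap D E F)
    (T S : AdjEnd D F) : U.conj (T - S) = U.conj T - U.conj S := by
  refine AdjEnd.val_injective (ContinuousLinearMap.ext fun x => ?_)
  rw [map_sub]
  change U.adj ((T - S).val (U.toCLM x)) = U.adj (T.val (U.toCLM x)) - U.adj (S.val (U.toCLM x))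
  rw [map_sub AdjEnd.val, sub_apply, map_sub]

/-- `‖π(a) - U⋆ρ(a)U‖` is Lipschitz in `a`. -/
theorem norm_sub_conj_sub_le {D E F : Type*} [NonUnitalCStarAlgebra D] [PartialOrder D]
    [StarOrderedRing D]
    [NormedAddCommGroup E] [NormedSpace ℂ E] [SMul D E] [CStarModule D E] [CompleteSpace E]
    [NormedAddCommGroup F] [NormedSpace ℂ F] [SMul D F] [CStarModule D F] [CompleteSpace F]
    (π : A →⋆ₐ[ℂ] AdjEnd D E) (ρ : A →⋆ₐ[ℂ] AdjEnd D F) (U : UnitaryMap D E F) (a b : A) :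
    ‖(π a - U.conj (ρ a)) - (π b - U.conj (ρ b))‖ ≤ 2 * ‖a - b‖ := by
  have h1 : (π a - U.conj (ρ a)) - (π b - U.conj (ρ b)) = π (a - b) - U.conj (ρ (a - b)) := by
    rw [map_sub, map_sub, conj_sub]
    abel
  rw [h1]
  calc _ ≤ ‖π (a - b)‖ + ‖ρ (a - b)‖ :=
        (norm_sub_le _ _).trans (add_le_add le_rfl (norm_conj_le _ _))
    _ ≤ ‖a - b‖ + ‖a - b‖ := add_le_add (NonUnitalStarAlgHom.norm_apply_le π _)
      (NonUnitalStarAlgHom.norm_apply_le ρ _)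
    _ = _ := by ring

theorem WeaklyContainedUniv.approxUnitarilyEquiv [TopologicalSpace.SeparableSpace A]
    {πX : A →⋆ₐ[ℂ] AdjEnd Bᵐᵒᵖ X} {πY : A →⋆ₐ[ℂ] AdjEnd Bᵐᵒᵖ Y} (hXY : WeaklyContainedUniv πX πY)
    (hX : CountablyGenerated Bᵐᵒᵖ X) :
    ApproxUnitarilyEquiv (prodRep πX (InfSum.rep πY)) (InfSum.rep πY) := by
  classical
  let s : ℕ → A := TopologicalSpace.denseSeq A
  have hs : DenseRange s := TopologicalSpace.denseRange_denseSeq A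
  -- For fixed $n$ the sets exhaust the dense sequence as $k$ grows, which gives compactness for
  -- every $a$ by closedness. The set for $k=0$ contains the first $n+1$ terms, which are the ones
  -- controlled in norm by $U_n$.
  choose U hUK hU using fun n : ℕ =>
    hXY.exists_unitary hX (S := fun k => (Finset.range (n + k + 1)).image s)
      (fun k k' h => Finset.image_subset_image (Finset.range_mono (by omega)))
      (ε := 1 / ((n : ℝ) + 1)) (by positivity)
  refine ⟨U, fun a => ⟨fun n => ?_, ?_⟩⟩
  · have hcont : Continuous fun a : A =>
        prodRep πX (InfSum.rep πY) a - (U n).conj (InfSum.rep πY a) := by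
      refine (LipschitzWith.of_dist_le_mul (K := 2) fun a b => ?_).continuous
      rw [dist_eq_norm, dist_eq_norm]
      exact norm_sub_conj_sub_le _ _ _ a b
    refine hs.induction_on (p := fun a => prodRep πX (InfSum.rep πY) a
      - (U n).conj (InfSum.rep πY a) ∈ Compacts Bᵐᵒᵖ _) a
      (isClosed_compacts.preimage hcont) fun j => ?_
    exact hUK n j (s j) (Finset.mem_image_of_mem _ (Finset.mem_range.2 (by omega)))
  · rw [Metric.tendsto_atTop]
    intro ε hε
    obtain ⟨_, ⟨j, rfl⟩, hj⟩ := Metric.mem_closure_iff.1 (hs a) (ε / 4) (by positivity)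
    obtain ⟨N, hN⟩ := exists_nat_one_div_lt (show 0 < ε / 2 by positivity)
    refine ⟨max N j, fun n hn => ?_⟩
    have h1 := hU n (s j) (Finset.mem_image_of_mem _ (Finset.mem_range.2 (by
      have := (le_max_right N j).trans hn
      omega)))
    have h2 : 1 / ((n : ℝ) + 1) ≤ 1 / ((N : ℝ) + 1) := by
      have h3 : (N : ℝ) ≤ n := by exact_mod_cast (le_max_left N j).trans hn
      gcongr
    have h4 := norm_sub_conj_sub_le (prodRep πX (InfSum.rep πY)) (InfSum.rep πY) (U n) a (s j)
    rw [dist_eq_norm] at hj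
    rw [dist_zero_right, norm_norm]
    have h5 := norm_add_le ((prodRep πX (InfSum.rep πY) a - (U n).conj (InfSum.rep πY a))
      - (prodRep πX (InfSum.rep πY) (s j) - (U n).conj (InfSum.rep πY (s j))))
      (prodRep πX (InfSum.rep πY) (s j) - (U n).conj (InfSum.rep πY (s j)))
    rw [sub_add_cancel] at h5
    linarith

end Forward

/-! ## Weak containment from approximate absorption -/

section Backward

variable {A B X Y H : Type*} [CStarAlgebra A]
  [NonUnitalCStarAlgebra B] [PartialOrder B] [StarOrderedRing B]
  [NormedAddCommGroup X] [NormedSpace ℂ X] [SMul Bᵐᵒᵖ X] [CStarModule Bᵐᵒᵖ X] [CompleteSpace X]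
  [NormedAddCommGroup Y] [NormedSpace ℂ Y] [SMul Bᵐᵒᵖ Y] [CStarModule Bᵐᵒᵖ Y] [CompleteSpace Y]
  [NormedAddCommGroup H] [InnerProductSpace ℂ H] [CompleteSpace H]

/-- The map `ξ ⊗ h ↦ T ξ ⊗ h` on the algebraic tensor product. -/
def tensorMapId (π : B →⋆ₙₐ[ℂ] (H →L[ℂ] H)) (T : X →L[ℂ] Y) : X ⊗[ℂ] H →ₗ[ℂ] IntTensor Y π :=
  (UniformSpace.Completion.toComplL (𝕜 := ℂ) (E := PreTensor Y π)).toLinearMap ∘ₗ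
    (PreTensor.of Y π).toLinearMap ∘ₗ TensorProduct.map (T : X →ₗ[ℂ] Y) LinearMap.id

theorem tensorMapId_tmul (π : B →⋆ₙₐ[ℂ] (H →L[ℂ] H)) (T : X →L[ℂ] Y) (ξ : X) (h : H) :
    tensorMapId π T (ξ ⊗ₜ h) = ((PreTensor.of Y π (T ξ ⊗ₜ h) : PreTensor Y π) : IntTensor Y π) := rfl

theorem tensorMapId_id (π : B →⋆ₙₐ[ℂ] (H →L[ℂ] H)) (u : X ⊗[ℂ] H) :
    tensorMapId π (ContinuousLinearMap.id ℂ X) u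
      = ((PreTensor.of X π u : PreTensor X π) : IntTensor X π) := by
  have h : TensorProduct.map ((ContinuousLinearMap.id ℂ X : X →L[ℂ] X) : X →ₗ[ℂ] X)
      (LinearMap.id : H →ₗ[ℂ] H) = LinearMap.id := by
    exact TensorProduct.map_id
  rw [tensorMapId, LinearMap.comp_apply, LinearMap.comp_apply, h]
  rfl

theorem inner_tensorMapId_tmul (π : B →⋆ₙₐ[ℂ] (H →L[ℂ] H)) (πY : A →⋆ₐ[ℂ] AdjEnd Bᵐᵒᵖ Y)
    (T : X →L[ℂ] Y) (a : A) (x : Commutant π) (ξ ξ' : X) (h h' : H) :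
    ⟪tensorMapId π T (ξ ⊗ₜ h), thetaAlg πY π (a ⊗ₜ x) (tensorMapId π T (ξ' ⊗ₜ h'))⟫_ℂ
      = ⟪h, π (rinner B (T ξ) ((πY a).val (T ξ'))) (x.1 h')⟫_ℂ := by
  rw [tensorMapId_tmul, tensorMapId_tmul, thetaAlg_tmul, tensorOp_coe, tensorLinear_tmul,
    UniformSpace.Completion.inner_coe, PreTensor.inner_def, tensorForm_tmul]

/-- By sesquilinearity everything reduces to elementary tensors. There the scalar is a fixed
continuous functional of a $B$-valued inner product, which converges in $i$ by `hV` and, in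
$Y^\infty$, is a sum over coordinates. Working coordinatewise keeps all vectors in $Y\otimes_BH$. -/
theorem exists_hasSum_tendsto {ι : Type*} {l : Filter ι} (π : B →⋆ₙₐ[ℂ] (H →L[ℂ] H))
    (πX : A →⋆ₐ[ℂ] AdjEnd Bᵐᵒᵖ X) (πY : A →⋆ₐ[ℂ] AdjEnd Bᵐᵒᵖ Y)
    (V : ι → X →L[ℂ] InfSum Bᵐᵒᵖ Y)
    (hV : ∀ a ξ ξ', Tendsto (fun i => (inner Bᵐᵒᵖ (V i ξ) ((InfSum.rep πY a).val (V i ξ')) : Bᵐᵒᵖ)) l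
      (𝓝 (inner Bᵐᵒᵖ ξ ((πX a).val ξ'))))
    (w : A ⊗[ℂ] Commutant π) (u u' : X ⊗[ℂ] H) :
    ∃ φ : ι → ℂ,
      (∀ i, HasSum (fun n => ⟪tensorMapId π (InfSum.proj Bᵐᵒᵖ Y n ∘L V i) u,
        thetaAlg πY π w (tensorMapId π (InfSum.proj Bᵐᵒᵖ Y n ∘L V i) u')⟫_ℂ) (φ i)) ∧
      Tendsto φ l (𝓝 ⟪tensorMapId π (ContinuousLinearMap.id ℂ X) u,
        thetaAlg πX π w (tensorMapId π (ContinuousLinearMap.id ℂ X) u')⟫_ℂ) := by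
  induction w with
  | zero => exact ⟨fun _ => 0, fun i => by simp, by
      simpa using tendsto_const_nhds (x := (0 : ℂ))⟩
  | add w w' hw hw' =>
    obtain ⟨φ, h1, h2⟩ := hw
    obtain ⟨φ', h1', h2'⟩ := hw'
    refine ⟨fun i => φ i + φ' i, fun i => ?_, ?_⟩
    · simpa only [map_add, add_apply, inner_add_right] using (h1 i).add (h1' i)
    · simpa only [map_add, add_apply, inner_add_right] using h2.add h2'
  | tmul a x =>
    induction u with
    | zero => exact ⟨fun _ => 0, fun i => by simp, by
      simpa using tendsto_const_nhds (x := (0 : ℂ))⟩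
    | add u v hu hv =>
      obtain ⟨φ, h1, h2⟩ := hu
      obtain ⟨φ', h1', h2'⟩ := hv
      refine ⟨fun i => φ i + φ' i, fun i => ?_, ?_⟩
      · simpa only [map_add, inner_add_left] using (h1 i).add (h1' i)
      · simpa only [map_add, inner_add_left] using h2.add h2'
    | tmul ξ h =>
      induction u' with
      | zero => exact ⟨fun _ => 0, fun i => by simp, by
      simpa using tendsto_const_nhds (x := (0 : ℂ))⟩
      | add u v hu hv =>
        obtain ⟨φ, h1, h2⟩ := hu
        obtain ⟨φ', h1', h2'⟩ := hv
        refine ⟨fun i => φ i + φ' i, fun i => ?_, ?_⟩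
        · simpa only [map_add, inner_add_right] using (h1 i).add (h1' i)
        · simpa only [map_add, inner_add_right] using h2.add h2'
      | tmul ξ' h' =>
        let f : Bᵐᵒᵖ →+ ℂ :=
          { toFun := fun d => ⟪h, π d.unop (x.1 h')⟫_ℂ
            map_zero' := by simp
            map_add' := fun d d' => by simp }
        have hf : Continuous f := by
          have h1 : Continuous π :=
            AddMonoidHomClass.continuous_of_bound π 1 fun b => by
              rw [one_mul]
              exact NonUnitalStarAlgHom.norm_apply_le π b
          exact continuous_const.inner ((ContinuousLinearMap.apply ℂ H (x.1 h')).continuous.comp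
            (h1.comp MulOpposite.continuous_unop))
        refine ⟨fun i => f (inner Bᵐᵒᵖ (V i ξ) ((InfSum.rep πY a).val (V i ξ'))), fun i => ?_, ?_⟩
        · have h1 := (InfSum.summable_inner (V i ξ) ((InfSum.rep πY a).val (V i ξ'))).hasSum.map f hf
          simp only [inner_tensorMapId_tmul]
          exact h1
        · simp only [inner_tensorMapId_tmul]
          exact (hf.tendsto _).comp (hV a ξ ξ')

theorem inner_star_mul_self {K : Type*} [NormedAddCommGroup K] [InnerProductSpace ℂ K]
    [CompleteSpace K] (T : K →L[ℂ] K) (v : K) : ⟪v, (star T * T) v⟫_ℂ = ((‖T v‖ ^ 2 : ℝ) : ℂ) := by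
  rw [mul_apply_eq_comp, ContinuousLinearMap.star_eq_adjoint,
    ContinuousLinearMap.adjoint_inner_right, inner_self_eq_norm_sq_to_K]
  norm_cast

theorem inner_thetaAlg_star_mul_self (π : B →⋆ₙₐ[ℂ] (H →L[ℂ] H)) (πY : A →⋆ₐ[ℂ] AdjEnd Bᵐᵒᵖ Y)
    (z : A ⊗[ℂ] Commutant π) (v : IntTensor Y π) :
    ⟪v, thetaAlg πY π (star z * z) v⟫_ℂ = ((‖thetaAlg πY π z v‖ ^ 2 : ℝ) : ℂ) := by
  rw [thetaAlg_mul, thetaAlg_star]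
  exact inner_star_mul_self _ _

theorem thetaAlg_one (π : B →⋆ₙₐ[ℂ] (H →L[ℂ] H)) (πY : A →⋆ₐ[ℂ] AdjEnd Bᵐᵒᵖ Y) (v : IntTensor Y π) :
    thetaAlg πY π 1 v = v := by
  have h : thetaAlg πY π 1 = ContinuousLinearMap.id ℂ _ := by
    rw [Algebra.TensorProduct.one_def, thetaAlg_tmul, map_one]
    refine intTensor_ext π fun z => ?_
    rw [tensorOp_coe, tensorLinear_one]
    rfl
  rw [h]
  rfl

/-- $\|\theta_X(z)u\|^2$ is a limit of sums
$\sum_n\|\theta_Y(z)v_n\|^2\le\|\theta_Y(z)\|^2\sum_n\|v_n\|^2$, and the last sums tend to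
$\|u\|^2$. -/
theorem norm_thetaAlg_apply_le {ι : Type*} {l : Filter ι} [l.NeBot] (π : B →⋆ₙₐ[ℂ] (H →L[ℂ] H))
    (πX : A →⋆ₐ[ℂ] AdjEnd Bᵐᵒᵖ X) (πY : A →⋆ₐ[ℂ] AdjEnd Bᵐᵒᵖ Y)
    (V : ι → X →L[ℂ] InfSum Bᵐᵒᵖ Y)
    (hV : ∀ a ξ ξ', Tendsto (fun i => (inner Bᵐᵒᵖ (V i ξ) ((InfSum.rep πY a).val (V i ξ')) : Bᵐᵒᵖ)) l
      (𝓝 (inner Bᵐᵒᵖ ξ ((πX a).val ξ'))))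
    (z : A ⊗[ℂ] Commutant π) (u : X ⊗[ℂ] H) :
    ‖thetaAlg πX π z (tensorMapId π (ContinuousLinearMap.id ℂ X) u)‖
      ≤ ‖thetaAlg πY π z‖ * ‖tensorMapId π (ContinuousLinearMap.id ℂ X) u‖ := by
  obtain ⟨φ, h1, h2⟩ := exists_hasSum_tendsto π πX πY V hV (star z * z) u u
  -- The unit written as $1^*1$ makes the norm of $u$ itself an instance of the same formula.
  obtain ⟨ψ, h3, h4⟩ := exists_hasSum_tendsto π πX πY V hV (star 1 * 1) u u
  simp only [inner_thetaAlg_star_mul_self] at h1 h2 h3 h4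
  have hle : ∀ i, (φ i).re ≤ ‖thetaAlg πY π z‖ ^ 2 * (ψ i).re := fun i => by
    have h5 := Complex.hasSum_re (h1 i)
    have h6 := (Complex.hasSum_re (h3 i)).mul_left (‖thetaAlg πY π z‖ ^ 2)
    refine hasSum_le (fun n => ?_) h5 h6
    rw [thetaAlg_one, Complex.ofReal_re, Complex.ofReal_re, ← mul_pow]
    gcongr
    exact ContinuousLinearMap.le_opNorm _ _
  have hlim := le_of_tendsto_of_tendsto' ((Complex.continuous_re.tendsto _).comp h2)
    (((Complex.continuous_re.tendsto _).comp h4).const_mul (‖thetaAlg πY π z‖ ^ 2)) hle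
  rw [thetaAlg_one, Complex.ofReal_re, Complex.ofReal_re, ← mul_pow] at hlim
  exact abs_le_of_sq_le_sq' hlim (by positivity) |>.2

theorem norm_thetaAlg_le_of_tendsto {ι : Type*} {l : Filter ι} [l.NeBot]
    (π : B →⋆ₙₐ[ℂ] (H →L[ℂ] H))
    (πX : A →⋆ₐ[ℂ] AdjEnd Bᵐᵒᵖ X) (πY : A →⋆ₐ[ℂ] AdjEnd Bᵐᵒᵖ Y)
    (V : ι → X →L[ℂ] InfSum Bᵐᵒᵖ Y)
    (hV : ∀ a ξ ξ', Tendsto (fun i => (inner Bᵐᵒᵖ (V i ξ) ((InfSum.rep πY a).val (V i ξ')) : Bᵐᵒᵖ)) l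
      (𝓝 (inner Bᵐᵒᵖ ξ ((πX a).val ξ'))))
    (z : A ⊗[ℂ] Commutant π) : ‖thetaAlg πX π z‖ ≤ ‖thetaAlg πY π z‖ := by
  refine ContinuousLinearMap.opNorm_le_bound _ (norm_nonneg _) fun v => ?_
  induction v using UniformSpace.Completion.induction_on with
  | hp =>
    exact isClosed_le (thetaAlg πX π z).continuous.norm (continuous_const.mul continuous_norm)
  | ih v =>
    obtain ⟨u, rfl⟩ := (PreTensor.of X π).surjective v
    have h := norm_thetaAlg_apply_le π πX πY V hV z u
    rwa [tensorMapId_id] at h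

theorem weaklyContainedWrt_of_tendsto {ι : Type*} {l : Filter ι} [l.NeBot]
    (π : B →⋆ₙₐ[ℂ] (H →L[ℂ] H))
    (πX : A →⋆ₐ[ℂ] AdjEnd Bᵐᵒᵖ X) (πY : A →⋆ₐ[ℂ] AdjEnd Bᵐᵒᵖ Y)
    (V : ι → X →L[ℂ] InfSum Bᵐᵒᵖ Y)
    (hV : ∀ a ξ ξ', Tendsto (fun i => (inner Bᵐᵒᵖ (V i ξ) ((InfSum.rep πY a).val (V i ξ')) : Bᵐᵒᵖ)) l
      (𝓝 (inner Bᵐᵒᵖ ξ ((πX a).val ξ')))) : WeaklyContainedWrt π πX πY := by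
  have h : ∀ z : MaxTensor A (Commutant π), ‖theta πX π z‖ ≤ ‖theta πY π z‖ := fun z => by
    induction z using UniformSpace.Completion.induction_on with
    | hp => exact isClosed_le (theta πX π).continuous.norm (theta πY π).continuous.norm
    | ih z =>
      obtain ⟨z, rfl⟩ := (PreMax.of A (Commutant π)).surjective z
      rw [theta_coe, theta_coe]
      exact norm_thetaAlg_le_of_tendsto π πX πY V hV z
  intro z hz
  have h1 := h z
  rw [hz, norm_zero] at h1
  exact norm_le_zero_iff.1 h1

/-- Approximate absorption implies weak containment. -/
theorem weaklyContainedUniv_of_tendsto {ι : Type*} {l : Filter ι} [l.NeBot]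
    {πX : A →⋆ₐ[ℂ] AdjEnd Bᵐᵒᵖ X} {πY : A →⋆ₐ[ℂ] AdjEnd Bᵐᵒᵖ Y}
    (U : ι → UnitaryMap Bᵐᵒᵖ C⋆ᵐᵒᵈ(Bᵐᵒᵖ, X × InfSum Bᵐᵒᵖ Y) (InfSum Bᵐᵒᵖ Y))
    (hU : ∀ a : A, Tendsto
      (fun i => ‖prodRep πX (InfSum.rep πY) a - (U i).conj (InfSum.rep πY a)‖) l (𝓝 0)) :
    WeaklyContainedUniv πX πY := by
  -- Restricting $U_i$ to the summand $X$ gives isometries into $Y^\infty$ whose coefficients for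
  -- $\pi_Y^\infty$ are those of $U_i^*\pi_Y^\infty(a)U_i$ on $X$, hence converge to those of
  -- $\pi_X$.
  refine weaklyContainedWrt_of_tendsto (l := l) (univRep B) πX πY
    (fun i => (U i).toCLM ∘L prodInl Bᵐᵒᵖ X (InfSum Bᵐᵒᵖ Y)) fun a ξ ξ' => ?_
  let j := prodInl Bᵐᵒᵖ X (InfSum Bᵐᵒᵖ Y)
  have h1 : Tendsto (fun i => (prodRep πX (InfSum.rep πY) a).val (j ξ')
      - (prodRep πX (InfSum.rep πY) a - (U i).conj (InfSum.rep πY a)).val (j ξ')) l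
      (𝓝 ((prodRep πX (InfSum.rep πY) a).val (j ξ'))) := by
    have h2 : Tendsto (fun i => (prodRep πX (InfSum.rep πY) a
        - (U i).conj (InfSum.rep πY a)).val (j ξ')) l (𝓝 0) := by
      refine squeeze_zero_norm (fun i => AdjEnd.norm_apply_le _ _) ?_
      simpa using (hU a).mul_const ‖j ξ'‖
    simpa using h2.const_sub ((prodRep πX (InfSum.rep πY) a).val (j ξ'))
  have h3 := ((CStarModule.continuous_inner (A := Bᵐᵒᵖ)).tendsto (j ξ, _)).comp
    (tendsto_const_nhds.prodMk_nhds h1)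
  have h4 : (inner Bᵐᵒᵖ (j ξ) ((prodRep πX (InfSum.rep πY) a).val (j ξ')) : Bᵐᵒᵖ)
      = inner Bᵐᵒᵖ ξ ((πX a).val ξ') := isAdjoint_prodInl ξ _
  simp only [h4] at h3
  refine h3.congr fun i => ?_
  simp only [Function.comp_apply, map_sub, sub_apply, sub_sub_cancel]
  exact ((U i).isAdjoint _ _).symm

end Backward

end HilbertMod

end

/-- Absorption theorem for correspondences and weak containment with respect to the universal
representation. Right Hilbert `B`-modules are complete C⋆-modules over `Bᵐᵒᵖ`; nets are indexed by
directed preorders. -/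
theorem theoremB {A : Type u} {B X Y : Type*} [CStarAlgebra A]
    [NonUnitalCStarAlgebra B] [PartialOrder B] [StarOrderedRing B]
    [NormedAddCommGroup X] [NormedSpace ℂ X] [SMul Bᵐᵒᵖ X] [CStarModule Bᵐᵒᵖ X] [CompleteSpace X]
    [NormedAddCommGroup Y] [NormedSpace ℂ Y] [SMul Bᵐᵒᵖ Y] [CStarModule Bᵐᵒᵖ Y] [CompleteSpace Y]
    (hB : SigmaUnital B) (πX : A →⋆ₐ[ℂ] AdjEnd Bᵐᵒᵖ X) (πY : A →⋆ₐ[ℂ] AdjEnd Bᵐᵒᵖ Y)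
    (hX : CountablyGenerated Bᵐᵒᵖ X) :
    (WeaklyContainedUniv πX πY ↔
      ∃ (ι : Type u) (_ : Preorder ι) (_ : IsDirectedOrder ι) (_ : Nonempty ι)
        (U : ι → UnitaryMap Bᵐᵒᵖ C⋆ᵐᵒᵈ(Bᵐᵒᵖ, X × InfSum Bᵐᵒᵖ Y) (InfSum Bᵐᵒᵖ Y)),
        ∀ a : A, Tendsto
          (fun i => ‖prodRep πX (InfSum.rep πY) a - (U i).conj (InfSum.rep πY a)‖) atTop (𝓝 0)) ∧
    (TopologicalSpace.SeparableSpace A →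
      (WeaklyContainedUniv πX πY ↔
        ApproxUnitarilyEquiv (prodRep πX (InfSum.rep πY)) (InfSum.rep πY))) := by
  refine ⟨⟨fun h => h.exists_net hX, ?_⟩, fun _ => ⟨fun h => h.approxUnitarilyEquiv hX, ?_⟩⟩
  · rintro ⟨ι, _, _, _, U, hU⟩
    exact weaklyContainedUniv_of_tendsto U hU
  · rintro ⟨U, hU⟩
    exact weaklyContainedUniv_of_tendsto U fun a => (hU a).2
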